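/- Let $d\ge 2$ be a fixed integer. For a finite set $P\subset[0,1)^d$ of $n$ points, the standard quadtree on $P$ has the root cell $[0,1)^d$, and a cell is split through its center into $2^d$ equal half-open cubes, its children, if and only if it contains at least two points of $P$. The compressed quadtree $\mathcal T_c$ on $P$ is obtained from it by contracting every internal node that has only one child containing a point of $P$; its cells are the leaf cells of the standard quadtree and the cells with at least two children containing a point of $P$. A rectangle is a closed axis-parallel box in $\mathbb R^d$, and a $<_t$-face of a rectangle is a face of dimension smaller than $t$. The model of computation is a word RAM with words of $O(\log n)$ bits, in which real numbers are atomic values that can be moved and compared in constant time. It has the usual constant-time primitive for building compressed quadtrees: for reals $r,s,u,v$ it decides whether $u,v$ differ at an earlier binary digit than $r,s$. Lemma. Let $P\subset[0,1)^d$ be a set of $n\ge 2$ points. One can construct from $P$, in $O(n\log^{d-1}n)$ time, a data structure of size $O(n\log^{d-1}n)$ so that, for every integer $t$ with $0<t\le d$, every rectangle $Q$ and every cell $\square$ of $\mathcal T_c$ that intersects no $<_t$-face of $Q$, the number of points of $P$ contained in $Q\cap\square$ can be computed, given the corners of $Q$ and of $\square$, in $O(\log^{d-t}n+\log n)$ time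 and without changing the data structure. The programs for construction and query and all implied constants depend only on $d$; in particular the query is not told $t$. -/

import Mathlib

namespace RangeCount

/-! ## Rectangles, their faces, and quadtree cells -/

/-- An axis-parallel (closed) rectangle in `d`-dimensional space. -/
structure Rect (d : ℕ) where
  lo : Fin d → ℝ
  hi : Fin d → ℝ
  lo_le_hi : ∀ j, lo j ≤ hi j

/-- The points of a rectangle. -/
def Rect.pts {d : ℕ} (Q : Rect d) : Set (Fin d → ℝ) :=
  {x | ∀ j, Q.lo j ≤ x j ∧ x j ≤ Q.hi j}

/-- The dimension of a rectangle: the number of axes along which it has positive length. -/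
noncomputable def Rect.dim {d : ℕ} (Q : Rect d) : ℕ := {j : Fin d | Q.lo j < Q.hi j}.ncard

/-- `F` is a face of `Q`: along each axis, `F` is either the whole side of `Q` or one of the two
endpoints of that side. The rectangle `Q` itself is one of its faces. -/
def Rect.IsFace {d : ℕ} (F Q : Rect d) : Prop :=
  ∀ j, (F.lo j = Q.lo j ∧ F.hi j = Q.hi j) ∨
    (F.lo j = Q.lo j ∧ F.hi j = Q.lo j) ∨
    (F.lo j = Q.hi j ∧ F.hi j = Q.hi j)

/-- A dyadic cell of side length `2 ^ (-level)`, with lower corner `index / 2 ^ level`. -/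
structure Cell (d : ℕ) where
  level : ℕ
  index : Fin d → ℕ

/-- Lower corner of a cell. -/
noncomputable def Cell.lo {d : ℕ} (c : Cell d) (j : Fin d) : ℝ := (c.index j : ℝ) / 2 ^ c.level

/-- Upper corner of a cell. -/
noncomputable def Cell.hi {d : ℕ} (c : Cell d) (j : Fin d) : ℝ :=
  ((c.index j : ℝ) + 1) / 2 ^ c.level

/-- The points of a cell; cells are half-open, so that the cells of one level are disjoint. -/
def Cell.pts {d : ℕ} (c : Cell d) : Set (Fin d → ℝ) :=
  {x | ∀ j, c.lo j ≤ x j ∧ x j < c.hi j}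

/-- The unit cube `[0,1)^d`. -/
def Cell.root (d : ℕ) : Cell d := ⟨0, fun _ => 0⟩

/-- One of the `2 ^ d` equal cells into which a cell is split. -/
def Cell.child {d : ℕ} (c : Cell d) (b : Fin d → Fin 2) : Cell d :=
  ⟨c.level + 1, fun j => 2 * c.index j + (b j : ℕ)⟩

/-- The cells of the standard quadtree on `P`: the root cell is the unit cube, and a cell is split
into its `2 ^ d` children exactly if it contains at least two points of `P`. -/
inductive StandardCell {d : ℕ} (P : Set (Fin d → ℝ)) : Cell d → Prop
  | root : StandardCell P (Cell.root d)
  | child (c : Cell d) (b : Fin d → Fin 2) :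
      StandardCell P c → (P ∩ c.pts).Nontrivial → StandardCell P (c.child b)

/-- The cells of the compressed quadtree on `P`: the internal nodes of the standard quadtree with
only one nonempty child are contracted away; what remains are the leaves and the nodes with at
least two nonempty children. -/
def CompressedCell {d : ℕ} (P : Set (Fin d → ℝ)) (c : Cell d) : Prop :=
  StandardCell P c ∧
    ((P ∩ c.pts).Subsingleton ∨
      ∃ b b' : Fin d → Fin 2, b ≠ b' ∧ (P ∩ (c.child b).pts).Nonempty ∧
        (P ∩ (c.child b').pts).Nonempty)

/-! ## The machine: a word RAM that handles real numbers as atomic values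

Programs are finite. Registers and memory cells hold either a word (a natural number below the
word bound `W`) or a real number. Reals can be moved and compared, and one can compare the positions
of the first binary digit in which two pairs of reals differ (the usual unit-cost primitive for
building compressed quadtrees); there is no arithmetic on reals. -/

/-- Elementary instructions; the arguments `x y z` name word registers, `r s` real registers. -/
inductive Instr
  | const (x c : ℕ)
  | copy (x y : ℕ)
  | add (x y z : ℕ)
  | sub (x y z : ℕ)
  | mul (x y z : ℕ)
  | div (x y z : ℕ)
  | load (x y : ℕ)
  | store (x y : ℕ)
  | rcopy (r s : ℕ)
  | rload (r x : ℕ)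
  | rstore (x r : ℕ)

/-- Tests; `bitLt r s u v` asks whether the first binary digit in which (the contents of) `u` and
`v` differ comes before the first binary digit in which `r` and `s` differ. -/
inductive Test
  | lt (x y : ℕ)
  | eq (x y : ℕ)
  | rlt (r s : ℕ)
  | bitLt (r s u v : ℕ)

/-- Structured programs. -/
inductive Prog
  | instr (i : Instr)
  | seq (p q : Prog)
  | ite (b : Test) (p q : Prog)
  | loop (b : Test) (p : Prog)

/-- The state of the machine: word registers, real registers, word memory, real memory. -/
structure State where
  reg : ℕ → ℕ
  rreg : ℕ → ℝ
  mem : ℕ → ℕ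
  rmem : ℕ → ℝ

/-- Put the word `v` into the word register `x`. -/
def State.setReg (σ : State) (x v : ℕ) : State := { σ with reg := Function.update σ.reg x v }

/-- Put the real `v` into the real register `r`. -/
def State.setRReg (σ : State) (r : ℕ) (v : ℝ) : State :=
  { σ with rreg := Function.update σ.rreg r v }

/-- The effect of one instruction. -/
def Instr.exec (σ : State) : Instr → State
  | .const x c => σ.setReg x c
  | .copy x y => σ.setReg x (σ.reg y)
  | .add x y z => σ.setReg x (σ.reg y + σ.reg z)
  | .sub x y z => σ.setReg x (σ.reg y - σ.reg z)
  | .mul x y z => σ.setReg x (σ.reg y * σ.reg z)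
  | .div x y z => σ.setReg x (σ.reg y / σ.reg z)
  | .load x y => σ.setReg x (σ.mem (σ.reg y))
  | .store x y => { σ with mem := Function.update σ.mem (σ.reg x) (σ.reg y) }
  | .rcopy r s => σ.setRReg r (σ.rreg s)
  | .rload r x => σ.setRReg r (σ.rmem (σ.reg x))
  | .rstore x r => { σ with rmem := Function.update σ.rmem (σ.reg x) (σ.rreg r) }

/-- An instruction is admissible if the word it produces is smaller than the word bound `W`;
otherwise the machine is stuck. -/
def Instr.Fits (W : ℕ) (σ : State) : Instr → Prop
  | .const _ c => c < W
  | .add _ y z => σ.reg y + σ.reg z < W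
  | .mul _ y z => σ.reg y * σ.reg z < W
  | _ => True

/-- The outcome of a test. In `bitLt`, two reals agree in their binary expansions up to the `k`-th
digit after the point iff the integer parts of their products with `2 ^ k` are equal. -/
def Test.Holds (σ : State) : Test → Prop
  | .lt x y => σ.reg x < σ.reg y
  | .eq x y => σ.reg x = σ.reg y
  | .rlt r s => σ.rreg r < σ.rreg s
  | .bitLt r s u v => ∃ k : ℕ,
      ⌊(2 : ℝ) ^ k * σ.rreg r⌋ = ⌊(2 : ℝ) ^ k * σ.rreg s⌋ ∧
      ⌊(2 : ℝ) ^ k * σ.rreg u⌋ ≠ ⌊(2 : ℝ) ^ k * σ.rreg v⌋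

/-- `Runs W p σ T τ`: with word bound `W`, the program `p` started in state `σ` halts in state `τ`
after `T` steps, where every instruction and every test counts as one step. -/
inductive Runs (W : ℕ) : Prog → State → ℕ → State → Prop
  | instr (i : Instr) (σ : State) : i.Fits W σ → Runs W (.instr i) σ 1 (i.exec σ)
  | seq {p q : Prog} {σ τ ρ : State} {T U : ℕ} :
      Runs W p σ T τ → Runs W q τ U ρ → Runs W (.seq p q) σ (T + U) ρ
  | ite_true {b : Test} {p q : Prog} {σ τ : State} {T : ℕ} :
      b.Holds σ → Runs W p σ T τ → Runs W (.ite b p q) σ (T + 1) τ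
  | ite_false {b : Test} {p q : Prog} {σ τ : State} {T : ℕ} :
      ¬ b.Holds σ → Runs W q σ T τ → Runs W (.ite b p q) σ (T + 1) τ
  | loop_done {b : Test} {p : Prog} {σ : State} :
      ¬ b.Holds σ → Runs W (.loop b p) σ 1 σ
  | loop_step {b : Test} {p : Prog} {σ τ ρ : State} {T U : ℕ} :
      b.Holds σ → Runs W p σ T τ → Runs W (.loop b p) τ U ρ →
        Runs W (.loop b p) σ (T + U + 1) ρ

/-- The input of the construction: word register `0` holds the number `n` of points, coordinate `j`
of point `i` is in cell `i * d + j` of the real memory, and everything else is zero. -/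
def inputState {d n : ℕ} (p : Fin n → Fin d → ℝ) : State where
  reg := fun x => if x = 0 then n else 0
  rreg := fun _ => 0
  mem := fun _ => 0
  rmem := fun a =>
    if h : 0 < d ∧ a / d < n then p ⟨a / d, h.2⟩ ⟨a % d, Nat.mod_lt a h.1⟩ else 0

/-- The start of a query `(Q, c)` to a data structure that consists of the first `S` word cells and
the first `S` real cells of the memory of `σ`. All other cells are erased; so are the registers, and
the real registers from `0` on then receive the lower corner of `Q`, the upper corner of `Q`, the
lower corner of `c` and the upper corner of `c`. -/
noncomputable def queryState {d : ℕ} (σ : State) (S : ℕ) (Q : Rect d) (c : Cell d) : State where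
  reg := fun _ => 0
  rreg := fun r =>
    if h : 0 < d then
      if r / d = 0 then Q.lo ⟨r % d, Nat.mod_lt r h⟩
      else if r / d = 1 then Q.hi ⟨r % d, Nat.mod_lt r h⟩
      else if r / d = 2 then c.lo ⟨r % d, Nat.mod_lt r h⟩
      else if r / d = 3 then c.hi ⟨r % d, Nat.mod_lt r h⟩
      else 0
    else 0
  mem := fun a => if a < S then σ.mem a else 0
  rmem := fun a => if a < S then σ.rmem a else 0

end RangeCount

namespace RangeCount

/-! ## Weakest preconditions with running time -/

/-! Two observations turn a query into range counting with few constraints. Suppose that `Q` meets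
the cell. Pin every coordinate in which `Q` properly cuts the cell to a side of `Q` that reaches
into the cell, and keep the whole side of `Q` in the other coordinates. The resulting face of `Q`
meets the cell, so its dimension is at least `t`, and at most `d - t` coordinates are cut
(`ncard_restricted_le`). The other coordinates impose nothing on points of the cell. As `t` is
positive, there are never more than `d - 1` constraints. Moreover, lying in a dyadic cell means
having a prescribed prefix of the interleaved binary digits, so the points of a cell are contiguous
in the Z-order (`InCell.of_zkey_le`), and binary search replaces the cell by a range of indices
(`cellSearch_spec`).

It remains to count the entries in a range of the Z-ordered sequence whose ranks in some coordinates
lie in given intervals. For one upper bound on a rank, go through the `L = ⌊log₂ n⌋ + 1` bits of the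
rank from the highest one. Stably partitioning the whole sequence by the current bit sends a range
to a range of zeros and a range of ones, whose ends are read off prefix counts (`IsPart.cntP_zeros`,
`IsPart.cntP_ones`). If the bit of the bound is one, the zeros all obey the bound, so they are
counted under the remaining constraints only, and the descent continues in the ones; if the bit is
zero, it continues in the zeros.

The structure `DS` therefore stores, for every coordinate and every bit, the prefix counts, the
partitioned sequence and, on the latter, a structure for one constraint fewer. Each of the `d - 1`
nested stages costs a factor `O(L)` in size and building time. A query pays a factor `O(L)` only for
a constraint that is present, a two-sided one being the difference of two one-sided ones; it detects
the restricted coordinates itself and hence needs no knowledge of `t` (`buildDS_spec`,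
`queryCoords_spec`).

Orders and ranks come from merge sort. The Z-order is compared without arithmetic on reals: find the
coordinate whose first differing digit comes first, and compare the points in that coordinate
(`FirstDiff.lt_iff`). The programs are verified with weakest preconditions that carry running times,
and loop invariants carry a budget for the remaining steps (`wp_loop`). -/

/-- The program `p`, started in `σ`, halts after some number `T` of steps in some state `τ` such
that `Q T τ`. -/
def WP (W : ℕ) (p : Prog) (σ : State) (Q : ℕ → State → Prop) : Prop :=
  ∃ T τ, Runs W p σ T τ ∧ Q T τ

theorem wp_instr {W : ℕ} {i : Instr} {σ : State} {Q : ℕ → State → Prop} :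
    WP W (.instr i) σ Q ↔ i.Fits W σ ∧ Q 1 (i.exec σ) := by
  constructor
  · rintro ⟨T, τ, h, hQ⟩
    cases h with
    | instr _ _ hf => exact ⟨hf, hQ⟩
  · rintro ⟨hf, hQ⟩
    exact ⟨1, _, .instr i σ hf, hQ⟩

theorem wp_seq {W : ℕ} {p q : Prog} {σ : State} {Q : ℕ → State → Prop} :
    WP W (.seq p q) σ Q ↔ WP W p σ fun T τ => WP W q τ fun U ρ => Q (T + U) ρ := by
  constructor
  · rintro ⟨T, τ, h, hQ⟩
    cases h with
    | seq h1 h2 => exact ⟨_, _, h1, _, _, h2, hQ⟩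
  · rintro ⟨T, τ, h1, U, ρ, h2, hQ⟩
    exact ⟨_, _, .seq h1 h2, hQ⟩

theorem wp_ite {W : ℕ} {b : Test} {p q : Prog} {σ : State} {Q : ℕ → State → Prop} :
    WP W (.ite b p q) σ Q ↔ (b.Holds σ → WP W p σ fun T τ => Q (T + 1) τ) ∧
      (¬ b.Holds σ → WP W q σ fun T τ => Q (T + 1) τ) := by
  constructor
  · rintro ⟨T, τ, h, hQ⟩
    cases h with
    | ite_true hb h => exact ⟨fun _ => ⟨_, _, h, hQ⟩, fun hn => absurd hb hn⟩
    | ite_false hb h => exact ⟨fun hn => absurd hn hb, fun _ => ⟨_, _, h, hQ⟩⟩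
  · rintro ⟨h1, h2⟩
    by_cases hb : b.Holds σ
    · obtain ⟨T, τ, h, hQ⟩ := h1 hb
      exact ⟨_, _, .ite_true hb h, hQ⟩
    · obtain ⟨T, τ, h, hQ⟩ := h2 hb
      exact ⟨_, _, .ite_false hb h, hQ⟩

theorem WP.mono {W : ℕ} {p : Prog} {σ : State} {Q Q' : ℕ → State → Prop}
    (h : WP W p σ Q) (hQ : ∀ T τ, Q T τ → Q' T τ) : WP W p σ Q' := by
  obtain ⟨T, τ, hr, hq⟩ := h
  exact ⟨T, τ, hr, hQ _ _ hq⟩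

/-- The loop rule; the invariant carries a budget that pays for the remaining steps. -/
theorem wp_loop {W : ℕ} {b : Test} {p : Prog} (I : ℕ → State → Prop)
    (step : ∀ k σ, I k σ → b.Holds σ → WP W p σ fun T τ => ∃ k', T + 1 + k' ≤ k ∧ I k' τ) :
    ∀ ⦃k : ℕ⦄ ⦃σ : State⦄, I k σ →
      WP W (.loop b p) σ fun T τ => T ≤ k + 1 ∧ ¬ b.Holds τ ∧ ∃ k', I k' τ := by
  intro k
  induction k using Nat.strong_induction_on with
  | _ k ih =>
    intro σ hI
    by_cases hb : b.Holds σ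
    · obtain ⟨T, τ, hr, k', hk, hI'⟩ := step k σ hI hb
      obtain ⟨U, ρ, hr', hU, hn, hI''⟩ := ih k' (by omega) hI'
      exact ⟨_, _, .loop_step hb hr hr', by omega, hn, hI''⟩
    · exact ⟨_, _, .loop_done hb, by omega, hb, _, hI⟩

/-- Register `1` holds the constant `1`. The loop runs `x` up to `y`. -/
def forTo (x y : ℕ) (p : Prog) : Prog := .loop (.lt x y) (.seq p (.instr (.add x x 1)))

theorem wp_forTo {W x y : ℕ} {p : Prog} (N t : ℕ) (I : ℕ → State → Prop) (hN : N < W)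
    (hreg : ∀ k σ, I k σ → σ.reg x = k ∧ σ.reg y = N)
    (step : ∀ k σ, k < N → I k σ → WP W p σ fun T τ =>
      T ≤ t ∧ τ.reg x = k ∧ τ.reg 1 = 1 ∧ I (k + 1) (τ.setReg x (k + 1)))
    ⦃σ : State⦄ (h0 : I 0 σ) :
    WP W (forTo x y p) σ fun T τ => T ≤ N * (t + 2) + 1 ∧ I N τ := by
  have := wp_loop (W := W) (b := .lt x y) (p := .seq p (.instr (.add x x 1)))
    -- Each remaining round pays for the body, for the increment and for the test of the loop.
    (I := fun b σ => ∃ k, k ≤ N ∧ b = (N - k) * (t + 2) ∧ I k σ) (by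
      rintro b σ ⟨k, hk, rfl, hI⟩ hb
      obtain ⟨hx, hy⟩ := hreg k σ hI
      simp only [Test.Holds, hx, hy] at hb
      rw [wp_seq]
      refine (step k σ hb hI).mono ?_
      rintro T τ ⟨hT, hτx, hτ1, hI'⟩
      rw [wp_instr]
      simp only [Instr.Fits, Instr.exec, hτx, hτ1]
      refine ⟨by omega, (N - (k + 1)) * (t + 2), ?_, k + 1, hb, rfl, hI'⟩
      obtain ⟨e, rfl⟩ : ∃ e, N = k + 1 + e := ⟨N - (k + 1), by omega⟩
      rw [show k + 1 + e - k = e + 1 by omega, show k + 1 + e - (k + 1) = e by omega, add_mul]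
      omega) (k := N * (t + 2)) (σ := σ) ⟨0, by omega, by simp, h0⟩
  refine this.mono ?_
  rintro T τ ⟨hT, hb, b, k, hk, -, hI⟩
  obtain ⟨hx, hy⟩ := hreg k τ hI
  simp only [Test.Holds, hx, hy] at hb
  obtain rfl : k = N := by omega
  exact ⟨hT, hI⟩

/-- Sequential composition of a list of programs with a last one. -/
def Prog.block : List Instr → Prog → Prog
  | [], p => p
  | i :: l, p => .seq (.instr i) (Prog.block l p)

/-- A program that does nothing of interest. -/
def Prog.skip : Prog := .instr (.copy 1 1)

theorem setReg_reg_self (σ : State) (x : ℕ) : σ.setReg x (σ.reg x) = σ := by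
  simp [State.setReg]

theorem wp_skip {W : ℕ} {σ : State} {Q : ℕ → State → Prop} :
    WP W .skip σ Q ↔ Q 1 σ := by
  simp [Prog.skip, wp_instr, Instr.Fits, Instr.exec, setReg_reg_self]

/-! ## The Z-order -/

/-- The Z-order key of a point: the interleaved binary expansions of its coordinates. -/
noncomputable def zkey (d : ℕ) (x : ℕ → ℝ) : Lex (ℕ → ℤ) :=
  toLex fun m => ⌊(2 : ℝ) ^ (m / d) * x (m % d)⌋

/-- Agreement of two reals up to the `k`-th binary digit. -/
def Agree (k : ℕ) (a b : ℝ) : Prop := ⌊(2 : ℝ) ^ k * a⌋ = ⌊(2 : ℝ) ^ k * b⌋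

/-- The integer `⌊2 ^ k * b⌋` lies strictly above `2 ^ k * a` and not above `2 ^ k * b`. Multiplied
by `2 ^ (l - k)` it is still an integer that separates the two scaled numbers. -/
theorem floor_lt_floor_of_le {k l : ℕ} {a b : ℝ} (hkl : k ≤ l)
    (h : ⌊(2 : ℝ) ^ k * a⌋ < ⌊(2 : ℝ) ^ k * b⌋) : ⌊(2 : ℝ) ^ l * a⌋ < ⌊(2 : ℝ) ^ l * b⌋ := by
  obtain ⟨e, rfl⟩ := Nat.exists_eq_add_of_le hkl
  have h1 : (2 : ℝ) ^ k * a < ⌊(2 : ℝ) ^ k * b⌋ := Int.floor_lt.1 h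
  have h2 : (⌊(2 : ℝ) ^ k * b⌋ : ℝ) ≤ (2 : ℝ) ^ k * b := Int.floor_le _
  have he : (0 : ℝ) < 2 ^ e := by positivity
  have key : (((2 : ℤ) ^ e * ⌊(2 : ℝ) ^ k * b⌋ : ℤ) : ℝ) = 2 ^ e * (⌊(2 : ℝ) ^ k * b⌋ : ℝ) := by
    push_cast; ring
  refine lt_of_lt_of_le (b := (2 : ℤ) ^ e * ⌊(2 : ℝ) ^ k * b⌋) ?_ ?_
  · rw [Int.floor_lt, key, pow_add]
    nlinarith
  · rw [Int.le_floor, key, pow_add]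
    nlinarith

theorem Agree.anti {k l : ℕ} {a b : ℝ} (hkl : k ≤ l) (h : Agree l a b) : Agree k a b := by
  by_contra hn
  rcases lt_or_gt_of_ne hn with hlt | hlt
  · exact absurd h (floor_lt_floor_of_le hkl hlt).ne
  · exact absurd h (floor_lt_floor_of_le hkl hlt).ne'

/-- Once `2 ^ k * (b - a)` exceeds `1`, the two scaled numbers cannot share an integer part. -/
theorem exists_not_agree_of_lt {a b : ℝ} (h : a < b) : ∃ k, ¬ Agree k a b := by
  obtain ⟨k, hk⟩ := pow_unbounded_of_one_lt (1 / (b - a)) (one_lt_two (α := ℝ))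
  refine ⟨k, fun hag => ?_⟩
  have hpos : 0 < b - a := sub_pos.2 h
  rw [div_lt_iff₀ hpos] at hk
  have h1 := Int.floor_le ((2 : ℝ) ^ k * b)
  have h2 := Int.lt_floor_add_one ((2 : ℝ) ^ k * b)
  have h3 := Int.floor_le ((2 : ℝ) ^ k * a)
  unfold Agree at hag
  rw [hag] at h3
  have h4 := Int.lt_floor_add_one ((2 : ℝ) ^ k * a)
  rw [hag] at h4
  nlinarith

theorem lt_iff_floor_lt {k : ℕ} {a b : ℝ} (h : ¬ Agree k a b) :
    a < b ↔ ⌊(2 : ℝ) ^ k * a⌋ < ⌊(2 : ℝ) ^ k * b⌋ := by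
  have h2 : (0 : ℝ) < 2 ^ k := by positivity
  constructor
  · intro hab
    exact lt_of_le_of_ne (Int.floor_mono (by nlinarith)) h
  · intro hab
    by_contra hn
    exact absurd hab (not_lt.2 (Int.floor_mono (by nlinarith)))

theorem zkey_lt_iff {d : ℕ} {x y : ℕ → ℝ} :
    zkey d x < zkey d y ↔ ∃ m, (∀ m' < m, Agree (m' / d) (x (m' % d)) (y (m' % d))) ∧
      ⌊(2 : ℝ) ^ (m / d) * x (m % d)⌋ < ⌊(2 : ℝ) ^ (m / d) * y (m % d)⌋ := Iff.rfl

/-- Among the coordinates below `j`, the coordinate `i` is the one in which `x` and `y` differ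
first, in the order of the interleaved digits. -/
def FirstDiff (x y : ℕ → ℝ) (j i : ℕ) : Prop :=
  i < j ∧ (∀ i' < j, ∀ k, Agree k (x i) (y i) → Agree k (x i') (y i')) ∧
    ((∃ k, ¬ Agree k (x i) (y i)) →
      ∃ k, ¬ Agree k (x i) (y i) ∧ ∀ i' < i, Agree k (x i') (y i'))

theorem firstDiff_one (x y : ℕ → ℝ) : FirstDiff x y 1 0 := by
  refine ⟨by omega, fun i' hi' k h => ?_, fun ⟨k, hk⟩ => ⟨k, hk, by simp⟩⟩
  obtain rfl : i' = 0 := by omega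
  exact h

/-- A tie keeps the earlier coordinate, because within one level the digits are interleaved in the
order of the coordinates. A later coordinate takes over only if it differs at a strictly earlier
level, which is what `Test.bitLt` decides. -/
theorem FirstDiff.keep {x y : ℕ → ℝ} {j i : ℕ} (h : FirstDiff x y j i)
    (hj : ¬ ∃ k, Agree k (x i) (y i) ∧ ¬ Agree k (x j) (y j)) : FirstDiff x y (j + 1) i := by
  obtain ⟨h1, h2, h3⟩ := h
  refine ⟨by omega, fun i' hi' k hk => ?_, h3⟩
  rcases Nat.lt_succ_iff_lt_or_eq.1 hi' with hlt | rfl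
  · exact h2 i' hlt k hk
  · by_contra hn
    exact hj ⟨k, hk, hn⟩

theorem FirstDiff.replace {x y : ℕ → ℝ} {j i : ℕ} (h : FirstDiff x y j i)
    (hj : ∃ k, Agree k (x i) (y i) ∧ ¬ Agree k (x j) (y j)) : FirstDiff x y (j + 1) j := by
  obtain ⟨h1, h2, h3⟩ := h
  obtain ⟨k, hk, hk'⟩ := hj
  refine ⟨by omega, fun i' hi' k' h' => ?_, fun _ => ⟨k, hk', fun i' hi' => h2 i' hi' k hk⟩⟩
  rcases Nat.lt_succ_iff_lt_or_eq.1 hi' with hlt | rfl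
  · refine h2 i' hlt k' (hk.anti ?_)
    by_contra hn
    exact hk' (h'.anti (by omega))
  · exact h'

theorem div_mod_of_lt {d k i : ℕ} (hi : i < d) :
    (k * d + i) / d = k ∧ (k * d + i) % d = i := by
  have hd : 0 < d := by omega
  constructor
  · rw [add_comm, Nat.add_mul_div_right _ _ hd, Nat.div_eq_of_lt hi, zero_add]
  · rw [add_comm, Nat.add_mul_mod_self_right, Nat.mod_eq_of_lt hi]

/-- Reduces the Z-order to a single comparison of reals. If `k0` is the first level at which
coordinate `i` differs, then `k0 * d + i` is the first position at which the keys differ, and the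
entries there are ordered like the two reals. If coordinate `i` never differs, no coordinate does,
and both sides fail. -/
theorem FirstDiff.lt_iff {d i : ℕ} {x y : ℕ → ℝ} (h : FirstDiff x y d i) :
    x i < y i ↔ zkey d x < zkey d y := by
  obtain ⟨h1, h2, h3⟩ := h
  have hd : 0 < d := by omega
  by_cases hex : ∃ k, ¬ Agree k (x i) (y i)
  · classical
    obtain ⟨k0, hk0, hmin⟩ : ∃ k, ¬ Agree k (x i) (y i) ∧ ∀ k' < k, Agree k' (x i) (y i) :=
      ⟨Nat.find hex, Nat.find_spec hex, fun k' hk' => not_not.1 (Nat.find_min hex hk')⟩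
    obtain ⟨k, hk, hki⟩ := h3 hex
    have hkk : k0 ≤ k := by
      by_contra hn
      exact hk (hmin k (by omega))
    -- A position before `k0 * d + i` belongs to an earlier level, or to the same level and an
    -- earlier coordinate.
    have hbefore : ∀ m' < k0 * d + i, Agree (m' / d) (x (m' % d)) (y (m' % d)) := by
      intro m' hm'
      have hmod := Nat.mod_lt m' hd
      have hdm := Nat.div_add_mod' m' d
      have hle : m' / d ≤ k0 := by
        by_contra hn
        have : (k0 + 1) * d ≤ m' / d * d := Nat.mul_le_mul_right _ (by omega)
        rw [add_mul] at this
        omega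
      rcases hle.lt_or_eq with hlt | heq
      · exact h2 _ hmod _ (hmin _ hlt)
      · have : m' % d < i := by rw [heq] at hdm; omega
        rw [heq]
        exact (hki _ this).anti hkk
    obtain ⟨e1, e2⟩ := div_mod_of_lt (k := k0) h1
    rw [lt_iff_floor_lt hk0, zkey_lt_iff]
    constructor
    · intro hlt
      exact ⟨k0 * d + i, hbefore, by rw [e1, e2]; exact hlt⟩
    · rintro ⟨m, hm, hlt⟩
      rcases lt_trichotomy m (k0 * d + i) with hlt' | rfl | hlt'
      · exact absurd (hbefore m hlt') hlt.ne
      · rwa [e1, e2] at hlt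
      · have := hm _ hlt'
        rw [e1, e2] at this
        exact absurd this hk0
  · push Not at hex
    constructor
    · intro hlt
      obtain ⟨k, hk⟩ := exists_not_agree_of_lt hlt
      exact absurd (hex k) hk
    · intro hlt
      obtain ⟨m, -, hm⟩ := zkey_lt_iff.1 hlt
      exact absurd (h2 _ (Nat.mod_lt m hd) _ (hex _)) hm.ne

/-- Membership in the dyadic cell of level `ℓ` with the given index. -/
def InCell (d ℓ : ℕ) (idx : ℕ → ℕ) (x : ℕ → ℝ) : Prop :=
  ∀ j < d, (idx j : ℝ) / 2 ^ ℓ ≤ x j ∧ x j < ((idx j : ℝ) + 1) / 2 ^ ℓ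

/-- Being in a cell is agreement with its lower corner through level `ℓ`, hence a condition on a
prefix of the key. This is the source of contiguity in the Z-order. -/
theorem inCell_iff {d ℓ : ℕ} {idx : ℕ → ℕ} {x : ℕ → ℝ} :
    InCell d ℓ idx x ↔ ∀ j < d, Agree ℓ (x j) ((idx j : ℝ) / 2 ^ ℓ) := by
  refine forall₂_congr fun j _ => ?_
  have h2 : (0 : ℝ) < 2 ^ ℓ := by positivity
  unfold Agree
  rw [mul_div_cancel₀ _ h2.ne', Int.floor_natCast, Int.floor_eq_iff, div_le_iff₀ h2,
    lt_div_iff₀ h2, mul_comm (x j)]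
  simp

theorem zkey_mono {d : ℕ} (hd : 0 < d) {x y : ℕ → ℝ} (h : ∀ j < d, x j ≤ y j) :
    zkey d x ≤ zkey d y := by
  refine Pi.toLex_monotone fun m => Int.floor_mono ?_
  have := h _ (Nat.mod_lt m hd)
  gcongr

theorem InCell.le_zkey {d ℓ : ℕ} {idx : ℕ → ℕ} {x : ℕ → ℝ} (hd : 0 < d) (h : InCell d ℓ idx x) :
    zkey d (fun j => (idx j : ℝ) / 2 ^ ℓ) ≤ zkey d x :=
  zkey_mono hd fun j hj => (h j hj).1

/-- The points of a cell are contiguous in the Z-order. -/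
theorem InCell.of_zkey_le {d ℓ : ℕ} {idx : ℕ → ℕ} {x y : ℕ → ℝ} (hd : 0 < d)
    (h : InCell d ℓ idx y) (hxy : zkey d x ≤ zkey d y) :
    zkey d x < zkey d (fun j => (idx j : ℝ) / 2 ^ ℓ) ∨ InCell d ℓ idx x := by
  rw [inCell_iff] at h ⊢
  rcases hxy.lt_or_eq with hlt | heq
  · obtain ⟨m, hm, hlt⟩ := zkey_lt_iff.1 hlt
    -- If the keys of `x` and `y` first differ within level `ℓ`, then `y` agrees with the corner
    -- there, so `x` precedes the corner. If they differ later, `x` shares with `y` the whole prefix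
    -- that defines the cell.
    by_cases hml : m / d ≤ ℓ
    · left
      refine zkey_lt_iff.2 ⟨m, fun m' hm' => ?_, ?_⟩
      · have h1 := hm m' hm'
        have h2 := (h _ (Nat.mod_lt m' hd)).anti ((Nat.div_le_div_right hm'.le).trans hml)
        exact Eq.trans h1 h2
      · have h2 := (h _ (Nat.mod_lt m hd)).anti hml
        exact lt_of_lt_of_eq hlt h2
    · right
      intro j hj
      have hlt' : ℓ * d + j < m := by
        have : (ℓ + 1) * d ≤ m / d * d := Nat.mul_le_mul_right _ (by omega)
        have := Nat.div_mul_le_self m d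
        rw [add_mul] at *
        omega
      obtain ⟨e1, e2⟩ := div_mod_of_lt (k := ℓ) hj
      have h1 := hm _ hlt'
      rw [e1, e2] at h1
      exact Eq.trans h1 (h j hj)
  · right
    intro j hj
    obtain ⟨e1, e2⟩ := div_mod_of_lt (k := ℓ) hj
    have h1 := congrFun (congrArg ofLex heq) (ℓ * d + j)
    simp only [zkey, ofLex_toLex, e1, e2] at h1
    exact Eq.trans h1 (h j hj)

/-! ## Counting in sequences -/

open Classical in
/-- The number of `i` with `l ≤ i < r` and `P i`. -/
noncomputable def cntP (P : ℕ → Prop) (l r : ℕ) : ℕ := ((Finset.Ico l r).filter P).card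

theorem cntP_self (P : ℕ → Prop) (l : ℕ) : cntP P l l = 0 := by simp [cntP]

theorem cntP_succ_of {P : ℕ → Prop} {l r : ℕ} (h : l ≤ r) (hP : P r) :
    cntP P l (r + 1) = cntP P l r + 1 := by
  classical
  unfold cntP
  rw [← Finset.insert_Ico_right_eq_Ico_add_one h, Finset.filter_insert, if_pos hP,
    Finset.card_insert_of_notMem (by simp)]

theorem cntP_succ_of_not {P : ℕ → Prop} {l r : ℕ} (h : l ≤ r) (hP : ¬ P r) :
    cntP P l (r + 1) = cntP P l r := by
  classical
  unfold cntP
  rw [← Finset.insert_Ico_right_eq_Ico_add_one h, Finset.filter_insert, if_neg hP]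

theorem cntP_congr {P Q : ℕ → Prop} {l r : ℕ} (h : ∀ i, l ≤ i → i < r → (P i ↔ Q i)) :
    cntP P l r = cntP Q l r := by
  classical
  unfold cntP
  congr 1
  refine Finset.filter_congr fun i hi => ?_
  rw [Finset.mem_Ico] at hi
  exact h i hi.1 hi.2

theorem cntP_add_of_disjoint {P Q : ℕ → Prop} {l r : ℕ} (h : ∀ i, ¬ (P i ∧ Q i)) :
    cntP (fun i => P i ∨ Q i) l r = cntP P l r + cntP Q l r := by
  classical
  unfold cntP
  rw [← Finset.card_union_of_disjoint, ← Finset.filter_or]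
  · congr
  · rw [Finset.disjoint_filter]
    exact fun i _ hp hq => h i ⟨hp, hq⟩

theorem cntP_append (P : ℕ → Prop) {l m r : ℕ} (h1 : l ≤ m) (h2 : m ≤ r) :
    cntP P l r = cntP P l m + cntP P m r := by
  classical
  unfold cntP
  rw [← Finset.Ico_union_Ico_eq_Ico h1 h2, Finset.filter_union, Finset.card_union_of_disjoint]
  exact Finset.disjoint_filter_filter (Finset.Ico_disjoint_Ico_consecutive l m r)

theorem cntP_mono_right (P : ℕ → Prop) {l m r : ℕ} (h1 : l ≤ m) (h2 : m ≤ r) :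
    cntP P l m ≤ cntP P l r := by
  rw [cntP_append P h1 h2]; omega

theorem cntP_le (P : ℕ → Prop) (l r : ℕ) : cntP P l r ≤ r - l := by
  classical
  exact (Finset.card_filter_le _ _).trans (by simp)

theorem cntP_eq_zero {P : ℕ → Prop} {l r : ℕ} :
    cntP P l r = 0 ↔ ∀ i, l ≤ i → i < r → ¬ P i := by
  classical
  simp [cntP, Finset.filter_eq_empty_iff]

theorem cntP_true {P : ℕ → Prop} {l r : ℕ} (h : ∀ i, l ≤ i → i < r → P i) :
    cntP P l r = r - l := by
  classical
  unfold cntP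
  rw [Finset.filter_true_of_mem, Nat.card_Ico]
  intro i hi
  rw [Finset.mem_Ico] at hi
  exact h i hi.1 hi.2

/-! ## Stable partition of a sequence by one bit -/

/-- The number of zero bits among the first `i` entries of `A`. -/
noncomputable def zeros (b A : ℕ → ℕ) (i : ℕ) : ℕ := cntP (fun u => b (A u) = 0) 0 i

/-- `A'` is the stable partition of the first `n` entries of `A` by the bit `b`. -/
def IsPart (n : ℕ) (b A A' : ℕ → ℕ) : Prop :=
  ∀ i < n, (b (A i) = 0 → A' (zeros b A i) = A i) ∧
    (b (A i) ≠ 0 → A' (zeros b A n + i - zeros b A i) = A i)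

theorem zeros_zero (b A : ℕ → ℕ) : zeros b A 0 = 0 := cntP_self _ _

theorem zeros_le (b A : ℕ → ℕ) (i : ℕ) : zeros b A i ≤ i := cntP_le _ _ _

theorem zeros_mono (b A : ℕ → ℕ) {i j : ℕ} (h : i ≤ j) : zeros b A i ≤ zeros b A j :=
  cntP_mono_right _ (Nat.zero_le _) h

theorem zeros_succ_of {b A : ℕ → ℕ} {i : ℕ} (h : b (A i) = 0) :
    zeros b A (i + 1) = zeros b A i + 1 := cntP_succ_of (Nat.zero_le _) h

theorem zeros_succ_of_not {b A : ℕ → ℕ} {i : ℕ} (h : b (A i) ≠ 0) :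
    zeros b A (i + 1) = zeros b A i := cntP_succ_of_not (Nat.zero_le _) h

theorem sub_zeros_mono (b A : ℕ → ℕ) {i j : ℕ} (h : i ≤ j) :
    i - zeros b A i ≤ j - zeros b A j := by
  induction j, h using Nat.le_induction with
  | base => rfl
  | succ j hj ih =>
    have := zeros_le b A j
    by_cases hb : b (A j) = 0
    · rw [zeros_succ_of hb]; omega
    · rw [zeros_succ_of_not hb]; omega

/-- Stability is what matters here: the zero entries at the positions from `l` up to `r` keep their
order and become consecutive, so a range is mapped to a range and `ψ` can be counted after the
partition. -/
theorem IsPart.cntP_zeros {n : ℕ} {b A A' : ℕ → ℕ} (h : IsPart n b A A') (ψ : ℕ → Prop) {l r : ℕ}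
    (hlr : l ≤ r) (hr : r ≤ n) :
    cntP (fun i => b (A i) = 0 ∧ ψ (A i)) l r =
      cntP (fun i => ψ (A' i)) (zeros b A l) (zeros b A r) := by
  induction r, hlr using Nat.le_induction with
  | base => rw [cntP_self, cntP_self]
  | succ r hlr ih =>
    have ih := ih (by omega)
    have hm := zeros_mono b A hlr
    by_cases hb : b (A r) = 0
    · rw [zeros_succ_of hb]
      have e := (h r (by omega)).1 hb
      by_cases hψ : ψ (A r)
      · rw [cntP_succ_of hlr ⟨hb, hψ⟩, cntP_succ_of hm (by rwa [e]), ih]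
      · rw [cntP_succ_of_not hlr (fun hh => hψ hh.2), cntP_succ_of_not hm (by rwa [e]), ih]
    · rw [zeros_succ_of_not hb, cntP_succ_of_not hlr (fun hh => hb hh.1), ih]

theorem IsPart.cntP_ones {n : ℕ} {b A A' : ℕ → ℕ} (h : IsPart n b A A') (ψ : ℕ → Prop) {l r : ℕ}
    (hlr : l ≤ r) (hr : r ≤ n) :
    cntP (fun i => b (A i) ≠ 0 ∧ ψ (A i)) l r =
      cntP (fun i => ψ (A' i)) (zeros b A n + l - zeros b A l)
        (zeros b A n + r - zeros b A r) := by
  induction r, hlr using Nat.le_induction with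
  | base => rw [cntP_self, cntP_self]
  | succ r hlr ih =>
    have ih := ih (by omega)
    have hm := sub_zeros_mono b A hlr
    have h1 := zeros_le b A l
    have h2 := zeros_le b A r
    by_cases hb : b (A r) = 0
    · rw [zeros_succ_of hb, cntP_succ_of_not hlr (fun hh => hh.1 hb), ih]
      congr 1
      omega
    · rw [zeros_succ_of_not hb]
      have e := (h r (by omega)).2 hb
      rw [show zeros b A n + (r + 1) - zeros b A r = zeros b A n + r - zeros b A r + 1 by omega]
      by_cases hψ : ψ (A r)
      · rw [cntP_succ_of hlr ⟨hb, hψ⟩, cntP_succ_of (by omega) (by rwa [e]), ih]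
      · rw [cntP_succ_of_not hlr (fun hh => hψ hh.2), cntP_succ_of_not (by omega) (by rwa [e]), ih]

theorem IsPart.lt {n : ℕ} {b A A' : ℕ → ℕ} (h : IsPart n b A A') {N : ℕ} (hA : ∀ i < n, A i < N) :
    ∀ i < n, A' i < N := by
  intro i hi
  -- No entry of `A` violates the bound, and the image ranges of the zeros and of the ones together
  -- exhaust the first `n` entries of `A'`.
  have h1 := h.cntP_zeros (fun v => ¬ v < N) (Nat.zero_le n) le_rfl
  have h2 := h.cntP_ones (fun v => ¬ v < N) (Nat.zero_le n) le_rfl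
  rw [cntP_eq_zero.2 (fun i _ hi => by simp [hA i hi])] at h1 h2
  have h1 := cntP_eq_zero.1 h1.symm i
  have h2 := cntP_eq_zero.1 h2.symm i
  rw [zeros_zero] at h1 h2
  rcases lt_or_ge i (zeros b A n) with hlt | hge
  · exact not_not.1 (h1 (Nat.zero_le _) hlt)
  · exact not_not.1 (h2 (by omega) (by omega))

/-- The leading bit decides the comparison of two numbers of `e + 1` bits, and a tie leaves the
comparison of the lower `e` bits. This drives the descent through the ranks. -/
theorem lt_mod_pow_succ_iff {x v e : ℕ} :
    x % 2 ^ (e + 1) < v % 2 ^ (e + 1) ↔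
      (x / 2 ^ e % 2 < v / 2 ^ e % 2) ∨
        (x / 2 ^ e % 2 = v / 2 ^ e % 2 ∧ x % 2 ^ e < v % 2 ^ e) := by
  rw [Nat.mod_pow_succ, Nat.mod_pow_succ]
  have hx := Nat.mod_lt x (show 2 ^ e > 0 by positivity)
  have hv := Nat.mod_lt v (show 2 ^ e > 0 by positivity)
  rcases Nat.mod_two_eq_zero_or_one (x / 2 ^ e) with h1 | h1 <;>
  rcases Nat.mod_two_eq_zero_or_one (v / 2 ^ e) with h2 | h2 <;> rw [h1, h2] <;> simp <;> omega

/-- One step of dominance counting, when the bit of the bound is `1`. -/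
theorem IsPart.cntP_step_one {n e v : ℕ} {rk A A' : ℕ → ℕ}
    (h : IsPart n (fun u => rk u / 2 ^ e % 2) A A') (ψ : ℕ → Prop) {l r : ℕ} (hlr : l ≤ r)
    (hr : r ≤ n) (hv : v / 2 ^ e % 2 = 1) :
    cntP (fun i => rk (A i) % 2 ^ (e + 1) < v % 2 ^ (e + 1) ∧ ψ (A i)) l r =
      cntP (fun i => ψ (A' i)) (zeros (fun u => rk u / 2 ^ e % 2) A l)
          (zeros (fun u => rk u / 2 ^ e % 2) A r) +
        cntP (fun i => rk (A' i) % 2 ^ e < v % 2 ^ e ∧ ψ (A' i))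
          (zeros (fun u => rk u / 2 ^ e % 2) A n + l - zeros (fun u => rk u / 2 ^ e % 2) A l)
          (zeros (fun u => rk u / 2 ^ e % 2) A n + r - zeros (fun u => rk u / 2 ^ e % 2) A r) := by
  rw [← h.cntP_zeros ψ hlr hr, ← h.cntP_ones (fun u => rk u % 2 ^ e < v % 2 ^ e ∧ ψ u) hlr hr,
    ← cntP_add_of_disjoint (fun i hi => hi.2.1 hi.1.1)]
  refine cntP_congr fun i _ _ => ?_
  rw [lt_mod_pow_succ_iff, hv]
  rcases Nat.mod_two_eq_zero_or_one (rk (A i) / 2 ^ e) with h1 | h1 <;> simp [h1]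

/-- One step of dominance counting, when the bit of the bound is `0`. -/
theorem IsPart.cntP_step_zero {n e v : ℕ} {rk A A' : ℕ → ℕ}
    (h : IsPart n (fun u => rk u / 2 ^ e % 2) A A') (ψ : ℕ → Prop) {l r : ℕ} (hlr : l ≤ r)
    (hr : r ≤ n) (hv : v / 2 ^ e % 2 = 0) :
    cntP (fun i => rk (A i) % 2 ^ (e + 1) < v % 2 ^ (e + 1) ∧ ψ (A i)) l r =
      cntP (fun i => rk (A' i) % 2 ^ e < v % 2 ^ e ∧ ψ (A' i))
          (zeros (fun u => rk u / 2 ^ e % 2) A l) (zeros (fun u => rk u / 2 ^ e % 2) A r) := by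
  rw [← h.cntP_zeros (fun u => rk u % 2 ^ e < v % 2 ^ e ∧ ψ u) hlr hr]
  refine cntP_congr fun i _ _ => ?_
  rw [lt_mod_pow_succ_iff, hv]
  simp [and_assoc]

/-- A two-sided bound is the difference of two one-sided bounds. -/
theorem cntP_between {f : ℕ → ℕ} {ψ : ℕ → Prop} {a b l r : ℕ} (hab : a ≤ b) :
    cntP (fun i => (a ≤ f i ∧ f i < b) ∧ ψ i) l r + cntP (fun i => f i < a ∧ ψ i) l r =
      cntP (fun i => f i < b ∧ ψ i) l r := by
  rw [← cntP_add_of_disjoint (fun i hi => absurd hi.2.1 (not_lt.2 hi.1.1.1))]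
  refine cntP_congr fun i _ _ => ?_
  constructor
  · rintro (h | h)
    · exact ⟨h.1.2, h.2⟩
    · exact ⟨by omega, h.2⟩
  · rintro ⟨h1, h2⟩
    rcases le_or_gt a (f i) with h | h
    · exact Or.inl ⟨⟨h, h1⟩, h2⟩
    · exact Or.inr ⟨h, h2⟩

/-! ## Leaf routines: comparing points -/

/-- Between `σ` and `τ` only the word registers in `S` and the real registers from `4 * d` on have
changed. -/
structure Frame (d : ℕ) (S : ℕ → Prop) (σ τ : State) : Prop where
  reg : ∀ x, ¬ S x → τ.reg x = σ.reg x
  rreg : ∀ r < 4 * d, τ.rreg r = σ.rreg r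
  mem : τ.mem = σ.mem
  rmem : τ.rmem = σ.rmem

theorem Frame.refl (d : ℕ) (S : ℕ → Prop) (σ : State) : Frame d S σ σ :=
  ⟨fun _ _ => rfl, fun _ _ => rfl, rfl, rfl⟩

theorem Frame.trans {d : ℕ} {S : ℕ → Prop} {σ τ ρ : State} (h : Frame d S σ τ)
    (h' : Frame d S τ ρ) : Frame d S σ ρ :=
  ⟨fun x hx => (h'.reg x hx).trans (h.reg x hx), fun r hr => (h'.rreg r hr).trans (h.rreg r hr),
    h'.mem.trans h.mem, h'.rmem.trans h.rmem⟩

theorem Frame.comp {d : ℕ} {S : ℕ → Prop} {σ τ ρ : State} (h' : Frame d S τ ρ)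
    (h : Frame d S σ τ) : Frame d S σ ρ := h.trans h'

theorem Frame.mono {d : ℕ} {S S' : ℕ → Prop} {σ τ : State} (h : Frame d S σ τ)
    (hS : ∀ x, S x → S' x) : Frame d S' σ τ :=
  ⟨fun x hx => h.reg x fun hx' => hx (hS x hx'), h.rreg, h.mem, h.rmem⟩

/-- The registers that leaf routines may change. -/
def LeafReg (x : ℕ) : Prop := x = 12 ∨ x = 13 ∨ x = 14

/-- The routine `f q j` loads the `j`-th entry of `x` into the real register `q`. -/
def Fetches (W d : ℕ) (f : ℕ → ℕ → Prog) (x : ℕ → ℝ) (σ₀ : State) : Prop :=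
  ∀ σ, Frame d LeafReg σ₀ σ → ∀ q, 4 * d ≤ q → ∀ j < d, WP W (f q j) σ fun T τ =>
    T ≤ 5 ∧ Frame d LeafReg σ τ ∧ τ.rreg = Function.update σ.rreg q (x j)

theorem Fetches.congr {W d : ℕ} {f : ℕ → ℕ → Prog} {x : ℕ → ℝ} {σ τ : State}
    (h : Fetches W d f x σ) (hστ : Frame d LeafReg σ τ) : Fetches W d f x τ :=
  fun ρ hρ => h ρ (hστ.trans hρ)

/-- Load coordinate `j` of the point with index in register `u`. -/
def fetchPoint (d u q j : ℕ) : Prog :=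
  .block [.const 12 d, .mul 12 u 12, .const 13 j, .add 12 12 13] (.instr (.rload q 12))

/-- Load coordinate `j` of the corner that starts at the real register `s`. -/
def fetchReg (s q j : ℕ) : Prog := .instr (.rcopy q (s + j))

theorem fetches_point {W d n u v : ℕ} (hn : n * d < W) (hu : u = 10 ∨ u = 11) {σ : State}
    (hv : σ.reg u = v) (hvn : v < n) :
    Fetches W d (fetchPoint d u) (fun j => σ.rmem (v * d + j)) σ := by
  intro ρ hρ q hq j hj
  have h1 : ρ.reg u = v := by
    rw [hρ.reg u (by rcases hu with rfl | rfl <;> simp [LeafReg]), hv]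
  have h2 : (v + 1) * d ≤ n * d := Nat.mul_le_mul_right _ hvn
  rw [add_mul, one_mul] at h2
  have hu12 : u ≠ 12 := by omega
  simp only [fetchPoint, Prog.block, wp_seq, wp_instr, Instr.Fits, Instr.exec, State.setReg,
    State.setRReg, Function.update_apply, h1, if_true, if_false, hu12, Nat.reduceEqDiff]
  refine ⟨by omega, by omega, by omega, by omega, trivial, by omega, ⟨?_, ?_, rfl, rfl⟩, ?_⟩
  · intro x hx
    simp only [LeafReg, not_or] at hx
    simp [hx]
  · intro r hr
    have : r ≠ q := by omega
    simp [this]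
  · funext r
    simp [Function.update_apply, hρ.rmem]

theorem fetches_reg {W d s : ℕ} (hs : s + d ≤ 4 * d) (σ : State) :
    Fetches W d (fetchReg s) (fun j => σ.rreg (s + j)) σ := by
  intro ρ hρ q hq j hj
  simp only [fetchReg, wp_instr, Instr.Fits, Instr.exec, State.setRReg]
  refine ⟨trivial, by omega, ⟨fun _ _ => rfl, fun r hr => ?_, rfl, rfl⟩, ?_⟩
  · have : r ≠ q := by omega
    simp [this]
  · rw [hρ.rreg _ (by omega)]

/-- The routine `p` decides `φ`; the answer is stored in register `14`. -/
def Decides (W d c : ℕ) (p : Prog) (σ : State) (φ : Prop) : Prop :=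
  WP W p σ fun T τ => T ≤ c ∧ Frame d LeafReg σ τ ∧ (τ.reg 14 = 1 ↔ φ)

/-- Store the outcome of a test in register `14`. -/
def flag (b : Test) : Prog := .ite b (.instr (.const 14 1)) (.instr (.const 14 0))

theorem flag_spec {W : ℕ} (hW : 2 < W) (d : ℕ) (b : Test) (σ : State) :
    Decides W d 2 (flag b) σ (b.Holds σ) := by
  simp only [Decides, flag, wp_ite, wp_instr, Instr.Fits, Instr.exec, State.setReg]
  constructor <;> intro h <;>
    refine ⟨by omega, by omega, ⟨fun x hx => ?_, fun _ _ => rfl, rfl, rfl⟩, by simp [h]⟩ <;>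
  · simp only [LeafReg, not_or] at hx
    simp [hx]

/-- Compare two points in coordinate `j`. -/
def coordLess (d : ℕ) (f g : ℕ → ℕ → Prog) (j : ℕ) : Prog :=
  .seq (f (4 * d) j) (.seq (g (4 * d + 1) j) (flag (.rlt (4 * d) (4 * d + 1))))

theorem coordLess_spec {W d : ℕ} (hW : 2 < W) {f g : ℕ → ℕ → Prog} {x y : ℕ → ℝ} {σ : State}
    (hf : Fetches W d f x σ) (hg : Fetches W d g y σ) {j : ℕ} (hj : j < d) :
    Decides W d 12 (coordLess d f g j) σ (x j < y j) := by
  unfold coordLess Decides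
  rw [wp_seq]
  refine (hf σ (Frame.refl ..) _ le_rfl j hj).mono ?_
  rintro T τ ⟨hT, hτ, eτ⟩
  rw [wp_seq]
  refine (hg τ hτ _ (by omega) j hj).mono ?_
  rintro U ρ ⟨hU, hρ, eρ⟩
  refine (flag_spec hW d _ ρ).mono ?_
  rintro V ν ⟨hV, hν, eν⟩
  refine ⟨by omega, (hτ.trans hρ).trans hν, ?_⟩
  rw [eν, Test.Holds, eρ, eτ]
  simp

/-- Find the first coordinate up to `j` in which two points differ. -/
def zscan (d : ℕ) (f g : ℕ → ℕ → Prog) : ℕ → Prog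
  | 0 => .seq (f (4 * d) 0) (g (4 * d + 1) 0)
  | j + 1 => .seq (zscan d f g j) (.seq (f (4 * d + 2) (j + 1)) (.seq (g (4 * d + 3) (j + 1))
      (.ite (.bitLt (4 * d) (4 * d + 1) (4 * d + 2) (4 * d + 3))
        (.seq (.instr (.rcopy (4 * d) (4 * d + 2))) (.instr (.rcopy (4 * d + 1) (4 * d + 3))))
        .skip)))

/-- The real registers carry the two values in the coordinate that differs first so far. The index
of that coordinate exists only in the proof: the values suffice for the final comparison, so no word
register stores it. -/
theorem zscan_spec {W d : ℕ} {f g : ℕ → ℕ → Prog} {x y : ℕ → ℝ} {σ : State}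
    (hf : Fetches W d f x σ) (hg : Fetches W d g y σ) {j : ℕ} (hj : j < d) :
    WP W (zscan d f g j) σ fun T τ => T ≤ 14 * (j + 1) ∧ Frame d LeafReg σ τ ∧
      ∃ i, FirstDiff x y (j + 1) i ∧ τ.rreg (4 * d) = x i ∧ τ.rreg (4 * d + 1) = y i := by
  induction j with
  | zero =>
    rw [zscan, wp_seq]
    refine (hf σ (Frame.refl ..) _ le_rfl 0 hj).mono ?_
    rintro T τ ⟨hT, hτ, eτ⟩
    refine (hg τ hτ _ (by omega) 0 hj).mono ?_
    rintro U ρ ⟨hU, hρ, eρ⟩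
    refine ⟨by omega, hτ.trans hρ, 0, firstDiff_one x y, ?_, ?_⟩ <;>
    simp [eρ, eτ]
  | succ j ih =>
    rw [zscan, wp_seq]
    refine (ih (by omega)).mono ?_
    rintro T τ ⟨hT, hτ, i, hi, hxi, hyi⟩
    rw [wp_seq]
    refine (hf τ hτ _ (by omega) (j + 1) hj).mono ?_
    rintro T1 τ1 ⟨hT1, hτ1, e1⟩
    rw [wp_seq]
    refine (hg τ1 (hτ.trans hτ1) _ (by omega) (j + 1) hj).mono ?_
    rintro T2 τ2 ⟨hT2, hτ2, e2⟩
    have r0 : τ2.rreg (4 * d) = x i := by simp [e2, e1, hxi]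
    have r1 : τ2.rreg (4 * d + 1) = y i := by simp [e2, e1, hyi]
    have r2 : τ2.rreg (4 * d + 2) = x (j + 1) := by simp [e2, e1]
    have r3 : τ2.rreg (4 * d + 3) = y (j + 1) := by simp [e2]
    have hF := (hτ.trans hτ1).trans hτ2
    rw [wp_ite]
    constructor
    · intro hb
      rw [Test.Holds, r0, r1, r2, r3] at hb
      simp only [wp_seq, wp_instr, Instr.Fits, Instr.exec, State.setRReg, true_and]
      refine ⟨by omega, hF.trans ⟨fun _ _ => rfl, fun r hr => ?_, rfl, rfl⟩, j + 1,
        hi.replace hb, ?_, ?_⟩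
      · have h1 : r ≠ 4 * d := by omega
        have h2 : r ≠ 4 * d + 1 := by omega
        simp [h1, h2]
      · simp [r2]
      · simp [r3]
    · intro hb
      rw [Test.Holds, r0, r1, r2, r3] at hb
      rw [wp_skip]
      exact ⟨by omega, hF, i, hi.keep hb, r0, r1⟩

/-- Compare two points in the Z-order. -/
def zLess (d : ℕ) (f g : ℕ → ℕ → Prog) : Prog :=
  .seq (zscan d f g (d - 1)) (flag (.rlt (4 * d) (4 * d + 1)))

theorem zLess_spec {W d : ℕ} (hW : 2 < W) (hd : 0 < d) {f g : ℕ → ℕ → Prog} {x y : ℕ → ℝ}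
    {σ : State} (hf : Fetches W d f x σ) (hg : Fetches W d g y σ) :
    Decides W d (14 * d + 2) (zLess d f g) σ (zkey d x < zkey d y) := by
  unfold zLess Decides
  rw [wp_seq]
  refine (zscan_spec hf hg (j := d - 1) (by omega)).mono ?_
  rintro T τ ⟨hT, hτ, i, hi, hxi, hyi⟩
  rw [Nat.sub_add_cancel hd] at hT hi
  refine (flag_spec hW d _ τ).mono ?_
  rintro V ν ⟨hV, hν, eν⟩
  refine ⟨by omega, hτ.trans hν, ?_⟩
  rw [eν, Test.Holds, hxi, hyi]
  exact hi.lt_iff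

theorem Decides.congr {W d c c' : ℕ} {p : Prog} {σ : State} {φ φ' : Prop}
    (h : Decides W d c p σ φ) (hφ : φ ↔ φ') (hc : c ≤ c') : Decides W d c' p σ φ' :=
  h.mono fun _ _ ⟨h1, h2, h3⟩ => ⟨h1.trans hc, h2, h3.trans hφ⟩

/-- Negate the answer of a decision routine. -/
def negate (p : Prog) : Prog :=
  .seq p (.ite (.eq 14 1) (.instr (.const 14 0)) (.instr (.const 14 1)))

theorem negate_spec {W d c : ℕ} (hW : 2 < W) {p : Prog} {σ : State} {φ : Prop}
    (h1 : σ.reg 1 = 1) (h : Decides W d c p σ φ) : Decides W d (c + 2) (negate p) σ (¬ φ) := by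
  unfold negate Decides
  rw [wp_seq]
  refine h.mono ?_
  rintro T τ ⟨hT, hτ, eτ⟩
  have e1 : τ.reg 1 = 1 := by rw [hτ.reg 1 (by simp [LeafReg]), h1]
  simp only [wp_ite, wp_instr, Instr.Fits, Instr.exec, State.setReg, Test.Holds, e1, eτ]
  constructor <;> intro hφ <;>
    refine ⟨by omega, by omega,
      hτ.trans ⟨fun x hx => ?_, fun _ _ => rfl, rfl, rfl⟩, by simp [hφ]⟩ <;>
  · simp only [LeafReg, not_or] at hx
    simp [hx]

/-- The conjunction of two decision routines. -/
def conj (p q : Prog) : Prog := .seq p (.ite (.eq 14 1) q .skip)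

theorem conj_spec {W d c c' : ℕ} {p q : Prog} {σ : State} {φ ψ : Prop}
    (h1 : σ.reg 1 = 1) (h : Decides W d c p σ φ)
    (h' : ∀ τ, Frame d LeafReg σ τ → Decides W d c' q τ ψ) :
    Decides W d (c + c' + 2) (conj p q) σ (φ ∧ ψ) := by
  unfold conj Decides
  rw [wp_seq]
  refine h.mono ?_
  rintro T τ ⟨hT, hτ, eτ⟩
  have e1 : τ.reg 1 = 1 := by rw [hτ.reg 1 (by simp [LeafReg]), h1]
  rw [wp_ite]
  simp only [Test.Holds, e1]
  constructor <;> intro hφ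
  · refine (h' τ hτ).mono ?_
    rintro U ρ ⟨hU, hρ, eρ⟩
    exact ⟨by omega, hτ.trans hρ, by rw [eρ]; simp [eτ.1 hφ]⟩
  · rw [wp_skip]
    refine ⟨by omega, hτ, ?_⟩
    have : ¬ φ := fun h => hφ (eτ.2 h)
    simp [hφ, this]

/-- The point, loaded by `f`, lies in the half-open box whose corners are in the real registers
from `s` and from `s'` on, as far as the first `j` coordinates are concerned. -/
def inBox (d : ℕ) (f : ℕ → ℕ → Prog) (s s' : ℕ) : ℕ → Prog
  | 0 => flag (.eq 1 1)
  | j + 1 => conj (inBox d f s s' j) (conj (negate (coordLess d f (fetchReg s) j))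
      (coordLess d f (fetchReg s') j))

theorem inBox_spec {W d s s' : ℕ} (hW : 2 < W) {f : ℕ → ℕ → Prog} {x : ℕ → ℝ} {σ : State}
    (hf : Fetches W d f x σ) (h1 : σ.reg 1 = 1) (hs : s + d ≤ 4 * d) (hs' : s' + d ≤ 4 * d)
    {j : ℕ} (hj : j ≤ d) :
    Decides W d (30 * j + 2) (inBox d f s s' j) σ
      (∀ i < j, σ.rreg (s + i) ≤ x i ∧ x i < σ.rreg (s' + i)) := by
  induction j with
  | zero => exact (flag_spec hW d _ σ).congr (by simp [Test.Holds]) le_rfl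
  | succ j ih =>
    have e1 : ∀ τ, Frame d LeafReg σ τ → τ.reg 1 = 1 := fun τ hτ => by
      rw [hτ.reg 1 (by simp [LeafReg]), h1]
    refine (conj_spec h1 (ih (by omega)) (ψ := ¬ (x j < σ.rreg (s + j)) ∧ x j < σ.rreg (s' + j))
      (c' := 28) fun τ hτ => conj_spec (c := 14) (c' := 12) (e1 τ hτ) (negate_spec hW (e1 τ hτ) ?_)
        fun ρ hρ => ?_).congr ?_ (by omega)
    · refine (coordLess_spec hW (hf.congr hτ) (fetches_reg hs τ) (by omega)).congr ?_ le_rfl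
      rw [hτ.rreg _ (by omega)]
    · refine (coordLess_spec hW (hf.congr (hτ.trans hρ)) (fetches_reg hs' ρ)
        (by omega)).congr ?_ le_rfl
      rw [(hτ.trans hρ).rreg _ (by omega)]
    · rw [not_lt]
      constructor
      · rintro ⟨h1, h2⟩ i hi
        rcases Nat.lt_succ_iff_lt_or_eq.1 hi with h | rfl
        · exact h1 i h
        · exact h2
      · exact fun h => ⟨fun i hi => h i (by omega), h j (by omega)⟩

/-! ## Binary search -/

/-- Find the first entry, of the `n` entries from the address in register `f + 2` on, for which the
routine `p` answers no. -/
def bsearch (f : ℕ) (p : Prog) : Prog :=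
  .block [.const f 0, .copy (f + 1) 2] (.loop (.lt f (f + 1))
    (.block [.add 15 f (f + 1), .const 16 2, .div 15 15 16, .add 17 (f + 2) 15, .load 10 17]
      (.seq p (.ite (.eq 14 1) (.instr (.add f 15 1)) (.instr (.copy (f + 1) 15))))))

/-- The registers that binary search may change. -/
def BsearchReg (f x : ℕ) : Prop := (10 ≤ x ∧ x < 20) ∨ x = f ∨ x = f + 1

/-- The routine may be any decision procedure whose positive answers form an initial segment of the
array. The word bound has room for `2 * n` because the two ends are added before they are halved. -/
theorem bsearch_spec {W d c n f X K : ℕ} (hf : 20 ≤ f) {p : Prog} {φ : ℕ → Prop}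
    {R : ℕ → ℕ} {σ₀ : State} (hW : 2 * n + 2 < W) (hX : X + n < W) (h1 : σ₀.reg 1 = 1)
    (h2 : σ₀.reg 2 = n) (hfX : σ₀.reg (f + 2) = X) (hR : ∀ i < n, σ₀.mem (X + i) = R i)
    (hp : ∀ σ, Frame d (BsearchReg f) σ₀ σ → ∀ i < n, σ.reg 10 = R i →
      Decides W d c p σ (φ (R i)))
    (hφ : ∀ i i', i < i' → i' < n → φ (R i') → φ (R i)) (hK : n < 2 ^ K) :
    WP W (bsearch f p) σ₀ fun T τ => T ≤ K * (c + 8) + 3 ∧ Frame d (BsearchReg f) σ₀ τ ∧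
      τ.reg f ≤ n ∧ ∀ i < n, φ (R i) ↔ i < τ.reg f := by
  obtain ⟨g, rfl⟩ : ∃ g, f = g + 20 := ⟨f - 20, by omega⟩
  have := wp_loop (W := W) (b := .lt (g + 20) (g + 20 + 1))
    (p := .block [.add 15 (g + 20) (g + 20 + 1), .const 16 2, .div 15 15 16,
        .add 17 (g + 20 + 2) 15, .load 10 17]
      (.seq p (.ite (.eq 14 1) (.instr (.add (g + 20) 15 1)) (.instr (.copy (g + 20 + 1) 15)))))
    -- The answer is yes below the left end and no from the right end on, and the gap is below `2 ^
    -- k`. A round costs `5` steps of setup, `c` for the decision, `2` for the update and `1` for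
    -- the loop test.
    (I := fun b σ => ∃ k, b = k * (c + 8) ∧ Frame d (BsearchReg (g + 20)) σ₀ σ ∧
      σ.reg (g + 20) ≤ σ.reg (g + 21) ∧ σ.reg (g + 21) ≤ n ∧
      σ.reg (g + 21) - σ.reg (g + 20) < 2 ^ k ∧
      (∀ i < σ.reg (g + 20), φ (R i)) ∧ ∀ i < n, σ.reg (g + 21) ≤ i → ¬ φ (R i)) (by
    rintro b σ ⟨k, rfl, hF, hle, hn, hk, hlo, hhi⟩ hb
    simp only [Test.Holds] at hb
    have e1 : σ.reg 1 = 1 := by rw [hF.reg 1 (by simp [BsearchReg]), h1]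
    have eX : σ.reg (g + 22) = X := by
      rw [hF.reg (g + 22) (by simp [BsearchReg]), hfX]
    obtain ⟨l, hl⟩ : ∃ l, σ.reg (g + 20) = l := ⟨_, rfl⟩
    obtain ⟨h, hh⟩ : ∃ h, σ.reg (g + 21) = h := ⟨_, rfl⟩
    simp only [hl, hh] at hb hle hn hk hlo hhi
    simp only [Prog.block, wp_seq, wp_instr, Instr.Fits, Instr.exec, State.setReg,
      Function.update_apply, if_true, if_false, Nat.reduceEqDiff, Nat.reduceAdd, Nat.add_assoc,
      hl, hh, eX]
    have hm : (l + h) / 2 < n := by omega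
    have hmem : σ.mem (X + (l + h) / 2) = R ((l + h) / 2) := by rw [hF.mem, hR _ hm]
    rw [hmem]
    refine ⟨by omega, by omega, trivial, by omega, trivial, ?_⟩
    have hF1 : Frame d (BsearchReg (g + 20)) σ₀
        { reg := fun x => if x = 10 then R ((l + h) / 2) else
            if x = 17 then X + (l + h) / 2 else if x = 15 then (l + h) / 2 else
            if x = 16 then 2 else if x = 15 then l + h else σ.reg x,
          rreg := σ.rreg, mem := σ.mem, rmem := σ.rmem } := by
      refine hF.trans ⟨fun x hx => ?_, fun _ _ => rfl, rfl, rfl⟩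
      simp only [BsearchReg, not_or] at hx
      have : x ≠ 10 ∧ x ≠ 15 ∧ x ≠ 16 ∧ x ≠ 17 := by omega
      simp [this]
    refine WP.mono (hp _ ?_ _ hm ?_) ?_
    · convert hF1 using 2
      funext x
      simp [Function.update_apply]
    · simp
    rintro T τ ⟨hT, hτ, eτ⟩
    have t1 : τ.reg 1 = 1 := by rw [hτ.reg 1 (by simp [LeafReg])]; simp [e1]
    have t15 : τ.reg 15 = (l + h) / 2 := by rw [hτ.reg 15 (by simp [LeafReg])]; simp
    have tl : τ.reg (g + 20) = l := by rw [hτ.reg _ (by simp [LeafReg])]; simpa using hl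
    have th : τ.reg (g + 21) = h := by rw [hτ.reg _ (by simp [LeafReg])]; simpa using hh
    have hF' : Frame d (BsearchReg (g + 20)) σ₀ τ := by
      refine hF1.trans (Frame.mono (S := LeafReg) ?_ fun x hx => ?_)
      · convert hτ using 2
        funext x
        simp [Function.update_apply]
      · simp only [LeafReg, BsearchReg] at *; omega
    obtain ⟨k, rfl⟩ : ∃ k', k = k' + 1 := by
      refine ⟨k - 1, ?_⟩
      rcases k with _ | k
      · simp at hk; omega
      · rfl
    have hpw : 2 ^ (k + 1) = 2 * 2 ^ k := by ring
    rw [wp_ite]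
    simp only [wp_instr, Test.Holds, t1, Instr.Fits, Instr.exec, State.setReg, t15]
    constructor
    · intro hφm
      rw [eτ] at hφm
      refine ⟨by omega, k * (c + 8), by rw [Nat.add_mul]; omega, k, rfl,
        hF'.trans ⟨fun x hx => ?_, fun _ _ => rfl, rfl, rfl⟩, ?_⟩
      · simp only [BsearchReg, not_or] at hx
        have : x ≠ g + 20 := by omega
        simp [this]
      · have e2 : g + 21 ≠ g + 20 := by omega
        simp only [Function.update_apply, if_true, if_false, e2, th]
        refine ⟨by omega, by omega, by omega, fun i hi => ?_, hhi⟩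
        rcases lt_or_ge i ((l + h) / 2) with hlt | hge
        · exact hφ i _ hlt hm hφm
        · obtain rfl : i = (l + h) / 2 := by omega
          exact hφm
    · intro hφm
      rw [eτ] at hφm
      refine ⟨trivial, k * (c + 8), by rw [Nat.add_mul]; omega, k, rfl,
        hF'.trans ⟨fun x hx => ?_, fun _ _ => rfl, rfl, rfl⟩, ?_⟩
      · simp only [BsearchReg, not_or] at hx
        have : x ≠ g + 21 := by omega
        simp [this]
      · have e2 : g + 20 ≠ g + 21 := by omega
        simp only [Function.update_apply, if_true, if_false, e2, tl]
        refine ⟨by omega, by omega, by omega, hlo, fun i hin hi hφi => ?_⟩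
        rcases lt_or_eq_of_le hi with hlt | heq
        · exact hφm (hφ _ i hlt hin hφi)
        · exact hφm (by rw [heq]; exact hφi))
  unfold bsearch
  simp only [Prog.block, wp_seq, wp_instr, Instr.Fits, Instr.exec, State.setReg,
      Function.update_apply]
  refine ⟨by omega, trivial, (this (k := K * (c + 8)) ⟨K, rfl, ?_⟩).mono ?_⟩
  · have e2 : 2 ≠ g + 20 := by omega
    have e3 : g + 20 ≠ g + 21 := by omega
    refine ⟨⟨fun x hx => ?_, fun _ _ => rfl, rfl, rfl⟩, ?_⟩
    · simp only [BsearchReg, not_or] at hx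
      simp [hx]
    · simp only [Function.update_apply, if_true, if_false, e2, e3, h2]
      exact ⟨by omega, by omega, by omega, fun i hi => by omega, fun i hi hi' => by omega⟩
  · rintro T τ ⟨hT, hb, b, k, -, hF, hle, hn, -, hlo, hhi⟩
    have hb : ¬ τ.reg (g + 20) < τ.reg (g + 21) := hb
    refine ⟨by omega, hF, by omega, fun i hi => ⟨fun h => ?_, hlo i⟩⟩
    by_contra hni
    exact hhi i hi (by omega) h

/-! ## Merge sort -/

/-- Between `σ` and `τ` only the word registers in `S`, the word memory cells in `P`, and real
registers have changed. -/
structure MFrame (S P : ℕ → Prop) (σ τ : State) : Prop where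
  reg : ∀ x, ¬ S x → τ.reg x = σ.reg x
  mem : ∀ a, ¬ P a → τ.mem a = σ.mem a
  rmem : τ.rmem = σ.rmem

theorem MFrame.refl (S P : ℕ → Prop) (σ : State) : MFrame S P σ σ :=
  ⟨fun _ _ => rfl, fun _ _ => rfl, rfl⟩

theorem MFrame.trans {S P : ℕ → Prop} {σ τ ρ : State} (h : MFrame S P σ τ)
    (h' : MFrame S P τ ρ) : MFrame S P σ ρ :=
  ⟨fun x hx => (h'.reg x hx).trans (h.reg x hx), fun r hr => (h'.mem r hr).trans (h.mem r hr),
    h'.rmem.trans h.rmem⟩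

theorem MFrame.comp {S P : ℕ → Prop} {σ τ ρ : State} (h' : MFrame S P τ ρ)
    (h : MFrame S P σ τ) : MFrame S P σ ρ := h.trans h'

theorem MFrame.mono {S S' P P' : ℕ → Prop} {σ τ : State} (h : MFrame S P σ τ)
    (hS : ∀ x, S x → S' x) (hP : ∀ x, P x → P' x) : MFrame S' P' σ τ :=
  ⟨fun x hx => h.reg x fun hx' => hx (hS x hx'), fun a ha => h.mem a fun ha' => ha (hP a ha'),
    h.rmem⟩

theorem Frame.toMFrame {d : ℕ} {S : ℕ → Prop} {σ τ : State} (h : Frame d S σ τ)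
    (P : ℕ → Prop) : MFrame S P σ τ :=
  ⟨h.reg, fun _ _ => by rw [h.mem], h.rmem⟩

/-- The volatile registers. -/
def TempReg (x : ℕ) : Prop := 10 ≤ x ∧ x < 20

theorem LeafReg.temp {x : ℕ} (h : LeafReg x) : TempReg x := by
  unfold LeafReg at h; unfold TempReg; omega

/-- The routine `p` compares the keys of the points with indices in the registers `10` and `11`. -/
def Compares {α : Type*} [LT α] (W d n c : ℕ) (rm : ℕ → ℝ) (p : Prog) (K : ℕ → α) : Prop :=
  ∀ σ : State, σ.reg 1 = 1 → σ.rmem = rm → σ.reg 10 < n → σ.reg 11 < n →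
    Decides W d c p σ (K (σ.reg 10) < K (σ.reg 11))

/-! ### Merging two sorted runs -/

/-- Decide whether the next element is taken from the second run. -/
def mergeChoose (p : Prog) : Prog :=
  .ite (.lt 27 25)
    (.ite (.lt 26 24) (.block [.add 15 20 27, .load 10 15, .add 15 20 26, .load 11 15] p)
      (.instr (.const 14 1)))
    (.instr (.const 14 0))

/-- Taking from the second run demands a strictly smaller key. In a linear order the failure of this
test is exactly the weak inequality that `Merged.takeLeft` needs. -/
theorem mergeChoose_spec {α : Type*} [LinearOrder α] {W d n c X : ℕ} {rm : ℕ → ℝ} {p : Prog}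
    {K : ℕ → α} (hp : Compares W d n c rm p K) {A : ℕ → ℕ} (hA : ∀ i < n, A i < n) {σ : State}
    (hW : 2 < W) (hX : X + n ≤ W)
    (h1 : σ.reg 1 = 1) (hrm : σ.rmem = rm) (h20 : σ.reg 20 = X)
    (hmem : ∀ i < n, σ.mem (X + i) = A i) {b e i j : ℕ} (h24 : σ.reg 24 = b) (h25 : σ.reg 25 = e)
    (h26 : σ.reg 26 = i) (h27 : σ.reg 27 = j) (hb : b ≤ n) (he : e ≤ n) :
    WP W (mergeChoose p) σ fun T τ => T ≤ c + 6 ∧ Frame d TempReg σ τ ∧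
      (τ.reg 14 = 1 ↔ j < e ∧ (i < b → K (A j) < K (A i))) := by
  have hfr : ∀ v, Frame d TempReg σ (σ.setReg 14 v) := by
    refine fun v => ⟨fun x hx => ?_, fun _ _ => rfl, rfl, rfl⟩
    simp only [TempReg] at hx
    have : x ≠ 14 := by omega
    simp [State.setReg, this]
  unfold mergeChoose
  rw [wp_ite]
  simp only [Test.Holds, h27, h25]
  constructor
  · intro hje
    rw [wp_ite]
    simp only [Test.Holds, h26, h24]
    constructor
    · intro hib
      simp only [Prog.block, wp_seq, wp_instr, Instr.Fits, Instr.exec, State.setReg, h20, h27,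
        Function.update_apply, if_true, if_false, Nat.reduceEqDiff, hmem j (by omega), h26,
        hmem i (by omega)]
      refine ⟨by omega, trivial, by omega, trivial,
        WP.mono (hp _ (by simp [h1]) (by exact hrm) ?_ ?_) ?_⟩
      · simpa using hA j (by omega)
      · simpa using hA i (by omega)
      · rintro T τ ⟨hT, hτ, eτ⟩
        refine ⟨by omega, Frame.comp (hτ.mono fun _ => LeafReg.temp)
          ⟨fun x hx => ?_, fun _ _ => rfl, rfl, rfl⟩, ?_⟩
        · simp only [TempReg] at hx
          have : x ≠ 10 ∧ x ≠ 11 ∧ x ≠ 15 := by omega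
          simp [this]
        · rw [eτ]
          simp [hje, hib]
    · intro hib
      simp only [wp_instr, Instr.Fits, Instr.exec]
      exact ⟨by omega, by omega, hfr 1, by simp [State.setReg, hib, hje]⟩
  · intro hje
    simp only [wp_instr, Instr.Fits, Instr.exec]
    exact ⟨by omega, by omega, hfr 0, by simp [State.setReg, hje]⟩

/-- Output the next element. -/
def mergeMove : Prog :=
  .seq (.ite (.eq 14 1) (.block [.add 15 20 27, .load 10 15] (.instr (.add 27 27 1)))
      (.block [.add 15 20 26, .load 10 15] (.instr (.add 26 26 1))))
    (.block [.add 15 21 28, .store 15 10] (.instr (.add 28 28 1)))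

/-- Merge two adjacent sorted runs. -/
def mergeRuns (p : Prog) : Prog := .loop (.lt 28 25) (.seq (mergeChoose p) mergeMove)

/-- The registers that merging may change. -/
def MergeReg (x : ℕ) : Prop := TempReg x ∨ x = 26 ∨ x = 27 ∨ x = 28

theorem mergeMove_spec {W n X Y : ℕ} {A : ℕ → ℕ} {σ : State} (hX : X + n < W) (hY : Y + n < W)
    (h1 : σ.reg 1 = 1) (h20 : σ.reg 20 = X) (h21 : σ.reg 21 = Y)
    (hmem : ∀ i < n, σ.mem (X + i) = A i) {i j o : ℕ}
    (h26 : σ.reg 26 = i) (h27 : σ.reg 27 = j) (h28 : σ.reg 28 = o) (ho : o < n)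
    (hi : σ.reg 14 ≠ 1 → i < n) (hj : σ.reg 14 = 1 → j < n) :
    WP W mergeMove σ fun T τ => T ≤ 7 ∧ (∀ x, ¬ MergeReg x → τ.reg x = σ.reg x) ∧
      τ.rmem = σ.rmem ∧
      ((σ.reg 14 = 1 ∧ τ.reg 26 = i ∧ τ.reg 27 = j + 1 ∧ τ.reg 28 = o + 1 ∧
        τ.mem = Function.update σ.mem (Y + o) (A j)) ∨
      (σ.reg 14 ≠ 1 ∧ τ.reg 26 = i + 1 ∧ τ.reg 27 = j ∧ τ.reg 28 = o + 1 ∧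
        τ.mem = Function.update σ.mem (Y + o) (A i))) := by
  unfold mergeMove
  rw [wp_seq, wp_ite]
  simp only [Test.Holds, h1]
  constructor
  · intro h14
    have hj := hj h14
    simp only [Prog.block, wp_seq, wp_instr, Instr.Fits, Instr.exec, State.setReg, h20, h27,
        Function.update_apply, if_true, if_false, Nat.reduceEqDiff, hmem j hj, h26, h28, h21, h1,
        OfNat.one_ne_ofNat]
    refine ⟨by omega, trivial, by omega, by omega, trivial, by omega, by omega, ?_, trivial,
      Or.inl ⟨h14, trivial, trivial, trivial, trivial⟩⟩
    intro x hx
    simp only [MergeReg, TempReg] at hx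
    have : x ≠ 10 ∧ x ≠ 15 ∧ x ≠ 27 ∧ x ≠ 28 := by omega
    simp [this]
  · intro h14
    have hi := hi h14
    simp only [Prog.block, wp_seq, wp_instr, Instr.Fits, Instr.exec, State.setReg, h20, h27,
        Function.update_apply, if_true, if_false, Nat.reduceEqDiff, hmem i hi, h26, h28, h21, h1,
        OfNat.one_ne_ofNat]
    refine ⟨by omega, trivial, by omega, by omega, trivial, by omega, by omega, ?_, trivial,
      Or.inr ⟨h14, trivial, trivial, trivial, trivial⟩⟩
    intro x hx
    simp only [MergeReg, TempReg] at hx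
    have : x ≠ 10 ∧ x ≠ 15 ∧ x ≠ 26 ∧ x ≠ 28 := by omega
    simp [this]

/-- `D` is sorted by the keys `K` on the positions from `l` up to `r`. -/
def SortedOn {α : Type*} [LE α] (K : ℕ → α) (D : ℕ → ℕ) (l r : ℕ) : Prop :=
  ∀ u v, l ≤ u → u ≤ v → v < r → K (D u) ≤ K (D v)

/-- The state of a merge of the runs `[a, b)` and `[b, e)` of `A` into `D`. -/
structure Merged {α : Type*} [LE α] (K : ℕ → α) (A D : ℕ → ℕ) (a b e i j o : ℕ) : Prop where
  hai : a ≤ i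
  hib : i ≤ b
  hbj : b ≤ j
  hje : j ≤ e
  ho : o + b = i + j
  sum : ∀ f : ℕ → ℕ, ∑ u ∈ Finset.Ico a o, f (D u) =
    ∑ u ∈ Finset.Ico a i, f (A u) + ∑ u ∈ Finset.Ico b j, f (A u)
  sorted : SortedOn K D a o
  lei : ∀ u, a ≤ u → u < o → i < b → K (D u) ≤ K (A i)
  lej : ∀ u, a ≤ u → u < o → j < e → K (D u) ≤ K (A j)

/-- That the output is a rearrangement of the consumed input is expressed by equality of sums over
all functions `f`, so appending `x` contributes one summand on each side. Sortedness survives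
because `x` dominates the old output and is dominated by whatever heads the two runs afterwards. -/
theorem Merged.step {α : Type*} [LinearOrder α] {K : ℕ → α} {A D D' : ℕ → ℕ}
    {a b e i j o x i' j' : ℕ}
    (h : Merged K A D a b e i j o) (hD : ∀ u, a ≤ u → u < o → D' u = D u) (hDo : D' o = x)
    (hi : i' ≤ b) (hj : j' ≤ e) (hii : i ≤ i') (hjj : j ≤ j') (hij : o + 1 + b = i' + j')
    (hx : ∀ f : ℕ → ℕ, ∑ u ∈ Finset.Ico a i', f (A u) + ∑ u ∈ Finset.Ico b j', f (A u) =
      ∑ u ∈ Finset.Ico a i, f (A u) + ∑ u ∈ Finset.Ico b j, f (A u) + f x)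
    (hlow : ∀ u, a ≤ u → u < o → K (D u) ≤ K x)
    (hxi : i' < b → K x ≤ K (A i')) (hxj : j' < e → K x ≤ K (A j')) :
    Merged K A D' a b e i' j' (o + 1) := by
  have hao : a ≤ o := by have := h.hai; have := h.hbj; have := h.ho; omega
  refine ⟨h.hai.trans hii, hi, h.hbj.trans hjj, hj, hij, fun f => ?_, ?_, ?_, ?_⟩
  · rw [Finset.sum_Ico_succ_top hao, hDo, hx, ← h.sum]
    congr 1
    refine Finset.sum_congr rfl fun u hu => ?_
    rw [Finset.mem_Ico] at hu
    rw [hD u hu.1 hu.2]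
  · intro u v hu huv hv
    rcases Nat.lt_succ_iff_lt_or_eq.1 hv with hv | rfl
    · rw [hD u hu (by omega), hD v (by omega) hv]
      exact h.sorted u v hu huv hv
    · rcases huv.lt_or_eq with huv | rfl
      · rw [hD u hu huv, hDo]
        exact hlow u hu huv
      · exact le_rfl
  · intro u hu huo hib
    rcases Nat.lt_succ_iff_lt_or_eq.1 huo with huo | rfl
    · rw [hD u hu huo]
      exact (hlow u hu huo).trans (hxi hib)
    · rw [hDo]
      exact hxi hib
  · intro u hu huo hje
    rcases Nat.lt_succ_iff_lt_or_eq.1 huo with huo | rfl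
    · rw [hD u hu huo]
      exact (hlow u hu huo).trans (hxj hje)
    · rw [hDo]
      exact hxj hje

theorem Merged.takeRight {α : Type*} [LinearOrder α] {K : ℕ → α} {A D D' : ℕ → ℕ}
    {a b e i j o : ℕ} (h : Merged K A D a b e i j o) (hs : SortedOn K A b e)
    (hD : ∀ u, a ≤ u → u < o → D' u = D u) (hDo : D' o = A j) (hj : j < e)
    (hlt : i < b → K (A j) < K (A i)) : Merged K A D' a b e i (j + 1) (o + 1) := by
  have h1 := h.hbj
  have h2 := h.ho
  refine h.step hD hDo h.hib hj le_rfl (by omega) (by omega) (fun f => ?_)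
    (fun u hu huo => h.lej u hu huo hj) (fun hib => (hlt hib).le)
    (fun hje => hs j (j + 1) h1 (by omega) hje)
  rw [Finset.sum_Ico_succ_top h1, add_assoc]

theorem Merged.takeLeft {α : Type*} [LinearOrder α] {K : ℕ → α} {A D D' : ℕ → ℕ}
    {a b e i j o : ℕ} (h : Merged K A D a b e i j o) (hs : SortedOn K A a b)
    (hD : ∀ u, a ≤ u → u < o → D' u = D u) (hDo : D' o = A i) (hi : i < b)
    (hle : j < e → K (A i) ≤ K (A j)) : Merged K A D' a b e (i + 1) j (o + 1) := by
  have h1 := h.hai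
  have h2 := h.ho
  refine h.step hD hDo hi h.hje (by omega) le_rfl (by omega) (fun f => ?_)
    (fun u hu huo => h.lei u hu huo hi) (fun hib => hs i (i + 1) h1 (by omega) hib)
    hle
  rw [Finset.sum_Ico_succ_top h1, add_right_comm]

theorem mergeRuns_spec {α : Type*} [LinearOrder α] {W d n c X : ℕ} {rm : ℕ → ℝ} {p : Prog}
    {K : ℕ → α} (hp : Compares W d n c rm p K) {A : ℕ → ℕ} (hA : ∀ i < n, A i < n) {σ₀ : State}
    (hW : 2 < W) (hX : X + 2 * n < W)
    (h1 : σ₀.reg 1 = 1) (hrm : σ₀.rmem = rm) (h20 : σ₀.reg 20 = X) (h21 : σ₀.reg 21 = X + n)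
    (hmem : ∀ i < n, σ₀.mem (X + i) = A i) {a b e : ℕ} (h24 : σ₀.reg 24 = b)
    (h25 : σ₀.reg 25 = e) (h26 : σ₀.reg 26 = a) (h27 : σ₀.reg 27 = b) (h28 : σ₀.reg 28 = a)
    (hab : a ≤ b) (hbe : b ≤ e) (he : e ≤ n) (hs1 : SortedOn K A a b) (hs2 : SortedOn K A b e) :
    WP W (mergeRuns p) σ₀ fun T τ => T ≤ (e - a) * (c + 14) + 1 ∧
      MFrame MergeReg (fun x => X + n + a ≤ x ∧ x < X + n + e) σ₀ τ ∧
      SortedOn K (fun u => τ.mem (X + n + u)) a e ∧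
      ∀ f : ℕ → ℕ, ∑ u ∈ Finset.Ico a e, f (τ.mem (X + n + u)) = ∑ u ∈ Finset.Ico a e, f (A u) := by
  have hloop := wp_loop (W := W) (b := .lt 28 25) (p := .seq (mergeChoose p) mergeMove)
    -- Every output element costs `c + 6` for the choice, `7` for the move and `1` for the loop
    -- test.
    (I := fun k σ => ∃ i j o, k = (e - o) * (c + 14) ∧
      MFrame MergeReg (fun x => X + n + a ≤ x ∧ x < X + n + e) σ₀ σ ∧
      σ.reg 26 = i ∧ σ.reg 27 = j ∧ σ.reg 28 = o ∧
      Merged K A (fun u => σ.mem (X + n + u)) a b e i j o) (by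
    rintro k σ ⟨i, j, o, rfl, hF, r26, r27, r28, hM⟩ hb
    have r1 : σ.reg 1 = 1 := by rw [hF.reg 1 (by simp [MergeReg, TempReg]), h1]
    have r20 : σ.reg 20 = X := by rw [hF.reg _ (by simp [MergeReg, TempReg]), h20]
    have r21 : σ.reg 21 = X + n := by rw [hF.reg _ (by simp [MergeReg, TempReg]), h21]
    have r24 : σ.reg 24 = b := by rw [hF.reg _ (by simp [MergeReg, TempReg]), h24]
    have r25 : σ.reg 25 = e := by rw [hF.reg _ (by simp [MergeReg, TempReg]), h25]
    have hmemσ : ∀ i < n, σ.mem (X + i) = A i := fun i hi => by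
      rw [hF.mem _ (by omega), hmem i hi]
    simp only [Test.Holds, r28, r25] at hb
    rw [wp_seq]
    refine (mergeChoose_spec hp hA hW (by omega) r1 (hF.rmem.trans hrm) r20 hmemσ r24 r25 r26 r27
      (by omega) he).mono ?_
    rintro T τ ⟨hT, hτ, eτ⟩
    have hib := hM.hib
    have hje := hM.hje
    have ho := hM.ho
    have hbj := hM.hbj
    have hai := hM.hai
    refine (mergeMove_spec (n := n) (A := A) (X := X) (Y := X + n) (i := i) (j := j) (o := o)
      (by omega) (by omega)
      (by rw [hτ.reg _ (by simp [TempReg]), r1])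
      (by rw [hτ.reg _ (by simp [TempReg]), r20]) (by rw [hτ.reg _ (by simp [TempReg]), r21])
      (by rw [hτ.mem]; exact hmemσ) (by rw [hτ.reg _ (by simp [TempReg]), r26])
      (by rw [hτ.reg _ (by simp [TempReg]), r27]) (by rw [hτ.reg _ (by simp [TempReg]), r28])
      (by omega) ?_ ?_).mono ?_
    · intro h14
      by_contra hin
      exact h14 (eτ.2 ⟨by omega, fun h => by omega⟩)
    · intro h14
      have := (eτ.1 h14).1
      omega
    · rintro U ρ ⟨hU, hρ, hρrm, hcase⟩
      have hbudget : T + U + 1 + (e - (o + 1)) * (c + 14) ≤ (e - o) * (c + 14) := by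
        obtain ⟨q, rfl⟩ : ∃ q, e = o + 1 + q := ⟨e - (o + 1), by omega⟩
        rw [show o + 1 + q - o = q + 1 by omega, show o + 1 + q - (o + 1) = q by omega, add_mul]
        omega
      have hfr : ∀ x, ρ.mem = Function.update τ.mem (X + n + o) x →
          MFrame MergeReg (fun x => X + n + a ≤ x ∧ x < X + n + e) σ₀ ρ := by
        intro x hx
        refine hF.trans ⟨fun y hy => ?_, fun y hy => ?_, hρrm.trans hτ.rmem⟩
        · rw [hρ y hy, hτ.reg y (fun h => hy (Or.inl h))]
        · rw [hx, Function.update_of_ne (by omega), hτ.mem]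
      have hDold : ∀ x, ρ.mem = Function.update τ.mem (X + n + o) x →
          ∀ u, a ≤ u → u < o → ρ.mem (X + n + u) = σ.mem (X + n + u) := by
        intro x hx u _ hu
        rw [hx, Function.update_of_ne (by omega), hτ.mem]
      have hDnew : ∀ x, ρ.mem = Function.update τ.mem (X + n + o) x →
          ρ.mem (X + n + o) = x := by
        intro x hx
        rw [hx, Function.update_self]
      rcases hcase with ⟨h14, q26, q27, q28, qm⟩ | ⟨h14, q26, q27, q28, qm⟩
      · obtain ⟨hj, hlt⟩ := eτ.1 h14
        exact ⟨_, hbudget, i, j + 1, o + 1, rfl, hfr _ qm, q26, q27, q28,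
          hM.takeRight hs2 (hDold _ qm) (hDnew _ qm) hj hlt⟩
      · rw [Ne, eτ] at h14
        -- With the first run exhausted, `o + b = i + j` and `o < e` leave an element in the second
        -- run, which would then have been chosen.
        have hi : i < b := by
          by_contra hin
          exact h14 ⟨by omega, fun h => by omega⟩
        refine ⟨_, hbudget, i + 1, j, o + 1, rfl, hfr _ qm, q26, q27, q28,
          hM.takeLeft hs1 (hDold _ qm) (hDnew _ qm) hi fun hj => ?_⟩
        by_contra hlt
        exact h14 ⟨hj, fun _ => not_le.1 hlt⟩)
  refine (hloop ⟨a, b, a, rfl, MFrame.refl .., h26, h27, h28, le_rfl, hab, le_rfl, hbe, by omega,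
    by simp, fun u v h1 h2 h3 => by omega, fun u h1 h2 => by omega,
    fun u h1 h2 => by omega⟩).mono ?_
  rintro T τ ⟨hT, hb, k, i, j, o, -, hF, r26, r27, r28, hM⟩
  have r25 : τ.reg 25 = e := by rw [hF.reg _ (by simp [MergeReg, TempReg]), h25]
  simp only [Test.Holds, r28, r25] at hb
  have hib := hM.hib
  have hje := hM.hje
  have ho := hM.ho
  obtain rfl : i = b := by omega
  obtain rfl : j = e := by omega
  obtain rfl : o = j := by omega
  refine ⟨hT, hF, hM.sorted, fun f => ?_⟩
  have := hM.sum f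
  rw [Finset.sum_Ico_consecutive _ hM.hai hM.hbj] at this
  exact this

/-! ### Passes of merge sort, and the ranks -/

/-- The registers that sorting may change. -/
def SortReg (x : ℕ) : Prop := TempReg x ∨ (22 ≤ x ∧ x < 30)

theorem MergeReg.sort {x : ℕ} (h : MergeReg x) : SortReg x := by
  unfold MergeReg TempReg at h; unfold SortReg TempReg; omega

/-- Set up the next merge of a pass. -/
def passSetup : Prog :=
  .seq (.instr (.add 24 23 22)) (.seq (.ite (.lt 2 24) (.instr (.copy 24 2)) .skip)
    (.seq (.instr (.add 25 23 22)) (.seq (.instr (.add 25 25 22))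
      (.seq (.ite (.lt 2 25) (.instr (.copy 25 2)) .skip)
        (.block [.copy 26 23, .copy 27 24] (.instr (.copy 28 23)))))))

theorem passSetup_spec {W n w s : ℕ} {σ : State} (hW : s + 2 * w < W) (h2 : σ.reg 2 = n)
    (h22 : σ.reg 22 = w) (h23 : σ.reg 23 = s) :
    WP W passSetup σ fun T τ => T ≤ 12 ∧ MFrame SortReg (fun _ => False) σ τ ∧
      τ.reg 22 = w ∧ τ.reg 23 = s ∧ τ.reg 24 = min (s + w) n ∧ τ.reg 25 = min (s + 2 * w) n ∧
      τ.reg 26 = s ∧ τ.reg 27 = min (s + w) n ∧ τ.reg 28 = s := by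
  unfold passSetup
  simp only [Prog.block, wp_seq, wp_ite, wp_skip, wp_instr, Instr.Fits, Instr.exec, State.setReg,
    Function.update_apply, if_true, if_false, Nat.reduceEqDiff, h2, h22, h23, Test.Holds]
  have hfr : ∀ f : ℕ → ℕ, (∀ x, ¬ SortReg x → f x = σ.reg x) →
      MFrame SortReg (fun _ => False) σ ⟨f, σ.rreg, σ.mem, σ.rmem⟩ :=
    fun f hf => ⟨hf, fun _ _ => rfl, rfl⟩
  have hx : ∀ x, ¬ SortReg x → x ≠ 24 ∧ x ≠ 25 ∧ x ≠ 26 ∧ x ≠ 27 ∧ x ≠ 28 := by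
    intro x hx
    simp only [SortReg, TempReg] at hx
    omega
  refine ⟨by omega, fun h1 => ⟨trivial, by omega, by omega, fun h2 => ?_, fun h2 => ?_⟩,
    fun h1 => ⟨by omega, by omega, fun h2 => ?_, fun h2 => ?_⟩⟩
  all_goals
    simp only [true_and, and_true]
    refine ⟨by omega, hfr _ fun x h => ?_, ?_⟩
    · simp [hx x h]
    · omega

/-- `D` is sorted within the blocks of `w` positions. -/
def SortedBlocks {α : Type*} [LE α] (K : ℕ → α) (D : ℕ → ℕ) (w n : ℕ) : Prop :=
  ∀ u v, u ≤ v → v < n → u / w = v / w → K (D u) ≤ K (D v)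

theorem SortedBlocks.sortedOn {α : Type*} [LE α] {K : ℕ → α} {D : ℕ → ℕ} {w n : ℕ}
    (h : SortedBlocks K D w n) (q : ℕ) {e : ℕ} (he : e ≤ n) (he' : e ≤ (q + 1) * w) :
    SortedOn K D (q * w) e := by
  intro u v hu huv hv
  refine h u v huv (by omega) ?_
  rw [Nat.div_eq_of_lt_le (k := q) hu (by omega),
    Nat.div_eq_of_lt_le (k := q) (by omega) (by omega)]

/-- One pass of merge sort: merge adjacent runs of the length stored in register `22`. -/
def mergePass (p : Prog) : Prog :=
  .seq (.instr (.const 23 0)) (.loop (.lt 23 2)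
    (.seq passSetup (.seq (mergeRuns p) (.instr (.copy 23 25)))))

theorem mergePass_spec {α : Type*} [LinearOrder α] {W d n c X w : ℕ} {rm : ℕ → ℝ} {p : Prog}
    {K : ℕ → α} (hp : Compares W d n c rm p K) {A : ℕ → ℕ} (hA : ∀ i < n, A i < n) {σ₀ : State}
    (hX : X + 2 * n < W) (hw : 0 < w) (hWw : n + 2 * w + 2 < W)
    (h1 : σ₀.reg 1 = 1) (h2 : σ₀.reg 2 = n) (hrm : σ₀.rmem = rm) (h20 : σ₀.reg 20 = X)
    (h21 : σ₀.reg 21 = X + n) (h22 : σ₀.reg 22 = w)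
    (hmem : ∀ i < n, σ₀.mem (X + i) = A i) (hs : SortedBlocks K A w n) :
    WP W (mergePass p) σ₀ fun T τ => T ≤ n * (c + 29) + 2 ∧
      MFrame SortReg (fun x => X + n ≤ x ∧ x < X + n + n) σ₀ τ ∧ τ.reg 22 = w ∧
      SortedBlocks K (fun u => τ.mem (X + n + u)) (2 * w) n ∧
      ∀ f : ℕ → ℕ, ∑ u ∈ Finset.range n, f (τ.mem (X + n + u)) =
        ∑ u ∈ Finset.range n, f (A u) := by
  have hloop := wp_loop (W := W) (b := .lt 23 2)
    (p := .seq passSetup (.seq (mergeRuns p) (.instr (.copy 23 25))))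
    -- The start of a merge is a multiple of `2 * w` only as long as something is left to merge; the
    -- last merge is cut off at `n`.
    (I := fun k σ => ∃ s, k = (n - s) * (c + 29) ∧ s ≤ n ∧ (s < n → ∃ q, s = q * (2 * w)) ∧
      MFrame SortReg (fun x => X + n ≤ x ∧ x < X + n + n) σ₀ σ ∧ σ.reg 22 = w ∧ σ.reg 23 = s ∧
      SortedBlocks K (fun u => σ.mem (X + n + u)) (2 * w) s ∧
      ∀ f : ℕ → ℕ, ∑ u ∈ Finset.Ico 0 s, f (σ.mem (X + n + u)) =
        ∑ u ∈ Finset.Ico 0 s, f (A u)) (by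
    rintro k σ ⟨s, rfl, hsn, hsq, hF, r22, r23, hsort, hsum⟩ hb
    have r2 : σ.reg 2 = n := by rw [hF.reg _ (by simp [SortReg, TempReg]), h2]
    simp only [Test.Holds, r23, r2] at hb
    obtain ⟨q, hq⟩ := hsq hb
    rw [wp_seq]
    refine (passSetup_spec (by omega) r2 r22 r23).mono ?_
    rintro T τ ⟨hT, hτ, t22, t23, t24, t25, t26, t27, t28⟩
    have hFτ := hF.trans (hτ.mono (fun _ h => h) fun _ h => h.elim)
    have t2 : τ.reg 2 = n := by rw [hFτ.reg _ (by simp [SortReg, TempReg]), h2]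
    have t1 : τ.reg 1 = 1 := by rw [hFτ.reg _ (by simp [SortReg, TempReg]), h1]
    have t20 : τ.reg 20 = X := by rw [hFτ.reg _ (by simp [SortReg, TempReg]), h20]
    have t21 : τ.reg 21 = X + n := by rw [hFτ.reg _ (by simp [SortReg, TempReg]), h21]
    have hmemτ : ∀ i < n, τ.mem (X + i) = A i := fun i hi => by
      rw [hFτ.mem _ (by omega), hmem i hi]
    have hD : ∀ u, τ.mem u = σ.mem u := fun u => hτ.mem u (fun h => h)
    obtain ⟨b, hb'⟩ : ∃ b, min (s + w) n = b := ⟨_, rfl⟩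
    obtain ⟨e, he'⟩ : ∃ e, min (s + 2 * w) n = e := ⟨_, rfl⟩
    rw [hb'] at t24 t27
    rw [he'] at t25
    have hq1 : (2 * q + 1) * w = q * (2 * w) + w := by ring
    have hq2 : (2 * q + 1 + 1) * w = q * (2 * w) + 2 * w := by ring
    have hs1 : SortedOn K A s b := by
      have := hs.sortedOn (2 * q) (e := b) (by omega) (by omega)
      rwa [show 2 * q * w = s by rw [hq]; ring] at this
    have hs2 : SortedOn K A b e := by
      rcases le_or_gt n (s + w) with hle | hgt
      · intro u v h1 h2 h3; omega
      · have := hs.sortedOn (2 * q + 1) (e := e) (by omega) (by omega)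
        rwa [show (2 * q + 1) * w = b by rw [← hb', min_eq_left hgt.le, hq]; ring] at this
    rw [wp_seq]
    refine (mergeRuns_spec hp hA (by omega) hX t1 (hFτ.rmem.trans hrm) t20 t21 hmemτ t24 t25 t26
      t27 t28 (by omega) (by omega) (by omega) hs1 hs2).mono ?_
    rintro U ρ ⟨hU, hρ, hsρ, hsumρ⟩
    have hFρ := hFτ.trans (hρ.mono (fun _ => MergeReg.sort) (fun x h => by omega))
    have q22 : ρ.reg 22 = w := by rw [hρ.reg _ (by simp [MergeReg, TempReg]), t22]
    have q25 : ρ.reg 25 = e := by rw [hρ.reg _ (by simp [MergeReg, TempReg]), t25]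
    have hDρ : ∀ u < s, ρ.mem (X + n + u) = σ.mem (X + n + u) := fun u hu => by
      rw [hρ.mem _ (by omega), hD]
    simp only [wp_instr, Instr.Fits, Instr.exec, q25, true_and]
    refine ⟨_, ?_, e, rfl, by omega, ?_, ?_, ?_, ?_, ?_, ?_⟩
    -- A merge of `z` elements has an overhead of `15` steps. As `z` is positive, this overhead is
    -- charged to the elements, which turns `c + 14` per element into `c + 29`.
    · obtain ⟨z, hz⟩ : ∃ z, e = s + z := ⟨e - s, by omega⟩
      obtain ⟨y, hy⟩ : ∃ y, n = e + y := ⟨n - e, by omega⟩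
      have hz1 : 1 ≤ z := by omega
      rw [show n - s = z + y by omega, show n - e = y by omega,
        show (z + y) * (c + 29) = z * (c + 14) + 15 * z + y * (c + 29) by ring]
      rw [show e - s = z by omega] at hU
      omega
    · intro hen
      exact ⟨q + 1, by rw [← he', min_eq_left (by omega), hq]; ring⟩
    · refine hFρ.trans ⟨fun x hx => ?_, fun _ _ => rfl, rfl⟩
      simp only [SortReg, TempReg] at hx
      have : x ≠ 23 := by omega
      simp [State.setReg, this]
    · simp [State.setReg, q22]
    · simp [State.setReg]
    · intro u v huv hv huv'
      simp only [State.setReg]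
      rcases lt_or_ge v s with hvs | hvs
      · rw [hDρ u (by omega), hDρ v hvs]
        exact hsort u v huv hvs huv'
      · refine hsρ u v ?_ huv hv
        -- Since `v` lies in the block `q` that was merged last, so does `u`; hence `u` is at least
        -- the start of that block.
        rw [Nat.div_eq_of_lt_le (m := v) (k := q) (by omega) (by rw [add_mul, ← hq]; omega)]
          at huv'
        have := Nat.div_mul_le_self u (2 * w)
        rw [huv'] at this
        omega
    · intro f
      simp only [State.setReg]
      rw [← Finset.sum_Ico_consecutive _ (Nat.zero_le s) (show s ≤ e by omega),
        ← Finset.sum_Ico_consecutive (fun u => f (A u)) (Nat.zero_le s) (show s ≤ e by omega),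
        hsumρ, ← hsum]
      congr 1
      refine Finset.sum_congr rfl fun u hu => ?_
      rw [Finset.mem_Ico] at hu
      rw [hDρ u hu.2])
  unfold mergePass
  simp only [wp_seq, wp_instr, Instr.Fits, Instr.exec]
  refine ⟨by omega, (hloop (k := n * (c + 29)) (σ := σ₀.setReg 23 0)
    ⟨0, by simp, by omega, fun _ => ⟨0, by simp⟩,
    ⟨fun x hx => ?_, fun _ _ => rfl, rfl⟩, ?_, ?_, ?_, by simp⟩).mono ?_⟩
  · simp only [SortReg, TempReg] at hx
    have : x ≠ 23 := by omega
    simp [State.setReg, this]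
  · simp [State.setReg, h22]
  · simp [State.setReg]
  · intro u v _ hv
    omega
  · rintro T τ ⟨hT, hb, k, s, -, hsn, -, hF, r22, r23, hsort, hsum⟩
    have r2 : τ.reg 2 = n := by rw [hF.reg _ (by simp [SortReg, TempReg]), h2]
    simp only [Test.Holds, r23, r2] at hb
    obtain rfl : s = n := by omega
    refine ⟨by omega, hF, r22, hsort, fun f => ?_⟩
    simpa using hsum f

/-- Fill an array: for `i < n`, the value that the routine `p` computes in register `10` is stored
at the address that it computes in register `15`; the register `x` holds `i`. -/
def fillLoop (x : ℕ) (p : Prog) : Prog :=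
  .seq (.instr (.const x 0)) (forTo x 2 (.seq p (.instr (.store 15 10))))

/-- The registers that a loop with index register `x` may change. -/
def FillReg (x y : ℕ) : Prop := TempReg y ∨ y = x

/-- Injectivity of the target positions ensures that no value is overwritten later. It allows the
loop to serve for copying as well as for scattering along a permutation or a partition. -/
theorem fillLoop_spec {W n t Y N x : ℕ} {p : Prog} {g v : ℕ → ℕ} {σ₀ : State} (hW : n < W)
    (hx : 20 ≤ x) (h1 : σ₀.reg 1 = 1) (h2 : σ₀.reg 2 = n) (hg : ∀ i < n, g i < N)
    (hinj : Set.InjOn g (Set.Iio n))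
    (hp : ∀ i < n, ∀ σ, MFrame (FillReg x) (fun a => Y ≤ a ∧ a < Y + N) σ₀ σ →
      σ.reg x = i → WP W p σ fun T τ => T ≤ t ∧ MFrame TempReg (fun _ => False) σ τ ∧
        τ.reg 15 = Y + g i ∧ τ.reg 10 = v i) :
    WP W (fillLoop x p) σ₀ fun T τ => T ≤ n * (t + 3) + 2 ∧
      MFrame (FillReg x) (fun a => Y ≤ a ∧ a < Y + N) σ₀ τ ∧
      ∀ i < n, τ.mem (Y + g i) = v i := by
  have n1 : ¬ FillReg x 1 := by simp only [FillReg, TempReg]; omega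
  have n2 : ¬ FillReg x 2 := by simp only [FillReg, TempReg]; omega
  have hset : ∀ (σ : State) (i : ℕ), MFrame (FillReg x) (fun a => Y ≤ a ∧ a < Y + N) σ
      (σ.setReg x i) := by
    refine fun σ i => ⟨fun y hy => ?_, fun _ _ => rfl, rfl⟩
    have : y ≠ x := fun h => hy (Or.inr h)
    simp [State.setReg, this]
  unfold fillLoop
  simp only [wp_seq, wp_instr, Instr.Fits, Instr.exec]
  refine ⟨by omega, (wp_forTo (W := W) n (t + 1) (fun i σ => σ.reg x = i ∧
    MFrame (FillReg x) (fun a => Y ≤ a ∧ a < Y + N) σ₀ σ ∧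
      ∀ i' < i, σ.mem (Y + g i') = v i') hW ?_ ?_ ?_).mono ?_⟩
  · rintro k σ ⟨hk, hF, -⟩
    exact ⟨hk, by rw [hF.reg _ n2, h2]⟩
  · rintro i σ hi ⟨hxi, hF, hv⟩
    rw [wp_seq]
    refine (hp i hi σ hF hxi).mono ?_
    rintro T τ ⟨hT, hτ, t15, t10⟩
    have hFτ := hF.trans (hτ.mono (fun _ h => Or.inl h) fun _ h => h.elim)
    have hgi := hg i hi
    simp only [wp_instr, Instr.Fits, Instr.exec, t15, t10, true_and]
    have hst : MFrame (FillReg x) (fun a => Y ≤ a ∧ a < Y + N) τ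
        { τ with mem := Function.update τ.mem (Y + g i) (v i) } :=
      ⟨fun _ _ => rfl, fun a ha => Function.update_of_ne (by omega) _ _, rfl⟩
    refine ⟨by omega, ?_, ?_, ?_, (hFτ.trans hst).trans (hset _ _), ?_⟩
    · rw [hτ.reg _ (by simp only [TempReg]; omega), hxi]
    · rw [hFτ.reg _ n1, h1]
    · simp [State.setReg]
    · intro i' hi'
      simp only [State.setReg]
      rcases Nat.lt_succ_iff_lt_or_eq.1 hi' with hlt | rfl
      · have : g i' ≠ g i := fun h => hlt.ne (hinj (by simp; omega) (by simpa) h)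
        rw [Function.update_of_ne (by omega), hτ.mem _ (fun h => h), hv i' hlt]
      · rw [Function.update_self]
  · exact ⟨by simp [State.setReg], hset _ _, by simp⟩
  · rintro T τ ⟨hT, -, hF, hv⟩
    rw [show t + 1 + 2 = t + 3 from rfl] at hT
    exact ⟨by omega, hF, hv⟩

theorem FillReg.sort {x : ℕ} (h : FillReg 23 x) : SortReg x := by
  unfold FillReg TempReg at h; unfold SortReg TempReg; omega

/-- The first `n` entries of `A` are a permutation of the numbers below `n`. -/
def PermOn (n : ℕ) (A : ℕ → ℕ) : Prop :=
  ∀ f : ℕ → ℕ, ∑ u ∈ Finset.range n, f (A u) = ∑ u ∈ Finset.range n, f u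

theorem PermOn.cntP {n : ℕ} {A : ℕ → ℕ} (h : PermOn n A) (P : ℕ → Prop) :
    cntP (fun i => P (A i)) 0 n = cntP P 0 n := by
  classical
  have := h fun v => if P v then 1 else 0
  simp only [RangeCount.cntP, Finset.card_filter, ← Finset.range_eq_Ico]
  convert this

theorem PermOn.lt {n : ℕ} {A : ℕ → ℕ} (h : PermOn n A) : ∀ i < n, A i < n := by
  have h0 := h.cntP fun v => ¬ v < n
  rw [cntP_eq_zero.2 (fun i _ hi => not_not.2 hi)] at h0
  exact fun i hi => not_not.1 (cntP_eq_zero.1 h0 i (Nat.zero_le i) hi)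

/-- Test the equality of sums with the indicator of the value `A i`. Among the numbers below `n` it
is attained at most once, so no second position can carry it. -/
theorem PermOn.injOn {n : ℕ} {A : ℕ → ℕ} (h : PermOn n A) : Set.InjOn A (Set.Iio n) := by
  intro i hi j hj hij
  by_contra hne
  have h0 := h fun v => if v = A i then 1 else 0
  have h1 : ∑ u ∈ Finset.range n, (if u = A i then 1 else 0) ≤ 1 := by
    rw [Finset.sum_ite_eq' (Finset.range n) (A i)]
    split_ifs <;> simp
  rw [← h0, ← Finset.card_filter, Finset.card_le_one] at h1
  exact hne (h1 i (by simpa using hi) j (by simpa [hij] using hj))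

theorem PermOn.congr {n : ℕ} {A B : ℕ → ℕ} (h : PermOn n A) (hAB : ∀ i < n, B i = A i) :
    PermOn n B := fun f => by
  rw [← h f]
  exact Finset.sum_congr rfl fun u hu => by rw [hAB u (by simpa using hu)]

/-- Copy the array at the address in register `21` to the address in register `20`. -/
def copyBack : Prog :=
  fillLoop 23 (.block [.add 15 21 23, .load 10 15] (.instr (.add 15 20 23)))

/-- All passes of merge sort. -/
def mergePasses (p : Prog) : Prog :=
  .seq (.instr (.const 22 1)) (.loop (.lt 22 2)
    (.seq (mergePass p) (.seq copyBack (.instr (.add 22 22 22)))))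

/-- The runs double from length `1`, so after `k` rounds a run has length `2 ^ k`, and `L` rounds
suffice. During a pass the run length is below `n`, so `3 * n + 2` bounds the words that the setup
of a merge forms. -/
theorem mergePasses_spec {α : Type*} [LinearOrder α] {W d n c X L : ℕ} {rm : ℕ → ℝ} {p : Prog}
    {K : ℕ → α} (hp : Compares W d n c rm p K) {σ₀ : State}
    (hX : X + 2 * n < W) (hW : 3 * n + 2 < W) (hL : n ≤ 2 ^ L)
    (h1 : σ₀.reg 1 = 1) (h2 : σ₀.reg 2 = n) (hrm : σ₀.rmem = rm) (h20 : σ₀.reg 20 = X)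
    (h21 : σ₀.reg 21 = X + n) (hA : PermOn n fun i => σ₀.mem (X + i)) :
    WP W (mergePasses p) σ₀ fun T τ => T ≤ L * (n * (c + 35) + 6) + 2 ∧
      MFrame SortReg (fun x => X ≤ x ∧ x < X + 2 * n) σ₀ τ ∧
      SortedOn K (fun u => τ.mem (X + u)) 0 n ∧ PermOn n fun i => τ.mem (X + i) := by
  have hloop := wp_loop (W := W) (b := .lt 22 2)
    (p := .seq (mergePass p) (.seq copyBack (.instr (.add 22 22 22))))
    -- Each element pays `c + 29` for the pass and `6` for being copied back; the remaining `6`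
    -- steps cover the starts of the two loops, the doubling and the test.
    (I := fun b σ => ∃ k w, b = k * (n * (c + 35) + 6) ∧ 0 < w ∧ n ≤ w * 2 ^ k ∧
      MFrame SortReg (fun x => X ≤ x ∧ x < X + 2 * n) σ₀ σ ∧ σ.reg 22 = w ∧
      SortedBlocks K (fun u => σ.mem (X + u)) w n ∧ PermOn n fun i => σ.mem (X + i)) (by
    rintro b σ ⟨k, w, rfl, hw, hk, hF, r22, hs, hperm⟩ hb
    have r2 : σ.reg 2 = n := by rw [hF.reg _ (by simp [SortReg, TempReg]), h2]
    have r1 : σ.reg 1 = 1 := by rw [hF.reg _ (by simp [SortReg, TempReg]), h1]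
    have r20 : σ.reg 20 = X := by rw [hF.reg _ (by simp [SortReg, TempReg]), h20]
    have r21 : σ.reg 21 = X + n := by rw [hF.reg _ (by simp [SortReg, TempReg]), h21]
    simp only [Test.Holds, r22, r2] at hb
    obtain ⟨k, rfl⟩ : ∃ k', k = k' + 1 := by
      refine ⟨k - 1, ?_⟩
      rcases k with _ | k
      · simp at hk; omega
      · rfl
    rw [wp_seq]
    refine (mergePass_spec hp hperm.lt hX hw (by omega) r1 r2 (hF.rmem.trans hrm) r20 r21 r22
      (fun _ _ => rfl) hs).mono ?_
    rintro T τ ⟨hT, hτ, t22, hsτ, hsum⟩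
    have hFτ := hF.trans (hτ.mono (fun _ h => h) fun x h => by omega)
    have t2 : τ.reg 2 = n := by rw [hFτ.reg _ (by simp [SortReg, TempReg]), h2]
    have t1 : τ.reg 1 = 1 := by rw [hFτ.reg _ (by simp [SortReg, TempReg]), h1]
    have t20 : τ.reg 20 = X := by rw [hFτ.reg _ (by simp [SortReg, TempReg]), h20]
    have t21 : τ.reg 21 = X + n := by rw [hFτ.reg _ (by simp [SortReg, TempReg]), h21]
    rw [wp_seq]
    refine (fillLoop_spec (W := W) (n := n) (t := 3) (Y := X) (N := n) (g := fun i => i)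
      (v := fun i => τ.mem (X + n + i)) (by omega) (by omega) t1 t2 (fun i hi => hi)
      (fun _ _ _ _ h => h)
      ?_).mono ?_
    · intro i hi ν hν h23
      have n20 : ν.reg 20 = X := by rw [hν.reg _ (by simp [FillReg, TempReg]), t20]
      have n21 : ν.reg 21 = X + n := by rw [hν.reg _ (by simp [FillReg, TempReg]), t21]
      simp only [Prog.block, wp_seq, wp_instr, Instr.Fits, Instr.exec, State.setReg,
        Function.update_apply, if_true, if_false, Nat.reduceEqDiff, n20, n21, h23]
      refine ⟨by omega, trivial, by omega, by omega, ⟨fun x hx => ?_, fun _ _ => rfl, rfl⟩,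
        trivial, hν.mem _ (by omega)⟩
      have : x ≠ 10 ∧ x ≠ 15 := by simp only [TempReg] at hx; omega
      simp [this]
    · rintro U ρ ⟨hU, hρ, hv⟩
      have hFρ := hFτ.trans (hρ.mono (fun _ => FillReg.sort) fun x h => by omega)
      have q22 : ρ.reg 22 = w := by rw [hρ.reg _ (by simp [FillReg, TempReg]), t22]
      simp only [wp_instr, Instr.Fits, Instr.exec, q22]
      refine ⟨by omega, k * (n * (c + 35) + 6), ?_, k, w + w, rfl, by omega, ?_, ?_, ?_, ?_, ?_⟩
      · rw [add_mul k 1]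
        have : n * (c + 35) = n * (c + 29) + n * 6 := by ring
        omega
      · rw [pow_succ] at hk
        calc n ≤ w * (2 ^ k * 2) := hk
          _ = (w + w) * 2 ^ k := by ring
      · refine hFρ.trans ⟨fun x hx => ?_, fun _ _ => rfl, rfl⟩
        have : x ≠ 22 := by simp only [SortReg, TempReg] at hx; omega
        simp [State.setReg, this]
      · simp [State.setReg]
      · intro u v huv hvn huv'
        simp only [State.setReg]
        rw [hv u (by omega), hv v hvn]
        exact hsτ u v huv hvn (by rwa [two_mul])
      · intro f
        rw [← hperm f, ← hsum f]
        refine Finset.sum_congr rfl fun u hu => ?_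
        simp only [State.setReg]
        rw [hv u (by simpa using hu)])
  unfold mergePasses
  simp only [wp_seq, wp_instr, Instr.Fits, Instr.exec]
  refine ⟨by omega, (hloop (k := L * (n * (c + 35) + 6)) (σ := σ₀.setReg 22 1)
    ⟨L, 1, rfl, by omega, by simpa using hL,
    ⟨fun x hx => ?_, fun _ _ => rfl, rfl⟩, ?_, ?_, hA⟩).mono ?_⟩
  · have : x ≠ 22 := by simp only [SortReg, TempReg] at hx; omega
    simp [State.setReg, this]
  · simp [State.setReg]
  · intro u v huv _ huv'
    rw [Nat.div_one, Nat.div_one] at huv'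
    rw [huv']
  · rintro T τ ⟨hT, hb, b, k, w, -, hw, -, hF, r22, hs, hperm⟩
    have r2 : τ.reg 2 = n := by rw [hF.reg _ (by simp [SortReg, TempReg]), h2]
    simp only [Test.Holds, r22, r2] at hb
    refine ⟨by omega, hF, fun u v _ huv hv => hs u v huv hv ?_, hperm⟩
    rw [Nat.div_eq_of_lt (by omega), Nat.div_eq_of_lt (by omega)]

/-- Compute the sorted order of the points and their ranks. -/
def sortRank (p : Prog) : Prog :=
  .seq (fillLoop 23 (.seq (.instr (.add 15 20 23)) (.instr (.copy 10 23))))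
    (.seq (mergePasses p)
      (fillLoop 23 (.block [.add 15 20 23, .load 15 15, .add 15 21 15] (.instr (.copy 10 23)))))

/-- The ranks are the inverse of the sorting permutation. They are obtained by writing `i` into the
cell that belongs to the `i`-th point of the sorted order. -/
theorem sortRank_spec {α : Type*} [LinearOrder α] {W d n c X L : ℕ} {rm : ℕ → ℝ} {p : Prog}
    {K : ℕ → α} (hp : Compares W d n c rm p K) {σ₀ : State} (hn : 0 < n) (hL0 : 0 < L)
    (hX : X + 2 * n < W) (hW : 3 * n + 2 < W) (hL : n ≤ 2 ^ L)
    (h1 : σ₀.reg 1 = 1) (h2 : σ₀.reg 2 = n) (hrm : σ₀.rmem = rm) (h20 : σ₀.reg 20 = X)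
    (h21 : σ₀.reg 21 = X + n) :
    WP W (sortRank p) σ₀ fun T τ => T ≤ (c + 60) * (n * L) ∧
      MFrame SortReg (fun x => X ≤ x ∧ x < X + 2 * n) σ₀ τ ∧
      SortedOn K (fun u => τ.mem (X + u)) 0 n ∧ PermOn n (fun i => τ.mem (X + i)) ∧
      ∀ i < n, τ.mem (X + n + τ.mem (X + i)) = i := by
  unfold sortRank
  rw [wp_seq]
  refine (fillLoop_spec (W := W) (n := n) (t := 2) (Y := X) (N := n) (g := fun i => i)
      (v := fun i => i) (by omega) (by omega) h1 h2 (fun i hi => hi) (fun _ _ _ _ h => h)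
      ?_).mono ?_
  · intro i hi ν hν h23
    have n20 : ν.reg 20 = X := by rw [hν.reg _ (by simp [FillReg, TempReg]), h20]
    simp only [wp_seq, wp_instr, Instr.Fits, Instr.exec, State.setReg,
      Function.update_apply, if_true, if_false, Nat.reduceEqDiff, n20, h23]
    refine ⟨by omega, trivial, by omega, ⟨fun x hx => ?_, fun _ _ => rfl, rfl⟩, trivial, trivial⟩
    have : x ≠ 10 ∧ x ≠ 15 := by simp only [TempReg] at hx; omega
    simp [this]
  rintro T τ ⟨hT, hτ, hv⟩
  have hFτ : MFrame SortReg (fun x => X ≤ x ∧ x < X + 2 * n) σ₀ τ :=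
    hτ.mono (fun _ => FillReg.sort) fun x h => by omega
  rw [wp_seq]
  refine (mergePasses_spec hp hX hW hL (by rw [hFτ.reg _ (by simp [SortReg, TempReg]), h1])
    (by rw [hFτ.reg _ (by simp [SortReg, TempReg]), h2]) (hτ.rmem.trans hrm)
    (by rw [hFτ.reg _ (by simp [SortReg, TempReg]), h20])
    (by rw [hFτ.reg _ (by simp [SortReg, TempReg]), h21])
    (PermOn.congr (A := fun i => i) (fun _ => rfl) hv)).mono ?_
  rintro U ρ ⟨hU, hρ, hs, hperm⟩
  have hFρ := hFτ.trans hρ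
  refine (fillLoop_spec (W := W) (n := n) (t := 4) (Y := X + n) (N := n)
    (g := fun i => ρ.mem (X + i)) (v := fun i => i) (by omega) (by omega)
    (by rw [hFρ.reg _ (by simp [SortReg, TempReg]), h1])
    (by rw [hFρ.reg _ (by simp [SortReg, TempReg]), h2])
    hperm.lt hperm.injOn ?_).mono ?_
  · intro i hi ν hν h23
    have n20 : ν.reg 20 = X := by
      rw [hν.reg _ (by simp [FillReg, TempReg]), hFρ.reg _ (by simp [SortReg, TempReg]), h20]
    have n21 : ν.reg 21 = X + n := by
      rw [hν.reg _ (by simp [FillReg, TempReg]), hFρ.reg _ (by simp [SortReg, TempReg]), h21]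
    have hm : ν.mem (X + i) = ρ.mem (X + i) := hν.mem _ (by omega)
    have := hperm.lt i hi
    simp only [Prog.block, wp_seq, wp_instr, Instr.Fits, Instr.exec, State.setReg,
      Function.update_apply, if_true, if_false, Nat.reduceEqDiff, n20, n21, h23, hm]
    refine ⟨by omega, trivial, by omega, trivial, by omega, ⟨fun x hx => ?_, fun _ _ => rfl, rfl⟩,
      trivial, trivial⟩
    have : x ≠ 10 ∧ x ≠ 15 := by simp only [TempReg] at hx; omega
    simp [this]
  rintro V ν ⟨hV, hν, hvν⟩
  have hm : ∀ i < n, ν.mem (X + i) = ρ.mem (X + i) := fun i hi => hν.mem _ (by omega)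
  refine ⟨?_, hFρ.trans (hν.mono (fun _ => FillReg.sort) fun x h => by omega),
    fun u v hu huv hv => ?_,
    hperm.congr hm, fun i hi => ?_⟩
  · have e1 : n ≤ n * L := Nat.le_mul_of_pos_right n hL0
    have e2 : L ≤ n * L := Nat.le_mul_of_pos_left L hn
    have e3 : L * (n * (c + 35) + 6) = c * (n * L) + 35 * (n * L) + 6 * L := by ring
    rw [e3] at hU
    rw [add_mul]
    omega
  · simp only [hm u (by omega), hm v hv]
    exact hs u v hu huv hv
  · rw [hm i hi]
    exact hvν i hi

/-! ## The counting structure -/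

/-- The number of words of the structure for `m` constrained coordinates. -/
def dsSize (d n L : ℕ) : ℕ → ℕ
  | 0 => 0
  | m + 1 => d * L * (2 * n + 1 + dsSize d n L m)

/-- The bit of weight `2 ^ e` of the rank. -/
def rankBit (rk : ℕ → ℕ) (e u : ℕ) : ℕ := rk u / 2 ^ e % 2

/-- The memory holds, from the address `B` on, the structure for `m` constrained coordinates on the
sequence `A`. It consists, for each coordinate `j`, of `L` blocks, one for each bit of the rank,
starting with the highest bit. A block holds the numbers of zero bits in the prefixes of the current
sequence, the stably partitioned sequence, and a structure for `m - 1` constrained coordinates on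
the latter. -/
def DS (d n L : ℕ) (rk : ℕ → ℕ → ℕ) (mem : ℕ → ℕ) : ℕ → (ℕ → ℕ) → ℕ → Prop
  | 0, _, _ => True
  | m + 1, A, B => ∀ j < d, ∃ seq : ℕ → ℕ → ℕ, seq 0 = A ∧ ∀ ℓ < L,
      IsPart n (rankBit (rk j) (L - 1 - ℓ)) (seq ℓ) (seq (ℓ + 1)) ∧
      (∀ i ≤ n, mem (B + (j * L + ℓ) * (2 * n + 1 + dsSize d n L m) + i) =
        zeros (rankBit (rk j) (L - 1 - ℓ)) (seq ℓ) i) ∧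
      DS d n L rk mem m (seq (ℓ + 1))
        (B + (j * L + ℓ) * (2 * n + 1 + dsSize d n L m) + 2 * n + 1)

theorem block_le {d L j ℓ w : ℕ} (hj : j < d) (hℓ : ℓ < L) :
    (j * L + ℓ) * w + w ≤ d * L * w := by
  have h1 : (j + 1) * L ≤ d * L := Nat.mul_le_mul_right _ hj
  have h2 : (j * L + ℓ + 1) * w ≤ d * L * w := Nat.mul_le_mul_right _ (by rw [add_mul] at h1; omega)
  rwa [add_mul, one_mul] at h2

/-- A structure depends only on its own `dsSize` words. This makes finished blocks immune to the
construction of later ones, and the whole structure immune to the erasure of all other memory before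
a query. -/
theorem DS.congr {d n L : ℕ} {rk : ℕ → ℕ → ℕ} {mem mem' : ℕ → ℕ} {m : ℕ} {A : ℕ → ℕ} {B : ℕ}
    (h : DS d n L rk mem m A B)
    (hm : ∀ x, B ≤ x → x < B + dsSize d n L m → mem' x = mem x) : DS d n L rk mem' m A B := by
  induction m generalizing A B with
  | zero => trivial
  | succ m ih =>
    intro j hj
    obtain ⟨seq, h0, hs⟩ := h j hj
    refine ⟨seq, h0, fun ℓ hℓ => ?_⟩
    obtain ⟨h1, h2, h3⟩ := hs ℓ hℓ
    have hb := block_le (w := 2 * n + 1 + dsSize d n L m) hj hℓ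
    simp only [dsSize] at hm
    refine ⟨h1, fun i hi => ?_, ih h3 fun x hx hx' => hm x (by omega) (by omega)⟩
    rw [hm _ (by omega) (by omega)]
    exact h2 i hi

/-! ### Building one block: rank bits, prefix counts and the partition -/

/-- Compute `dsSize` in the register `x`. -/
def sizeProg (d x : ℕ) : ℕ → Prog
  | 0 => .instr (.const x 0)
  | m + 1 => .seq (sizeProg d x m)
      (.block [.add x x 2, .add x x 2, .add x x 1, .const 19 d, .mul x x 19] (.instr (.mul x x 4)))

theorem width_le_dsSize {d n L m : ℕ} (hd : 0 < d) (hL : 0 < L) :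
    2 * n + 1 + dsSize d n L m ≤ dsSize d n L (m + 1) :=
  Nat.le_mul_of_pos_left _ (Nat.mul_pos hd hL)

theorem sizeProg_spec {W d n L x m : ℕ} (hd : 0 < d) (hL : 0 < L) (hx : 20 ≤ x) {σ : State}
    (h1 : σ.reg 1 = 1) (h2 : σ.reg 2 = n) (h4 : σ.reg 4 = L) (hdW : d < W)
    (hW : dsSize d n L m < W) :
    WP W (sizeProg d x m) σ fun T τ => T ≤ 6 * m + 1 ∧ Frame d (FillReg x) σ τ ∧
      τ.reg x = dsSize d n L m := by
  induction m with
  | zero =>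
    simp only [sizeProg, wp_instr, Instr.Fits, Instr.exec, State.setReg, Function.update_self]
    refine ⟨by omega, by omega, ⟨fun y hy => ?_, fun _ _ => rfl, rfl, rfl⟩, rfl⟩
    have : y ≠ x := fun h => hy (Or.inr h)
    simp [this]
  | succ m ih =>
    have hw := width_le_dsSize (n := n) (m := m) hd hL
    have hw2 : (2 * n + 1 + dsSize d n L m) * d ≤ dsSize d n L (m + 1) := by
      simp only [dsSize]
      rw [mul_comm (_ + _) d, mul_right_comm]
      exact Nat.le_mul_of_pos_right _ hL
    have hw3 : (2 * n + 1 + dsSize d n L m) * d * L = dsSize d n L (m + 1) := by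
      simp only [dsSize]; ring
    rw [sizeProg, wp_seq]
    refine (ih (by omega)).mono ?_
    rintro T τ ⟨hT, hτ, tx⟩
    have t1 : τ.reg 1 = 1 := by rw [hτ.reg 1 (by simp only [FillReg, TempReg]; omega), h1]
    have t2 : τ.reg 2 = n := by rw [hτ.reg 2 (by simp only [FillReg, TempReg]; omega), h2]
    have t4 : τ.reg 4 = L := by rw [hτ.reg 4 (by simp only [FillReg, TempReg]; omega), h4]
    obtain ⟨y, rfl⟩ : ∃ y, x = y + 20 := ⟨x - 20, by omega⟩
    have e : dsSize d n L m + n + n + 1 = 2 * n + 1 + dsSize d n L m := by ring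
    simp only [Prog.block, wp_seq, wp_instr, Instr.Fits, Instr.exec, State.setReg,
      Function.update_apply, if_true, if_false, Nat.reduceEqDiff, t1, t2, t4, tx, e, hw3]
    refine ⟨by omega, by omega, by omega, by omega, by omega, by omega, by omega,
      hτ.trans ⟨fun z hz => ?_, fun _ _ => rfl, rfl, rfl⟩, trivial⟩
    have h1 : z ≠ y + 20 := fun h => hz (Or.inr h)
    have h2 : z ≠ 19 := fun h => hz (Or.inl ⟨by omega, by omega⟩)
    simp [h1, h2]

/-- With `f` the current frame and `i` the register of the position, load the entry of the current
sequence into register `10` and the current bit of its rank into register `15`. -/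
def bitProg (f i : ℕ) : Prog :=
  .block [.add 15 (f + 2) i, .load 10 15, .add 15 (f + 5) 10, .load 15 15, .div 15 15 (f + 4),
    .const 16 2, .div 17 15 16, .mul 17 17 16] (.instr (.sub 15 15 17))

theorem bitProg_spec {W d n e a R f x i : ℕ} {A rk : ℕ → ℕ} (hf : 20 ≤ f) (hx : 20 ≤ x)
    {σ : State} (hA : ∀ i < n, A i < n) (hrk : ∀ v < n, rk v < n) (haW : a + n < W)
    (hRW : R + n < W) (hW : 2 < W)
    (hmA : ∀ i < n, σ.mem (a + i) = A i) (hmR : ∀ v < n, σ.mem (R + v) = rk v)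
    (h2 : σ.reg (f + 2) = a) (h4 : σ.reg (f + 4) = 2 ^ e) (h5 : σ.reg (f + 5) = R)
    (hi : i < n) (hxi : σ.reg x = i) :
    WP W (bitProg f x) σ fun T τ => T = 9 ∧ Frame d TempReg σ τ ∧ τ.reg 10 = A i ∧
      τ.reg 15 = rankBit rk e (A i) := by
  obtain ⟨g, rfl⟩ : ∃ g, f = g + 20 := ⟨f - 20, by omega⟩
  obtain ⟨y, rfl⟩ : ∃ y, x = y + 20 := ⟨x - 20, by omega⟩
  have h3 := hA i hi
  have h6 := hrk _ h3
  have h7 : rk (A i) / 2 ^ e ≤ rk (A i) := Nat.div_le_self _ _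
  simp only [bitProg, Prog.block, wp_seq, wp_instr, Instr.Fits, Instr.exec, State.setReg,
    Function.update_apply, if_true, if_false, Nat.reduceEqDiff, Nat.add_assoc, Nat.reduceAdd] at *
  simp only [h2, h4, h5, hxi, hmA i hi, hmR _ h3]
  refine ⟨by omega, trivial, by omega, trivial, trivial, by omega, trivial, by omega, trivial,
    trivial, ⟨fun z hz => ?_, fun _ _ => rfl, rfl, rfl⟩, trivial, ?_⟩
  · have : z ≠ 10 ∧ z ≠ 15 ∧ z ≠ 16 ∧ z ≠ 17 := by simp only [TempReg] at hz; omega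
    simp [this]
  · simp only [rankBit]
    omega

/-- Store the numbers of zero bits in the prefixes of the current sequence. -/
def countPass (f : ℕ) : Prog :=
  .block [.const (f + 6) 0, .const (f + 7) 0, .store (f + 3) (f + 7)]
    (forTo (f + 6) 2 (.seq (bitProg f (f + 6)) (.block [.sub 15 1 15, .add (f + 7) (f + 7) 15,
      .add 16 (f + 3) (f + 6), .add 16 16 1] (.instr (.store 16 (f + 7))))))

/-- The registers that the counting pass may change. -/
def CountReg (f x : ℕ) : Prop := TempReg x ∨ x = f + 6 ∨ x = f + 7

theorem countPass_spec {W n e a R f b : ℕ} {A rk : ℕ → ℕ} (hf : 20 ≤ f)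
    {σ₀ : State} (hA : ∀ i < n, A i < n) (hrk : ∀ v < n, rk v < n) (haW : a + n ≤ b)
    (hRW : R + n ≤ b) (hbW : b + n + 2 < W)
    (hmA : ∀ i < n, σ₀.mem (a + i) = A i) (hmR : ∀ v < n, σ₀.mem (R + v) = rk v)
    (h1 : σ₀.reg 1 = 1) (hn : σ₀.reg 2 = n)
    (h2 : σ₀.reg (f + 2) = a) (h3 : σ₀.reg (f + 3) = b) (h4 : σ₀.reg (f + 4) = 2 ^ e)
    (h5 : σ₀.reg (f + 5) = R) :
    WP W (countPass f) σ₀ fun T τ => T ≤ n * 16 + 4 ∧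
      MFrame (CountReg f) (fun x => b ≤ x ∧ x < b + n + 1) σ₀ τ ∧
      τ.reg (f + 7) = zeros (rankBit rk e) A n ∧
      ∀ i ≤ n, τ.mem (b + i) = zeros (rankBit rk e) A i := by
  obtain ⟨g, rfl⟩ : ∃ g, f = g + 20 := ⟨f - 20, by omega⟩
  simp only [Nat.add_assoc, Nat.reduceAdd] at *
  have hreg : ∀ {σ : State}, MFrame (CountReg (g + 20)) (fun x => b ≤ x ∧ x < b + (n + 1)) σ₀ σ →
      σ.reg 1 = 1 ∧ σ.reg 2 = n ∧ σ.reg (g + 22) = a ∧ σ.reg (g + 23) = b ∧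
      σ.reg (g + 24) = 2 ^ e ∧ σ.reg (g + 25) = R := by
    intro σ hF
    refine ⟨?_, ?_, ?_, ?_, ?_, ?_⟩ <;>
    · rw [hF.reg _ (by simp only [CountReg, TempReg]; omega)]
      assumption
  have hfor := wp_forTo (W := W) (x := g + 26) (y := 2)
    (p := .seq (bitProg (g + 20) (g + 26)) (.block [.sub 15 1 15, .add (g + 27) (g + 27) 15,
      .add 16 (g + 23) (g + 26), .add 16 16 1] (.instr (.store 16 (g + 27))))) n 14
    (fun i σ => σ.reg (g + 26) = i ∧ σ.reg (g + 27) = zeros (rankBit rk e) A i ∧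
      MFrame (CountReg (g + 20)) (fun x => b ≤ x ∧ x < b + (n + 1)) σ₀ σ ∧
      ∀ i' ≤ i, σ.mem (b + i') = zeros (rankBit rk e) A i') (by omega) (by
    rintro k σ ⟨hk, -, hF, -⟩
    exact ⟨hk, (hreg hF).2.1⟩) (by
    rintro i σ hi ⟨hxi, hz, hF, hv⟩
    obtain ⟨r1, r2, r22, r23, r24, r25⟩ := hreg hF
    rw [wp_seq]
    refine (bitProg_spec (W := W) (d := 0) (f := g + 20) (a := a) (R := R) (A := A) (rk := rk)
      hf (by omega) hA hrk (by omega) (by omega) (by omega)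
      (fun u hu => by rw [hF.mem _ (by omega), hmA u hu])
      (fun u hu => by rw [hF.mem _ (by omega), hmR u hu]) r22 r24 r25 hi hxi).mono ?_
    rintro T τ ⟨hT, hτ, -, t15⟩
    have hFτ := hF.trans (hτ.toMFrame _ |>.mono (fun _ h => Or.inl h) fun _ h => h)
    obtain ⟨t1, t2, t22, t23, t24, t25⟩ := hreg hFτ
    have t26 : τ.reg (g + 26) = i := by rw [hτ.reg _ (by simp only [TempReg]; omega), hxi]
    have t27 : τ.reg (g + 27) = zeros (rankBit rk e) A i := by
      rw [hτ.reg _ (by simp only [TempReg]; omega), hz]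
    have hzi := zeros_le (rankBit rk e) A i
    -- The program counts zeros by adding the complement of the bit, which avoids a branch.
    have hz' : zeros (rankBit rk e) A i + (1 - rankBit rk e (A i)) =
        zeros (rankBit rk e) A (i + 1) := by
      by_cases h0 : rankBit rk e (A i) = 0
      · rw [zeros_succ_of h0, h0]
      · rw [zeros_succ_of_not h0]; omega
    simp only [Prog.block, wp_seq, wp_instr, Instr.Fits, Instr.exec, State.setReg,
      Function.update_apply, if_true, if_false, Nat.reduceEqDiff, Nat.left_eq_add,
      Nat.add_eq_left, OfNat.ofNat_ne_zero, one_ne_zero, t1, t15, t23, t26, t27, hz']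
    have hz2 := zeros_le (rankBit rk e) A (i + 1)
    refine ⟨trivial, by omega, by omega, by omega, trivial, by omega, ?_, ?_, ?_, ?_, ?_, ?_⟩
    · simp
    · simp
    · trivial
    · simp
    · refine hFτ.trans ⟨fun y hy => ?_, fun y hy => ?_, rfl⟩
      · have : y ≠ 15 ∧ y ≠ 16 ∧ y ≠ g + 26 ∧ y ≠ g + 27 := by
          simp only [CountReg, TempReg] at hy; omega
        simp [this]
      · have : y ≠ b + i + 1 := by omega
        simp [this]
    · intro i' hi'
      rcases hi'.lt_or_eq with hlt | rfl
      · have : b + i' ≠ b + i + 1 := by omega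
        simp only [this, if_false]
        rw [hτ.mem]
        exact hv i' (by omega)
      · simp [Nat.add_assoc])
  simp only [countPass, Prog.block, wp_seq, wp_instr, Instr.Fits, Instr.exec, State.setReg,
    Nat.add_assoc, Nat.reduceAdd]
  refine ⟨by omega, by omega, trivial, WP.mono (hfor ?_) ?_⟩
  · refine ⟨?_, ?_, ⟨fun y hy => ?_, fun y hy => ?_, rfl⟩, ?_⟩
    · simp
    · simp [zeros_zero]
    · have : y ≠ g + 26 ∧ y ≠ g + 27 := by
        simp only [CountReg, TempReg] at hy; omega
      simp [this]
    · have : y ≠ b := by omega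
      simp [h3, this]
    · intro i' hi'
      obtain rfl : i' = 0 := by omega
      simp [h3, zeros_zero]
  · rintro T τ ⟨hT, -, hz, hF, hv⟩
    exact ⟨by omega, hF, hz, hv⟩

/-- The position of the entry `i` after the partition. -/
noncomputable def partPos (n : ℕ) (b A : ℕ → ℕ) (i : ℕ) : ℕ :=
  if b (A i) = 0 then zeros b A i else zeros b A n + i - zeros b A i

/-- The counts up to `i + 1` include the entry `i` itself, so monotonicity of the counts up to `n`
bounds its position. -/
theorem partPos_lt {n : ℕ} {b A : ℕ → ℕ} {i : ℕ} (hi : i < n) : partPos n b A i < n := by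
  have h1 := zeros_mono b A (show i + 1 ≤ n by omega)
  have h2 := sub_zeros_mono b A (show i + 1 ≤ n by omega)
  have h3 := zeros_le b A n
  have h4 := zeros_le b A i
  unfold partPos
  split_ifs with h
  · rw [zeros_succ_of h] at h1; omega
  · rw [zeros_succ_of_not h] at h2; omega

/-- Entries with equal bits keep their order strictly, since each advances the counter of its own
kind. Entries with different bits go to different sides of the total number of zeros. -/
theorem partPos_ne {n : ℕ} {b A : ℕ → ℕ} {i j : ℕ} (hij : i < j) (hj : j < n) :
    partPos n b A i ≠ partPos n b A j := by
  have h1 := zeros_mono b A (show i + 1 ≤ j by omega)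
  have h1' := zeros_mono b A (show j + 1 ≤ n by omega)
  have h2 := sub_zeros_mono b A (show i + 1 ≤ j by omega)
  have h5 := zeros_mono b A (show j ≤ n by omega)
  have h3 := zeros_le b A j
  have h4 := zeros_le b A i
  unfold partPos
  split_ifs with h h' h'
  · rw [zeros_succ_of h] at h1; omega
  · rw [zeros_succ_of h] at h1; omega
  · rw [zeros_succ_of h'] at h1'; omega
  · rw [zeros_succ_of_not h] at h2; omega

theorem partPos_injOn {n : ℕ} {b A : ℕ → ℕ} : Set.InjOn (partPos n b A) (Set.Iio n) := by
  intro i hi j hj hij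
  rcases lt_trichotomy i j with h | h | h
  · exact absurd hij (partPos_ne h hj)
  · exact h
  · exact absurd hij.symm (partPos_ne h hi)

theorem isPart_of_partPos {n : ℕ} {b A A' : ℕ → ℕ} (h : ∀ i < n, A' (partPos n b A i) = A i) :
    IsPart n b A A' := by
  intro i hi
  have := h i hi
  unfold partPos at this
  constructor <;> intro hb
  · rwa [if_pos hb] at this
  · rwa [if_neg hb] at this

/-- Store the partitioned sequence. -/
def scatterPass (f : ℕ) : Prog :=
  fillLoop (f + 6) (.seq (bitProg f (f + 6)) (.seq (.block [.add 16 (f + 3) (f + 6)]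
    (.instr (.load 16 16))) (.seq (.ite (.eq 15 1) (.seq (.instr (.add 17 (f + 7) (f + 6)))
      (.instr (.sub 16 17 16))) .skip)
    (.block [.add 17 (f + 3) 2, .add 17 17 1] (.instr (.add 15 17 16))))))

theorem scatterPass_spec {W n e a R f b : ℕ} {A rk : ℕ → ℕ} (hf : 20 ≤ f)
    {σ₀ : State} (hA : ∀ i < n, A i < n) (hrk : ∀ v < n, rk v < n) (haW : a + n ≤ b)
    (hRW : R + n ≤ b) (hbW : b + 2 * n + 2 < W)
    (hmA : ∀ i < n, σ₀.mem (a + i) = A i) (hmR : ∀ v < n, σ₀.mem (R + v) = rk v)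
    (h1 : σ₀.reg 1 = 1) (hn : σ₀.reg 2 = n)
    (h2 : σ₀.reg (f + 2) = a) (h3 : σ₀.reg (f + 3) = b) (h4 : σ₀.reg (f + 4) = 2 ^ e)
    (h5 : σ₀.reg (f + 5) = R) (h7 : σ₀.reg (f + 7) = zeros (rankBit rk e) A n)
    (hz : ∀ i ≤ n, σ₀.mem (b + i) = zeros (rankBit rk e) A i) :
    WP W (scatterPass f) σ₀ fun T τ => T ≤ n * 21 + 2 ∧
      MFrame (CountReg f) (fun x => b + n + 1 ≤ x ∧ x < b + n + 1 + n) σ₀ τ ∧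
      IsPart n (rankBit rk e) A fun i => τ.mem (b + n + 1 + i) := by
  obtain ⟨g, rfl⟩ : ∃ g, f = g + 20 := ⟨f - 20, by omega⟩
  refine (fillLoop_spec (W := W) (n := n) (t := 18) (Y := b + n + 1) (N := n) (x := g + 20 + 6)
    (g := partPos n (rankBit rk e) A) (v := A) (by omega) (by omega) h1 hn
    (fun i hi => partPos_lt hi) partPos_injOn ?_).mono ?_
  · intro i hi σ hF hxi
    simp only [Nat.add_assoc, Nat.reduceAdd] at *
    have hreg : ∀ {y v}, σ₀.reg y = v → ¬ TempReg y → y ≠ g + 26 → σ.reg y = v := by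
      intro y v hy hy1 hy2
      rw [hF.reg _ (fun h => h.elim hy1 hy2), hy]
    have r1 := hreg h1 (by simp [TempReg]) (by omega)
    have r2 := hreg hn (by simp [TempReg]) (by omega)
    have r22 := hreg h2 (by simp [TempReg]) (by omega)
    have r23 := hreg h3 (by simp [TempReg]) (by omega)
    have r24 := hreg h4 (by simp [TempReg]) (by omega)
    have r25 := hreg h5 (by simp [TempReg]) (by omega)
    have r27 := hreg h7 (by simp [TempReg]) (by omega)
    rw [wp_seq]
    refine (bitProg_spec (W := W) (d := 0) (f := g + 20) (a := a) (R := R) (A := A) (rk := rk)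
      hf (by omega) hA hrk (by omega) (by omega) (by omega)
      (fun u hu => by rw [hF.mem _ (by omega), hmA u hu])
      (fun u hu => by rw [hF.mem _ (by omega), hmR u hu]) r22 r24 r25 hi hxi).mono ?_
    rintro T τ ⟨hT, hτ, t10, t15⟩
    have hregτ : ∀ {y v}, σ.reg y = v → ¬ TempReg y → τ.reg y = v := by
      intro y v hy hy1
      rw [hτ.reg _ hy1, hy]
    have t1 := hregτ r1 (by simp [TempReg])
    have t2 := hregτ r2 (by simp [TempReg])
    have t23 := hregτ r23 (by simp [TempReg])
    have t26 := hregτ hxi (by simp [TempReg])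
    have t27 := hregτ r27 (by simp [TempReg])
    have hzi := zeros_le (rankBit rk e) A i
    have hzn := zeros_le (rankBit rk e) A n
    have hc : τ.mem (b + i) = zeros (rankBit rk e) A i := by
      rw [hτ.mem, hF.mem _ (by omega), hz i (by omega)]
    have hfr : ∀ f : ℕ → ℕ, (∀ x, ¬ TempReg x → f x = τ.reg x) →
        MFrame TempReg (fun _ => False) σ ⟨f, τ.rreg, τ.mem, τ.rmem⟩ :=
      fun f hf => (hτ.toMFrame _).trans ⟨hf, fun _ _ => rfl, rfl⟩
    have hx : ∀ x, ¬ TempReg x → x ≠ 15 ∧ x ≠ 16 ∧ x ≠ 17 := by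
      intro x hx; simp only [TempReg] at hx; omega
    have hpos := partPos_lt (b := rankBit rk e) (A := A) hi
    have hbit : rankBit rk e (A i) < 2 := Nat.mod_lt _ (by omega)
    unfold partPos at hpos ⊢
    simp only [Prog.block, wp_seq, wp_ite, wp_skip, wp_instr, Instr.Fits, Instr.exec, State.setReg,
      Function.update_apply, if_true, if_false, Nat.reduceEqDiff, OfNat.one_ne_ofNat,
      t1, t2, t10, t15, t23, t26, t27, hc, Test.Holds]
    refine ⟨by omega, trivial, fun hb => ?_, fun hb => ?_⟩
    · have hb0 : rankBit rk e (A i) ≠ 0 := by omega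
      simp only [hb0, if_false] at hpos ⊢
      exact ⟨by omega, trivial, by omega, by omega, by omega, by omega,
        hfr _ fun x h => by simp [hx x h], by omega, trivial⟩
    · have hb0 : rankBit rk e (A i) = 0 := by omega
      simp only [hb0, if_true] at hpos ⊢
      exact ⟨by omega, by omega, by omega, by omega,
        hfr _ fun x h => by simp [hx x h], by omega, trivial⟩
  · rintro T τ ⟨hT, hF, hv⟩
    exact ⟨hT, hF.mono (fun x h => h.imp (fun h => h) fun h => Or.inl h) fun x h => h,
      isPart_of_partPos hv⟩

/-- The state in which the counting structure is built: `1`, `n`, `2 ^ L` and `L` are in the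
registers, and the ranks are in the memory. -/
structure BuildEnv (d n L : ℕ) (rk : ℕ → ℕ → ℕ) (σ : State) : Prop where
  r1 : σ.reg 1 = 1
  r2 : σ.reg 2 = n
  r3 : σ.reg 3 = 2 ^ L
  r4 : σ.reg 4 = L
  rank : ∀ j < d, ∀ v < n, σ.mem (8 + (2 * j + 1) * n + v) = rk j v

/-- The registers that building a structure may change. -/
def BuildReg (f x : ℕ) : Prop := TempReg x ∨ f + 2 ≤ x

/-- The address from which on structures may be built. -/
def dsBase (d n : ℕ) : ℕ := 8 + 2 * (d + 1) * n

theorem rank_addr_le {d n j : ℕ} (hj : j < d) : 8 + (2 * j + 1) * n + n ≤ dsBase d n := by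
  have : (2 * j + 1 + 1) * n ≤ 2 * (d + 1) * n := Nat.mul_le_mul_right _ (by omega)
  rw [add_mul _ 1, one_mul] at this
  unfold dsBase
  omega

theorem BuildEnv.frame {d n L : ℕ} {rk : ℕ → ℕ → ℕ} {σ τ : State} {S P : ℕ → Prop}
    (h : BuildEnv d n L rk σ) (hF : MFrame S P σ τ) (hS : ∀ x < 10, ¬ S x)
    (hP : ∀ x < dsBase d n, ¬ P x) : BuildEnv d n L rk τ := by
  refine ⟨?_, ?_, ?_, ?_, fun j hj v hv => ?_⟩
  · rw [hF.reg _ (hS _ (by omega)), h.r1]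
  · rw [hF.reg _ (hS _ (by omega)), h.r2]
  · rw [hF.reg _ (hS _ (by omega)), h.r3]
  · rw [hF.reg _ (hS _ (by omega)), h.r4]
  · have := rank_addr_le (n := n) hj
    rw [hF.mem _ (hP _ (by omega)), h.rank j hj v hv]

/-- The routine `p` builds, in the frame `f`, the structure for `m` constrained coordinates on the
array at the address in register `f`, from the address in register `f + 1` on. -/
def Builds (W d n L : ℕ) (rk : ℕ → ℕ → ℕ) (m f t : ℕ) (p : Prog) : Prop :=
  ∀ (σ : State) (a B : ℕ) (A : ℕ → ℕ), BuildEnv d n L rk σ → σ.reg f = a → σ.reg (f + 1) = B →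
    (∀ i < n, A i < n) → (∀ i < n, σ.mem (a + i) = A i) → a + n ≤ B → dsBase d n ≤ B →
    B + dsSize d n L m + 2 < W →
    WP W p σ fun T τ => T ≤ t ∧
      MFrame (BuildReg f) (fun x => B ≤ x ∧ x < B + dsSize d n L m) σ τ ∧
      DS d n L rk τ.mem m A B

/-- Build one block and advance to the next one. -/
def buildLevel (f : ℕ) (sub : Prog) : Prog :=
  .seq (.block [.const 16 2] (.instr (.div (f + 4) (f + 4) 16)))
    (.seq (countPass f) (.seq (scatterPass f)
    (.seq (.block [.add 15 (f + 3) 2, .add (f + 16) 15 1] (.instr (.add (f + 17) (f + 16) 2)))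
    (.seq sub (.block [.add 15 (f + 3) 2, .add (f + 2) 15 1]
      (.instr (.add (f + 3) (f + 3) (f + 8))))))))

/-- Recursion is simulated by static register frames of width `16`. The nested routine receives its
two arguments in `f + 16` and `f + 17` and otherwise changes only temporary and later registers, so
the data of the current frame survive the call. Its input is the sequence just partitioned, and its
output starts right behind that sequence. -/
theorem buildLevel_spec {W d n L m f t a b e R w : ℕ} {rk : ℕ → ℕ → ℕ} {A rkj : ℕ → ℕ} {sub : Prog}
    (hf : 20 ≤ f) (hsub : Builds W d n L rk m (f + 16) t sub) {σ : State}
    (hw : 2 * n + 1 + dsSize d n L m = w) (hE : BuildEnv d n L rk σ) (hA : ∀ i < n, A i < n)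
    (hrk : ∀ v < n, rkj v < n)
    (hmA : ∀ i < n, σ.mem (a + i) = A i) (hmR : ∀ v < n, σ.mem (R + v) = rkj v)
    (hab : a + n ≤ b) (hRb : R + n ≤ b) (hb : dsBase d n ≤ b)
    (hW : b + w + 2 < W)
    (h2 : σ.reg (f + 2) = a) (h3 : σ.reg (f + 3) = b) (h4 : σ.reg (f + 4) = 2 ^ (e + 1))
    (h5 : σ.reg (f + 5) = R) (h8 : σ.reg (f + 8) = w) :
    WP W (buildLevel f sub) σ fun T τ => T ≤ n * 37 + 14 + t ∧
      MFrame (BuildReg f) (fun x => b ≤ x ∧ x < b + w) σ τ ∧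
      τ.reg (f + 2) = b + n + 1 ∧ τ.reg (f + 3) = b + w ∧
      τ.reg (f + 4) = 2 ^ e ∧ τ.reg (f + 5) = R ∧
      τ.reg (f + 8) = w ∧
      (∀ i ≤ n, τ.mem (b + i) = zeros (rankBit rkj e) A i) ∧
      ∃ A' : ℕ → ℕ, IsPart n (rankBit rkj e) A A' ∧ (∀ i < n, τ.mem (b + n + 1 + i) = A' i) ∧
        DS d n L rk τ.mem m A' (b + 2 * n + 1) := by
  obtain ⟨g, rfl⟩ : ∃ g, f = g + 20 := ⟨f - 20, by omega⟩
  unfold buildLevel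
  rw [wp_seq]
  simp only [Prog.block, wp_seq (p := .instr _), wp_instr, Instr.Fits, Instr.exec, State.setReg,
    Function.update_apply, if_true]
  have hpw : 2 ^ (e + 1) / 2 = 2 ^ e := by rw [pow_succ]; simp
  have e4 : g + 20 + 4 ≠ 16 := by omega
  simp only [e4, if_false, h4, hpw]
  refine ⟨by omega, trivial, ?_⟩
  rw [wp_seq]
  have hF1 : MFrame (BuildReg (g + 20)) (fun x => b ≤ x ∧ x < b + w) σ
      { reg := Function.update (Function.update σ.reg 16 2) (g + 20 + 4) (2 ^ e),
        rreg := σ.rreg, mem := σ.mem, rmem := σ.rmem } := by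
    refine ⟨fun x hx => ?_, fun _ _ => rfl, rfl⟩
    have : x ≠ 16 ∧ x ≠ g + 20 + 4 := by simp only [BuildReg, TempReg] at hx; omega
    simp [this]
  refine WP.mono (countPass_spec (e := e) (a := a) (R := R) (b := b) (A := A) hf hA hrk hab hRb
    (by omega) hmA hmR ?_ ?_ ?_ ?_ ?_ ?_) ?_
  · simp [hE.r1]
  · simp [hE.r2]
  · simp [h2]
  · simp [h3]
  · simp
  · simp [h5]
  rintro T τ ⟨hT, hτ, t7, hz⟩
  have hF2 := hF1.trans (hτ.mono (S' := BuildReg (g + 20)) (P' := fun x => b ≤ x ∧ x < b + w)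
    (fun x h => by simp only [CountReg, BuildReg, TempReg] at *; omega) (fun x h => by omega))
  have hE2 := hE.frame hF2 (fun x h => by simp only [BuildReg, TempReg]; omega)
    (fun x h => by omega)
  have hτr : ∀ x, x ≠ g + 24 → ¬ CountReg (g + 20) x → τ.reg x = σ.reg x := by
    intro x hx hx'
    rw [hτ.reg x hx']
    have : x ≠ 16 := by simp only [CountReg, TempReg] at hx'; omega
    simp [hx, this]
  rw [wp_seq]
  refine WP.mono (scatterPass_spec (e := e) (a := a) (R := R) (b := b) (A := A) (rk := rkj) hf hA
    hrk hab hRb (by omega) (fun i hi => ?_) (fun i hi => ?_) hE2.r1 hE2.r2 ?_ ?_ ?_ ?_ t7 hz) ?_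
  · rw [hF2.mem _ (by omega), hmA i hi]
  · rw [hF2.mem _ (by omega), hmR i hi]
  · rw [hτr _ (by omega) (by simp only [CountReg, TempReg]; omega), h2]
  · rw [hτr _ (by omega) (by simp only [CountReg, TempReg]; omega), h3]
  · rw [hτ.reg _ (by simp only [CountReg, TempReg]; omega)]; simp
  · rw [hτr _ (by omega) (by simp only [CountReg, TempReg]; omega), h5]
  rintro U ρ ⟨hU, hρ, hpart⟩
  have hF3 := hF2.trans (hρ.mono (S' := BuildReg (g + 20)) (P' := fun x => b ≤ x ∧ x < b + w)
    (fun x h => by simp only [CountReg, BuildReg, TempReg] at *; omega) (fun x h => by omega))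
  have hE3 := hE.frame hF3 (fun x h => by simp only [BuildReg, TempReg]; omega)
    (fun x h => by omega)
  have hρr : ∀ x, x ≠ g + 24 → ¬ CountReg (g + 20) x → ρ.reg x = σ.reg x := by
    intro x hx hx'
    rw [hρ.reg x hx', hτr x hx hx']
  have q3 : ρ.reg (g + 23) = b := by
    rw [hρr _ (by omega) (by simp only [CountReg, TempReg]; omega), ← h3]
  have q4 : ρ.reg (g + 24) = 2 ^ e := by
    rw [hρ.reg _ (by simp only [CountReg, TempReg]; omega),
      hτ.reg _ (by simp only [CountReg, TempReg]; omega)]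
    simp
  have q5 : ρ.reg (g + 25) = R := by
    rw [hρr _ (by omega) (by simp only [CountReg, TempReg]; omega), ← h5]
  have q8 : ρ.reg (g + 28) = w := by
    rw [hρr _ (by omega) (by simp only [CountReg, TempReg]; omega), ← h8]
  obtain ⟨A', hA'e⟩ : ∃ A' : ℕ → ℕ, A' = fun i => ρ.mem (b + n + 1 + i) := ⟨_, rfl⟩
  rw [← hA'e] at hpart
  have hA' := hpart.lt hA
  rw [wp_seq]
  simp only [Nat.add_assoc, Nat.reduceAdd] at q3 q4 q5 q8 hsub ⊢
  simp only [wp_seq (p := .instr _), wp_instr, Instr.Fits, Instr.exec, State.setReg,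
    Function.update_apply, if_true, if_false, Nat.reduceEqDiff, hE3.r1, hE3.r2, q3,
    OfNat.one_ne_ofNat]
  refine ⟨by omega, by omega, by omega, ?_⟩
  have hF4 : MFrame (fun x => x = 15 ∨ x = g + 36 ∨ x = g + 37) (fun _ => False) ρ
      { reg := Function.update (Function.update (Function.update ρ.reg 15 (b + n)) (g + 36)
          (b + n + 1)) (g + 37) (b + n + 1 + n),
        rreg := ρ.rreg, mem := ρ.mem, rmem := ρ.rmem } := by
    refine ⟨fun x hx => ?_, fun _ _ => rfl, rfl⟩
    simp only [not_or] at hx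
    simp [hx]
  have hE4 := hE3.frame hF4 (fun x h => by omega) (fun x _ h => h)
  rw [wp_seq]
  refine WP.mono (hsub _ (b + n + 1) (b + n + 1 + n) A' hE4 ?_ ?_ hA' ?_ le_rfl (by omega)
    (by omega)) ?_
  · simp
  · simp
  · intro i hi; simp [hA'e]
  rintro V ν ⟨hV, hν, hDS⟩
  have hF5 := hF3.trans ((hF4.mono (S' := BuildReg (g + 20)) (P' := fun x => b ≤ x ∧ x < b + w)
    (fun x h => by simp only [BuildReg, TempReg]; omega) (fun x h => h.elim)).trans
      (hν.mono (fun x h => by simp only [BuildReg, TempReg] at *; omega) (fun x h => by omega)))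
  have hνr : ∀ x, x ≠ 15 → ¬ BuildReg (g + 34) x → ν.reg x = ρ.reg x := by
    intro x hx hx'
    rw [hν.reg x (fun h => hx' (by simp only [BuildReg, TempReg] at *; omega))]
    have : x ≠ g + 36 ∧ x ≠ g + 37 := by simp only [BuildReg, TempReg] at hx'; omega
    simp [hx, this]
  have hνm : ∀ x, x < b + n + 1 + n → ν.mem x = ρ.mem x := fun x hx => hν.mem x (by omega)
  have v1 : ν.reg 1 = 1 := by rw [hF5.reg _ (by simp only [BuildReg, TempReg]; omega), hE.r1]
  have v2 : ν.reg 2 = n := by rw [hF5.reg _ (by simp only [BuildReg, TempReg]; omega), hE.r2]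
  have v3 : ν.reg (g + 23) = b := by
    rw [hνr _ (by omega) (by simp only [BuildReg, TempReg]; omega), q3]
  have v4 : ν.reg (g + 24) = 2 ^ e := by
    rw [hνr _ (by omega) (by simp only [BuildReg, TempReg]; omega), q4]
  have v5 : ν.reg (g + 25) = R := by
    rw [hνr _ (by omega) (by simp only [BuildReg, TempReg]; omega), q5]
  have v8 : ν.reg (g + 28) = w := by
    rw [hνr _ (by omega) (by simp only [BuildReg, TempReg]; omega), q8]
  have hA'' : ∀ i < n, ν.mem (b + n + 1 + i) = A' i := fun i hi => by
    rw [hνm _ (by omega), hA'e]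
  simp only [wp_seq (p := .instr _), wp_instr, Instr.Fits, Instr.exec, State.setReg,
    Function.update_apply, if_true, if_false, Nat.reduceEqDiff, v1, v2, v3, v4, v5, v8,
    OfNat.one_ne_ofNat, Nat.left_eq_add, Nat.add_eq_left, OfNat.ofNat_ne_zero, one_ne_zero]
  refine ⟨by omega, by omega, by omega, by omega, hF5.trans ⟨fun x hx => ?_, fun _ _ => rfl, rfl⟩,
    by omega, trivial, trivial, trivial, trivial, fun i hi => ?_, A', hpart, fun i hi => ?_, ?_⟩
  · have : x ≠ 15 ∧ x ≠ g + 22 ∧ x ≠ g + 23 := by simp only [BuildReg, TempReg] at hx; omega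
    simp [this]
  · rw [hνm _ (by omega), hρ.mem _ (by omega), hz i hi]
  · rw [← hA'' i hi]
    congr 1
    omega
  · rwa [show b + n + 1 + n = b + (2 * n + 1) by omega] at hDS

/-- The part of the structure that belongs to the coordinate `j`, with blocks of `w` words. -/
def DSCoord (d n L : ℕ) (rk : ℕ → ℕ → ℕ) (mem : ℕ → ℕ) (m w : ℕ) (A : ℕ → ℕ) (B j : ℕ) : Prop :=
  ∃ seq : ℕ → ℕ → ℕ, seq 0 = A ∧ ∀ ℓ < L,
    IsPart n (rankBit (rk j) (L - 1 - ℓ)) (seq ℓ) (seq (ℓ + 1)) ∧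
    (∀ i ≤ n, mem (B + (j * L + ℓ) * w + i) = zeros (rankBit (rk j) (L - 1 - ℓ)) (seq ℓ) i) ∧
    DS d n L rk mem m (seq (ℓ + 1)) (B + (j * L + ℓ) * w + 2 * n + 1)

theorem ds_succ_iff {d n L : ℕ} {rk : ℕ → ℕ → ℕ} {mem : ℕ → ℕ} {m : ℕ} {A : ℕ → ℕ} {B : ℕ} :
    DS d n L rk mem (m + 1) A B ↔
      ∀ j < d, DSCoord d n L rk mem m (2 * n + 1 + dsSize d n L m) A B j := Iff.rfl

theorem DSCoord.congr {d n L : ℕ} {rk : ℕ → ℕ → ℕ} {mem mem' : ℕ → ℕ} {m w : ℕ} {A : ℕ → ℕ}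
    {B j : ℕ} (h : DSCoord d n L rk mem m w A B j) (hw : 2 * n + 1 + dsSize d n L m = w)
    (hm : ∀ x < B + (j + 1) * L * w, mem' x = mem x) :
    DSCoord d n L rk mem' m w A B j := by
  obtain ⟨seq, h0, hs⟩ := h
  refine ⟨seq, h0, fun ℓ hℓ => ?_⟩
  obtain ⟨h1, h2, h3⟩ := hs ℓ hℓ
  have hb := block_le (w := w) (Nat.lt_succ_self j) hℓ
  simp only [Nat.succ_eq_add_one] at hb
  refine ⟨h1, fun i hi => ?_, h3.congr fun x hx hx' => hm x (by omega)⟩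
  rw [hm _ (by omega)]
  exact h2 i hi

/-- Set up the registers for the coordinate `j`. -/
def coordSetup (d m j f : ℕ) : Prog :=
  .seq (.instr (.copy (f + 2) f)) (.seq (sizeProg d (f + 8) m)
    (.block [.add (f + 8) (f + 8) 2, .add (f + 8) (f + 8) 2, .add (f + 8) (f + 8) 1,
      .const 15 j, .mul 15 15 4, .mul 15 15 (f + 8), .add (f + 3) (f + 1) 15,
      .const 15 (2 * j + 1), .mul 15 15 2, .const 16 8, .add (f + 5) 16 15]
      (.instr (.copy (f + 4) 3))))

/-- The registers that the setup for a coordinate may change. -/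
def SetupReg (f x : ℕ) : Prop :=
  TempReg x ∨ x = f + 2 ∨ x = f + 3 ∨ x = f + 4 ∨ x = f + 5 ∨ x = f + 8

theorem coordSetup_spec {W d n L m j f a B w : ℕ} (hn : 0 < n) (hL : 0 < L) (hf : 20 ≤ f)
    (hj : j < d) (hw : 2 * n + 1 + dsSize d n L m = w) {σ : State} (hr1 : σ.reg 1 = 1)
    (hr2 : σ.reg 2 = n) (hr3 : σ.reg 3 = 2 ^ L) (hr4 : σ.reg 4 = L)
    (ha : σ.reg f = a) (hB : σ.reg (f + 1) = B) (hdB : dsBase d n ≤ B)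
    (hW : B + d * L * w + 2 < W) :
    WP W (coordSetup d m j f) σ fun T τ => T ≤ 6 * m + 14 ∧ Frame d (SetupReg f) σ τ ∧
      τ.reg (f + 2) = a ∧ τ.reg (f + 3) = B + j * L * w ∧ τ.reg (f + 4) = 2 ^ L ∧
      τ.reg (f + 5) = 8 + (2 * j + 1) * n ∧ τ.reg (f + 8) = w := by
  obtain ⟨g, rfl⟩ : ∃ g, f = g + 20 := ⟨f - 20, by omega⟩
  have hd : 0 < d := by omega
  have e1 : w ≤ d * L * w := Nat.le_mul_of_pos_left _ (Nat.mul_pos hd hL)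
  have e2 : j * L * w ≤ d * L * w := by gcongr
  have e3 : j * L ≤ j * L * w := Nat.le_mul_of_pos_right _ (by omega)
  have e4 : j ≤ j * L := Nat.le_mul_of_pos_right _ hL
  have e5 := rank_addr_le (n := n) hj
  have e6 : 2 * j + 1 ≤ (2 * j + 1) * n := Nat.le_mul_of_pos_right _ hn
  have e7 : d ≤ d * L * w := by
    rw [mul_assoc]; exact Nat.le_mul_of_pos_right _ (Nat.mul_pos hL (by omega))
  unfold coordSetup
  simp only [Nat.add_assoc, Nat.reduceAdd] at *
  rw [wp_seq]
  simp only [wp_instr, Instr.Fits, Instr.exec, true_and]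
  rw [wp_seq]
  have hF1 : Frame d (SetupReg (g + 20)) σ (σ.setReg (g + 22) (σ.reg (g + 20))) := by
    refine ⟨fun x hx => ?_, fun _ _ => rfl, rfl, rfl⟩
    have : x ≠ g + 22 := by simp only [SetupReg, TempReg] at hx; omega
    simp [State.setReg, this]
  refine WP.mono (sizeProg_spec (d := d) (n := n) (L := L) hd hL (by omega)
    (by simpa [State.setReg] using hr1) (by simpa [State.setReg] using hr2)
    (by simpa [State.setReg] using hr4) (by omega) (by omega)) ?_
  rintro T τ ⟨hT, hτ, t8⟩
  have hF2 := hF1.trans (hτ.mono (S' := SetupReg (g + 20))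
    (fun x h => by simp only [FillReg, SetupReg, TempReg] at *; omega))
  have t1 : τ.reg 1 = 1 := by rw [hF2.reg _ (by simp [SetupReg, TempReg]), hr1]
  have t2 : τ.reg 2 = n := by rw [hF2.reg _ (by simp [SetupReg, TempReg]), hr2]
  have t3 : τ.reg 3 = 2 ^ L := by rw [hF2.reg _ (by simp [SetupReg, TempReg]), hr3]
  have t4 : τ.reg 4 = L := by rw [hF2.reg _ (by simp [SetupReg, TempReg]), hr4]
  have t21 : τ.reg (g + 21) = B := by
    rw [hF2.reg _ (by simp only [SetupReg, TempReg]; omega), hB]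
  have t22 : τ.reg (g + 22) = a := by
    rw [hτ.reg _ (by simp only [FillReg, TempReg]; omega)]; simp [State.setReg, ha]
  have e : dsSize d n L m + n + n + 1 = w := by omega
  simp only [Prog.block, wp_seq, wp_instr, Instr.Fits, Instr.exec, State.setReg,
    Function.update_apply, if_true, if_false, Nat.reduceEqDiff, Nat.left_eq_add, Nat.add_eq_left,
    OfNat.ofNat_ne_zero, one_ne_zero, t1, t2, t3, t4, t8, t21, t22, e]
  refine ⟨by omega, by omega, by omega, by omega, by omega, by omega, by omega, by omega, by omega,
    by omega, by omega, trivial, by omega, hF2.trans ⟨fun x hx => ?_, fun _ _ => rfl, rfl, rfl⟩,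
    trivial, trivial, trivial, trivial, trivial⟩
  have : x ≠ 15 ∧ x ≠ 16 ∧ x ≠ g + 23 ∧ x ≠ g + 24 ∧ x ≠ g + 25 ∧ x ≠ g + 28 := by
    simp only [SetupReg, TempReg] at hx; omega
  simp [this]

/-- Build the part of the structure that belongs to the coordinate `j`. -/
def buildCoord (d m j f : ℕ) (sub : Prog) : Prog :=
  .seq (coordSetup d m j f) (.loop (.lt 1 (f + 4)) (buildLevel f sub))

theorem buildCoord_spec {W d n L m j f t a B w : ℕ} {rk : ℕ → ℕ → ℕ} {A : ℕ → ℕ} {sub : Prog}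
    (hn : 0 < n) (hL : 0 < L) (hf : 20 ≤ f) (hj : j < d)
    (hsub : Builds W d n L rk m (f + 16) t sub) (hrk : ∀ v < n, rk j v < n)
    (hw : 2 * n + 1 + dsSize d n L m = w) {σ₀ : State} (hE : BuildEnv d n L rk σ₀)
    (ha : σ₀.reg f = a) (hB : σ₀.reg (f + 1) = B) (hA : ∀ i < n, A i < n)
    (hmA : ∀ i < n, σ₀.mem (a + i) = A i) (haB : a + n ≤ B) (hdB : dsBase d n ≤ B)
    (hW : B + d * L * w + 2 < W) :
    WP W (buildCoord d m j f sub) σ₀ fun T τ => T ≤ 6 * m + 15 + L * (n * 37 + 15 + t) ∧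
      MFrame (BuildReg f) (fun x => B + j * L * w ≤ x ∧ x < B + (j + 1) * L * w) σ₀ τ ∧
      DSCoord d n L rk τ.mem m w A B j := by
  have hjL : (j + 1) * L ≤ d * L := Nat.mul_le_mul_right _ hj
  have hjLw : (j + 1) * L * w ≤ d * L * w := by gcongr
  have hR := rank_addr_le (n := n) hj
  unfold buildCoord
  rw [wp_seq]
  refine (coordSetup_spec hn hL hf hj hw hE.r1 hE.r2 hE.r3 hE.r4 ha hB hdB hW).mono ?_
  rintro T τ ⟨hT, hτ, t2, t3, t4, t5, t8⟩
  refine ((wp_loop (W := W) (b := .lt 1 (f + 4)) (p := buildLevel f sub)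
    -- The register `f + 4` holds `2 ^ (L - ℓ)` and thus serves as the bit weight and, on reaching
    -- `1`, as the signal to stop. The current sequence is stored at `acur`: initially the given
    -- array, afterwards a part of the previous block. The budget per level is `37 * n + 14 + t`
    -- plus the loop test.
    (I := fun k σ => ∃ ℓ acur, ∃ seq : ℕ → ℕ → ℕ, k = (L - ℓ) * (n * 37 + 15 + t) ∧ ℓ ≤ L ∧
      MFrame (BuildReg f) (fun x => B + j * L * w ≤ x ∧ x < B + (j * L + ℓ) * w) σ₀ σ ∧
      σ.reg (f + 2) = acur ∧ σ.reg (f + 3) = B + (j * L + ℓ) * w ∧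
      σ.reg (f + 4) = 2 ^ (L - ℓ) ∧ σ.reg (f + 5) = 8 + (2 * j + 1) * n ∧ σ.reg (f + 8) = w ∧
      seq 0 = A ∧ (∀ i < n, seq ℓ i < n) ∧ (∀ i < n, σ.mem (acur + i) = seq ℓ i) ∧
      acur + n ≤ B + (j * L + ℓ) * w ∧ ∀ ℓ' < ℓ,
        IsPart n (rankBit (rk j) (L - 1 - ℓ')) (seq ℓ') (seq (ℓ' + 1)) ∧
        (∀ i ≤ n, σ.mem (B + (j * L + ℓ') * w + i) =
          zeros (rankBit (rk j) (L - 1 - ℓ')) (seq ℓ') i) ∧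
        DS d n L rk σ.mem m (seq (ℓ' + 1)) (B + (j * L + ℓ') * w + 2 * n + 1)) ?_)
    (k := L * (n * 37 + 15 + t)) ?_).mono ?_
  · rintro k σ ⟨ℓ, acur, seq, rfl, hℓ, hF, r2, r3, r4, r5, r8, h0, hlt, hm, hac, hs⟩ hb
    have hEσ := hE.frame hF (fun x h => by simp only [BuildReg, TempReg]; omega)
      (fun x h => by omega)
    simp only [Test.Holds, hEσ.r1, r4] at hb
    have hℓL : ℓ < L := by
      rcases hℓ.lt_or_eq with h | rfl
      · exact h
      · simp at hb
    obtain ⟨e, he⟩ : ∃ e, L - ℓ = e + 1 := ⟨L - ℓ - 1, by omega⟩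
    have he' : L - 1 - ℓ = e := by omega
    have hbl := block_le (w := w) hj hℓL
    have hbase : B ≤ B + (j * L + ℓ) * w := Nat.le_add_right _ _
    have hbase' : B + j * L * w ≤ B + (j * L + ℓ) * w := by gcongr; omega
    have hnext : B + (j * L + ℓ) * w + w = B + (j * L + (ℓ + 1)) * w := by ring
    obtain ⟨b, hbb⟩ : ∃ b, B + (j * L + ℓ) * w = b := ⟨_, rfl⟩
    rw [hbb] at r3 hac hnext hbase hbase' hF
    rw [he] at r4
    refine (buildLevel_spec (a := acur) (b := b) (e := e) (R := 8 + (2 * j + 1) * n)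
      (A := seq ℓ) (rkj := rk j) hf hsub hw hEσ hlt hrk hm
      (fun v hv => hEσ.rank j hj v hv) hac (by omega) (by omega) (by omega) r2 r3 r4 r5 r8).mono ?_
    rintro U ρ ⟨hU, hρ, q2, q3, q4, q5, q8, hz, A', hpart, hmA', hDS⟩
    have hprev : ∀ ℓ' < ℓ, B + (j * L + ℓ') * w + w ≤ b := by
      intro ℓ' hℓ'
      rw [← hbb]
      have : (j * L + ℓ' + 1) * w ≤ (j * L + ℓ) * w := Nat.mul_le_mul_right _ (by omega)
      rw [add_mul _ 1, one_mul] at this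
      omega
    -- The sequence of partitions is defined one level at a time; the update leaves untouched all
    -- levels about which something is already known.
    refine ⟨_, ?_, ℓ + 1, b + n + 1, Function.update seq (ℓ + 1) A', rfl, hℓL, ?_, q2, ?_, ?_, q5,
      q8, ?_, ?_, ?_, ?_, fun ℓ' hℓ' => ?_⟩
    · rw [he, show L - (ℓ + 1) = e by omega, add_mul e 1, one_mul]
      omega
    · exact (hF.mono (fun x h => h) (fun x h => by omega)).trans
        (hρ.mono (fun x h => h) (fun x h => by omega))
    · rw [q3, hnext]
    · rw [q4, show L - (ℓ + 1) = e by omega]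
    · rw [Function.update_of_ne (by omega), h0]
    · rw [Function.update_self]
      exact hpart.lt hlt
    · rw [Function.update_self]
      exact hmA'
    · omega
    · rcases Nat.lt_succ_iff_lt_or_eq.1 hℓ' with h | rfl
      · obtain ⟨s1, s2, s3⟩ := hs ℓ' h
        have hp := hprev ℓ' h
        rw [Function.update_of_ne (by omega), Function.update_of_ne (by omega)]
        refine ⟨s1, fun i hi => ?_, s3.congr fun x hx hx' => hρ.mem x (by omega)⟩
        rw [hρ.mem _ (by omega)]
        exact s2 i hi
      · rw [Function.update_of_ne (by omega), Function.update_self, he', hbb]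
        exact ⟨hpart, hz, hDS⟩
  -- Only the entry at level `0` of this constant sequence matters; the others are replaced as the
  -- levels are built.
  · refine ⟨0, a, fun _ => A, by simp, by omega, (hτ.toMFrame _).mono (fun x h => ?_) fun x h => h,
      t2, by simpa using t3, by simpa using t4, t5, t8, rfl, hA, fun i hi => ?_, ?_, by simp⟩
    · simp only [SetupReg, BuildReg, TempReg] at *; omega
    · rw [hτ.mem, hmA i hi]
    · exact haB.trans (Nat.le_add_right _ _)
  · rintro U ρ ⟨hU, hb, k, ℓ, acur, seq, -, hℓ, hF, -, -, r4, -, -, h0, -, -, -, hs⟩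
    have r1 : ρ.reg 1 = 1 := by rw [hF.reg _ (by simp only [BuildReg, TempReg]; omega), hE.r1]
    simp only [Test.Holds, r1, r4] at hb
    obtain rfl : ℓ = L := by
      by_contra hne
      obtain ⟨e, he⟩ : ∃ e, L - ℓ = e + 1 := ⟨L - ℓ - 1, by omega⟩
      rw [he, pow_succ] at hb
      have : 0 < 2 ^ e := by positivity
      omega
    refine ⟨by omega, ?_, seq, h0, hs⟩
    rwa [show j * ℓ + ℓ = (j + 1) * ℓ by ring] at hF

/-- Build the parts of the structure that belong to the coordinates below `j`. -/
def buildCoords (d m f : ℕ) (sub : Prog) : ℕ → Prog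
  | 0 => .skip
  | j + 1 => .seq (buildCoords d m f sub j) (buildCoord d m j f sub)

/-- Build the structure for `m` constrained coordinates in the frame `f`. -/
def buildDS (d : ℕ) : ℕ → ℕ → Prog
  | 0, _ => .skip
  | m + 1, f => buildCoords d m f (buildDS d m (f + 16)) d

/-- A bound on the time to build the structure for `m` constrained coordinates. -/
def buildTime (d n L : ℕ) : ℕ → ℕ
  | 0 => 1
  | m + 1 => d * (6 * m + 15 + L * (n * 37 + 15 + buildTime d n L m)) + 1

/-- The outer induction is on the number of constraints, for all register frames at once, since the
nested builder runs in a shifted frame. The inner one is on the coordinates: their parts lie one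
after another, so building a new part preserves the earlier ones. -/
theorem buildDS_spec {W d n L : ℕ} {rk : ℕ → ℕ → ℕ} (hn : 0 < n) (hL : 0 < L)
    (hrk : ∀ j < d, ∀ v < n, rk j v < n) (m : ℕ) :
    ∀ f, 20 ≤ f → Builds W d n L rk m f (buildTime d n L m) (buildDS d m f) := by
  induction m with
  | zero =>
    intro f hf σ a B A hE ha hB hA hmA haB hdB hW
    rw [buildDS, wp_skip]
    exact ⟨le_rfl, MFrame.refl .., trivial⟩
  | succ m ih =>
    intro f hf σ₀ a B A hE ha hB hA hmA haB hdB hW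
    obtain ⟨w, hw⟩ : ∃ w, 2 * n + 1 + dsSize d n L m = w := ⟨_, rfl⟩
    simp only [dsSize, hw] at hW ⊢
    have key : ∀ j ≤ d, WP W (buildCoords d m f (buildDS d m (f + 16)) j) σ₀ fun T τ =>
        T ≤ j * (6 * m + 15 + L * (n * 37 + 15 + buildTime d n L m)) + 1 ∧
        MFrame (BuildReg f) (fun x => B ≤ x ∧ x < B + j * L * w) σ₀ τ ∧
        ∀ j' < j, DSCoord d n L rk τ.mem m w A B j' := by
      intro j
      induction j with
      | zero =>
        intro _
        rw [buildCoords, wp_skip]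
        exact ⟨by omega, MFrame.refl .., by simp⟩
      | succ j ihj =>
        intro hj
        rw [buildCoords, wp_seq]
        refine (ihj (by omega)).mono ?_
        rintro T τ ⟨hT, hτ, hDS⟩
        have hEτ := hE.frame hτ (fun x h => by simp only [BuildReg, TempReg]; omega)
          (fun x h => by omega)
        have hmono : j * L * w ≤ (j + 1) * L * w := by gcongr; omega
        refine (buildCoord_spec (A := A) hn hL hf hj (ih (f + 16) (by omega)) (hrk j hj) hw hEτ
          (a := a) (B := B) ?_ ?_ hA (fun i hi => ?_) haB hdB hW).mono ?_
        · rw [hτ.reg _ (by simp only [BuildReg, TempReg]; omega), ha]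
        · rw [hτ.reg _ (by simp only [BuildReg, TempReg]; omega), hB]
        · rw [hτ.mem _ (by omega), hmA i hi]
        rintro U ρ ⟨hU, hρ, hDSj⟩
        refine ⟨by rw [add_mul j 1]; omega, (hτ.mono (fun x h => h) fun x h => by omega).trans
          (hρ.mono (fun x h => h) fun x h => by omega), fun j' hj' => ?_⟩
        rcases Nat.lt_succ_iff_lt_or_eq.1 hj' with h | rfl
        · refine (hDS j' h).congr hw fun x hx => hρ.mem x fun hx' => ?_
          have : (j' + 1) * L * w ≤ j * L * w := by gcongr; omega
          omega
        · exact hDSj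
    refine (key d le_rfl).mono ?_
    rintro T τ ⟨hT, hτ, hDS⟩
    refine ⟨hT, hτ, ds_succ_iff.2 ?_⟩
    rwa [hw]

/-! ## Construction -/

/-- From the address `X` on, the memory holds the order of the points sorted by the keys `K` and,
after that, the ranks of the points in this order. -/
structure Ranked {α : Type*} [LE α] (K : ℕ → α) (mem : ℕ → ℕ) (n X : ℕ) : Prop where
  sorted : SortedOn K (fun i => mem (X + i)) 0 n
  perm : PermOn n fun i => mem (X + i)
  rank : ∀ i < n, mem (X + n + mem (X + i)) = i

/-- Count the occurrences of `v`: a missing value would give zero occurrences in the permutation,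
but `v` occurs among the numbers below `n`. -/
theorem PermOn.surj {n : ℕ} {A : ℕ → ℕ} (h : PermOn n A) {v : ℕ} (hv : v < n) :
    ∃ i < n, A i = v := by
  by_contra hn
  push Not at hn
  have h0 := h.cntP (fun u => u = v)
  rw [cntP_eq_zero.2 (fun i _ hi => hn i hi)] at h0
  exact cntP_eq_zero.1 h0.symm v (Nat.zero_le v) hv rfl

theorem Ranked.rank_lt {α : Type*} [LE α] {K : ℕ → α} {mem : ℕ → ℕ} {n X : ℕ}
    (h : Ranked K mem n X) {v : ℕ} (hv : v < n) : mem (X + n + v) < n := by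
  obtain ⟨i, hi, rfl⟩ := h.perm.surj hv
  rw [h.rank i hi]
  exact hi

theorem Ranked.congr {α : Type*} [LE α] {K : ℕ → α} {mem mem' : ℕ → ℕ} {n X : ℕ}
    (h : Ranked K mem n X) (hm : ∀ x, X ≤ x → x < X + 2 * n → mem' x = mem x) :
    Ranked K mem' n X := by
  have e : ∀ i < n, mem' (X + i) = mem (X + i) := fun i hi => hm _ (by omega) (by omega)
  refine ⟨fun u v hu huv hv => ?_, h.perm.congr e, fun i hi => ?_⟩
  · simp only [e u (by omega), e v hv]
    exact h.sorted u v hu huv hv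
  · have := h.perm.lt i hi
    rw [e i hi, hm _ (by omega) (by omega), h.rank i hi]

/-- Everything that the queries need to know about the memory. The reals `rm` are the coordinates
of the points. -/
structure Data (d n L : ℕ) (rm : ℕ → ℝ) (mem : ℕ → ℕ) : Prop where
  m0 : mem 0 = n
  m1 : mem 1 = 2 ^ L
  m2 : mem 2 = L
  ranked : ∀ j < d, Ranked (fun v => rm (v * d + j)) mem n (8 + 2 * j * n)
  zranked : Ranked (fun v => zkey d fun j => rm (v * d + j)) mem n (8 + 2 * d * n)
  ds : ∃ rk A, (∀ j < d, ∀ v < n, rk j v = mem (8 + 2 * j * n + n + v)) ∧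
    (∀ i < n, A i = mem (8 + 2 * d * n + i)) ∧ DS d n L rk mem (d - 1) A (dsBase d n)

/-- The layout of the memory: a header of eight words, then for each coordinate and finally for the
Z-order a region of `2 * n` words with an order and its ranks, and from `dsBase` on the counting
structure. -/
theorem region_le {d n j : ℕ} (hj : j ≤ d) : 8 + 2 * j * n + 2 * n ≤ dsBase d n := by
  have : 2 * (j + 1) * n ≤ 2 * (d + 1) * n := Nat.mul_le_mul_right _ (by omega)
  rw [mul_add, add_mul] at this
  unfold dsBase
  omega

theorem region_le_region {n i j : ℕ} (hij : i < j) : 8 + 2 * i * n + 2 * n ≤ 8 + 2 * j * n := by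
  have : 2 * (i + 1) * n ≤ 2 * j * n := Nat.mul_le_mul_right _ (by omega)
  rw [mul_add, add_mul] at this
  omega

/-- Sort the points and store the result in the region `j`. -/
def sortStage (j : ℕ) (p : Prog) : Prog :=
  .seq (.block [.const 15 (2 * j), .mul 15 15 2, .const 16 8, .add 20 15 16]
    (.instr (.add 21 20 2))) (sortRank p)

theorem sortStage_spec {α : Type*} [LinearOrder α] {W d n c L j : ℕ} {rm : ℕ → ℝ} {p : Prog}
    {K : ℕ → α} (hp : Compares W d n c rm p K) {σ : State} (hn : 0 < n) (hL0 : 0 < L)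
    (hj : j ≤ d) (hW : dsBase d n + 2 * n < W) (hL : n ≤ 2 ^ L)
    (h1 : σ.reg 1 = 1) (h2 : σ.reg 2 = n) (hrm : σ.rmem = rm) :
    WP W (sortStage j p) σ fun T τ => T ≤ (c + 60) * (n * L) + 5 ∧
      MFrame (fun x => 10 ≤ x) (fun x => 8 + 2 * j * n ≤ x ∧ x < 8 + 2 * j * n + 2 * n) σ τ ∧
      τ.reg 20 = 8 + 2 * j * n ∧ τ.reg 21 = 8 + 2 * j * n + n ∧
      Ranked K τ.mem n (8 + 2 * j * n) := by
  have hr := region_le (n := n) hj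
  have hj2 : 2 * j ≤ 2 * j * n := Nat.le_mul_of_pos_right _ hn
  have e : 2 * j * n + 8 = 8 + 2 * j * n := by ring
  unfold sortStage
  rw [wp_seq]
  simp only [Prog.block, wp_seq (p := .instr _), wp_instr, Instr.Fits, Instr.exec, State.setReg,
    Function.update_apply, if_true, if_false, Nat.reduceEqDiff, h2, e]
  refine ⟨by omega, by omega, by omega, by omega, by omega, WP.mono (sortRank_spec hp hn hL0
    (X := 8 + 2 * j * n) (by omega) (by unfold dsBase at hW; nlinarith) hL
    (by simp [h1]) (by simp [h2]) hrm (by simp) (by simp)) ?_⟩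
  rintro T τ ⟨hT, hτ, hs, hperm, hrk⟩
  refine ⟨by omega, (hτ.mono (fun x h => ?_) fun x h => h).comp ⟨fun x hx => ?_,
    fun _ _ => rfl, rfl⟩, ?_, ?_, hs, hperm, hrk⟩
  · simp only [SortReg, TempReg] at h; omega
  · have : x ≠ 15 ∧ x ≠ 16 ∧ x ≠ 20 ∧ x ≠ 21 := by omega
    simp [this]
  · rw [hτ.reg _ (by simp [SortReg, TempReg])]; simp
  · rw [hτ.reg _ (by simp [SortReg, TempReg])]; simp

theorem compares_coord {W d n j : ℕ} (rm : ℕ → ℝ) (hW : 2 < W) (hn : n * d < W) (hj : j < d) :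
    Compares W d n 12 rm (coordLess d (fetchPoint d 10) (fetchPoint d 11) j)
      (fun v => rm (v * d + j)) := by
  rintro σ - rfl h10 h11
  exact coordLess_spec hW (fetches_point hn (Or.inl rfl) rfl h10)
    (fetches_point hn (Or.inr rfl) rfl h11) hj

theorem compares_zkey {W d n : ℕ} (rm : ℕ → ℝ) (hW : 2 < W) (hn : n * d < W) (hd : 0 < d) :
    Compares W d n (14 * d + 2) rm (zLess d (fetchPoint d 10) (fetchPoint d 11))
      (fun v => zkey d fun j => rm (v * d + j)) := by
  rintro σ - rfl h10 h11
  exact zLess_spec hW hd (fetches_point hn (Or.inl rfl) rfl h10)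
    (fetches_point hn (Or.inr rfl) rfl h11)

/-- Sort the points by each of the coordinates below `j`. -/
def sortCoords (d : ℕ) : ℕ → Prog
  | 0 => .skip
  | j + 1 => .seq (sortCoords d j)
      (sortStage j (coordLess d (fetchPoint d 10) (fetchPoint d 11) j))

theorem sortCoords_spec {W d n L : ℕ} {rm : ℕ → ℝ} {σ : State} (hn : 0 < n) (hL0 : 0 < L)
    (hW : dsBase d n + 2 * n < W) (hL : n ≤ 2 ^ L)
    (h1 : σ.reg 1 = 1) (h2 : σ.reg 2 = n) (hrm : σ.rmem = rm) {j : ℕ} (hj : j ≤ d) :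
    WP W (sortCoords d j) σ fun T τ => T ≤ j * (72 * (n * L) + 5) + 1 ∧
      MFrame (fun x => 10 ≤ x) (fun x => 8 ≤ x ∧ x < 8 + 2 * j * n) σ τ ∧
      ∀ i < j, Ranked (fun v => rm (v * d + i)) τ.mem n (8 + 2 * i * n) := by
  induction j with
  | zero =>
    rw [sortCoords, wp_skip]
    exact ⟨by omega, MFrame.refl .., by simp⟩
  | succ j ih =>
    rw [sortCoords, wp_seq]
    refine (ih (by omega)).mono ?_
    rintro T τ ⟨hT, hτ, hr⟩
    have hnd : n * d ≤ dsBase d n := by unfold dsBase; nlinarith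
    refine (sortStage_spec (compares_coord rm (by omega) (by omega) hj) hn hL0 (by omega) hW hL
      (by rw [hτ.reg _ (by omega), h1]) (by rw [hτ.reg _ (by omega), h2])
      (hτ.rmem.trans hrm)).mono ?_
    rintro U ρ ⟨hU, hρ, -, -, hrj⟩
    have e : 2 * (j + 1) * n = 2 * j * n + 2 * n := by ring
    refine ⟨by rw [add_mul j 1]; omega, (hτ.mono (fun _ h => h) fun x h => by omega).trans
      (hρ.mono (fun _ h => h) fun x h => by omega), fun i hi => ?_⟩
    rcases Nat.lt_succ_iff_lt_or_eq.1 hi with h | rfl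
    · have := region_le_region (n := n) h
      exact (hr i h).congr fun x hx hx' => hρ.mem x (by omega)
    · exact hrj

/-- Compute the number of bits and store it in the memory, together with `n`. -/
def initProg : Prog :=
  .seq (.block [.const 1 1, .copy 2 0, .const 3 1, .const 4 0] (.instr (.add 5 2 1)))
    (.seq (.loop (.lt 3 5) (.seq (.instr (.add 3 3 3)) (.instr (.add 4 4 1))))
      (.block [.const 10 0, .store 10 2, .store 1 3, .const 10 2] (.instr (.store 10 4))))

/-- Doubling stops at the first power of two that is at least `n + 1`. Its exponent is the number of
bits needed for every number up to and including `n`, and the power itself is at most `2 * n`. -/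
theorem initProg_spec {W n : ℕ} (hn : 0 < n) (hW : 2 * n + 2 < W) {σ₀ : State}
    (h0 : σ₀.reg 0 = n) :
    WP W initProg σ₀ fun T τ => T ≤ (Nat.log 2 n + 1) * 3 + 11 ∧ τ.reg 1 = 1 ∧ τ.reg 2 = n ∧
      τ.reg 3 = 2 ^ (Nat.log 2 n + 1) ∧ τ.reg 4 = Nat.log 2 n + 1 ∧ τ.rmem = σ₀.rmem ∧
      τ.mem 0 = n ∧ τ.mem 1 = 2 ^ (Nat.log 2 n + 1) ∧ τ.mem 2 = Nat.log 2 n + 1 := by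
  have hlog := Nat.pow_log_le_self 2 hn.ne'
  have hlog' := Nat.lt_pow_succ_log_self (b := 2) (by omega) n
  unfold initProg
  rw [wp_seq]
  simp only [Prog.block, wp_seq (p := .instr _), wp_instr, Instr.Fits, Instr.exec, State.setReg,
    Function.update_apply, if_true, if_false, Nat.reduceEqDiff, h0, OfNat.one_ne_ofNat, zero_ne_one]
  refine ⟨by omega, trivial, by omega, by omega, by omega, ?_⟩
  rw [wp_seq]
  refine WP.mono ((wp_loop (W := W) (b := .lt 3 5)
    (p := .seq (.instr (.add 3 3 3)) (.instr (.add 4 4 1)))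
    (I := fun b σ => ∃ k ≤ Nat.log 2 n + 1, b = (Nat.log 2 n + 1 - k) * 3 ∧ σ.reg 1 = 1 ∧
      σ.reg 2 = n ∧ σ.reg 3 = 2 ^ k ∧ σ.reg 4 = k ∧ σ.reg 5 = n + 1 ∧ σ.rmem = σ₀.rmem) ?_)
    (k := (Nat.log 2 n + 1) * 3) ?_) ?_
  · rintro b σ ⟨k, hk, rfl, r1, r2, r3, r4, r5, hrm⟩ hb
    simp only [Test.Holds, r3, r5] at hb
    have hkl : k ≤ Nat.log 2 n := (Nat.le_log_iff_pow_le (by omega) hn.ne').2 (by omega)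
    simp only [wp_seq, wp_instr, Instr.Fits, Instr.exec, State.setReg,
      Function.update_apply, if_true, if_false, Nat.reduceEqDiff, r1, r2, r3, r4, r5,
      OfNat.one_ne_ofNat]
    have hkn : k < 2 ^ k := Nat.lt_two_pow_self
    exact ⟨by omega, by omega, _, by omega, k + 1, by omega, rfl, trivial, trivial, by ring,
      rfl, trivial, hrm⟩
  · exact ⟨0, by omega, by simp, by simp⟩
  · rintro T τ ⟨hT, hb, b, k, hk, -, r1, r2, r3, r4, r5, hrm⟩
    simp only [Test.Holds, r3, r5] at hb
    obtain rfl : k = Nat.log 2 n + 1 := by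
      by_contra hne
      have : 2 ^ k ≤ 2 ^ Nat.log 2 n := Nat.pow_le_pow_right (by omega) (by omega)
      omega
    simp only [wp_seq, wp_instr, Instr.Fits, Instr.exec, State.setReg,
      Function.update_apply, if_true, if_false, Nat.reduceEqDiff, r1, r2, r3, r4,
      OfNat.one_ne_ofNat, OfNat.zero_ne_ofNat, zero_ne_one]
    exact ⟨by omega, trivial, trivial, by omega, trivial, by omega, trivial, trivial, trivial,
      trivial, hrm, trivial, trivial, trivial⟩

/-- The construction. -/
def buildProg (d : ℕ) : Prog :=
  .seq initProg (.seq (sortCoords d d)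
    (.seq (sortStage d (zLess d (fetchPoint d 10) (fetchPoint d 11)))
      (.seq (.instr (.add 21 21 2)) (buildDS d (d - 1) 20))))

theorem buildProg_spec {W d n : ℕ} (hd : 0 < d) (hn : 0 < n)
    (hW : dsBase d n + dsSize d n (Nat.log 2 n + 1) (d - 1) + 2 * n + 2 < W) {σ₀ : State}
    (h0 : σ₀.reg 0 = n) :
    WP W (buildProg d) σ₀ fun T τ =>
      T ≤ (100 * d + 200) * (n * (Nat.log 2 n + 1)) +
        buildTime d n (Nat.log 2 n + 1) (d - 1) ∧ τ.rmem = σ₀.rmem ∧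
      Data d n (Nat.log 2 n + 1) σ₀.rmem τ.mem := by
  have hnd : n * d ≤ dsBase d n := by unfold dsBase; nlinarith
  obtain ⟨L, hLdef⟩ : ∃ L, Nat.log 2 n + 1 = L := ⟨_, rfl⟩
  have hLn : n < 2 ^ L := by
    rw [← hLdef]; exact Nat.lt_pow_succ_log_self (by omega) n
  have hL0 : 0 < L := by omega
  unfold buildProg
  rw [wp_seq]
  refine (initProg_spec hn (by omega) h0).mono ?_
  rw [hLdef] at hW ⊢
  rintro T τ ⟨hT, t1, t2, t3, t4, hrm, m0, m1, m2⟩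
  rw [wp_seq]
  refine (sortCoords_spec (rm := σ₀.rmem) hn hL0 (by omega) hLn.le t1 t2 hrm le_rfl).mono ?_
  rintro U ρ ⟨hU, hρ, hr⟩
  rw [wp_seq]
  refine (sortStage_spec (compares_zkey σ₀.rmem (by omega) (by omega) hd) hn hL0 le_rfl (by omega)
    hLn.le (by rw [hρ.reg _ (by omega), t1]) (by rw [hρ.reg _ (by omega), t2])
    (hρ.rmem.trans hrm)).mono ?_
  rintro V ν ⟨hV, hν, n20, n21, hz⟩
  have hrν : ∀ j < d, Ranked (fun v => σ₀.rmem (v * d + j)) ν.mem n (8 + 2 * j * n) :=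
    fun j hj => by
      have := region_le_region (n := n) hj
      exact (hr j hj).congr fun x hx hx' => hν.mem x (by omega)
  have hreg := region_le (n := n) (le_refl d)
  -- The region of the Z-order is the last one, so adding `n` to the address of its ranks gives the
  -- place for the counting structure.
  have hbase : 8 + 2 * d * n + n + n = dsBase d n := by unfold dsBase; ring
  have hFν := (hρ.mono (S' := fun x => 10 ≤ x) (P' := fun x => 8 ≤ x) (fun _ h => h)
    (fun x h => h.1)).trans (hν.mono (fun _ h => h) (fun x h => by omega))
  have n2 : ν.reg 2 = n := by rw [hFν.reg _ (by omega), t2]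
  rw [wp_seq]
  simp only [wp_instr, Instr.Fits, Instr.exec, n21, n2, hbase]
  refine ⟨by omega, WP.mono (buildDS_spec (L := L) (rk := fun j v =>
    ν.mem (8 + (2 * j + 1) * n + v)) hn hL0 ?_ (d - 1) 20 le_rfl (ν.setReg 21 (dsBase d n))
    (8 + 2 * d * n) (dsBase d n) (fun i => ν.mem (8 + 2 * d * n + i)) ?_ ?_ ?_ hz.perm.lt
    (fun i hi => rfl) (by omega) le_rfl (by omega)) ?_⟩
  · intro j hj v hv
    have := (hrν j hj).rank_lt hv
    rwa [show 8 + 2 * j * n + n = 8 + (2 * j + 1) * n by ring] at this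
  · refine ⟨?_, ?_, ?_, ?_, fun j hj v hv => rfl⟩
    · simp [State.setReg, hFν.reg 1 (by omega), t1]
    · simp [State.setReg, n2]
    · simp [State.setReg, hFν.reg 3 (by omega), t3]
    · simp [State.setReg, hFν.reg 4 (by omega), t4]
  · simp [State.setReg, n20]
  · simp [State.setReg]
  · rintro X ξ ⟨hX, hξ, hDS⟩
    have hmem : ∀ x < dsBase d n, ξ.mem x = ν.mem x := fun x hx => hξ.mem x (by omega)
    have hb8 : 8 ≤ dsBase d n := by unfold dsBase; omega
    refine ⟨?_, hξ.rmem.trans (hFν.rmem.trans hrm), ?_, ?_, ?_, fun j hj => ?_, ?_, ?_⟩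
    · have e1 : L ≤ n * L := Nat.le_mul_of_pos_left L hn
      have e2 : 1 ≤ n * L := Nat.mul_pos hn hL0
      have e3 : d * (72 * (n * L) + 5) = 72 * (d * (n * L)) + 5 * d := by ring
      have e4 : (14 * d + 2 + 60) * (n * L) = 14 * (d * (n * L)) + 62 * (n * L) := by ring
      have e5 : (100 * d + 200) * (n * L) = 100 * (d * (n * L)) + 200 * (n * L) := by ring
      have e6 : d ≤ d * (n * L) := Nat.le_mul_of_pos_right _ e2
      omega
    · rw [hmem _ (by omega), hFν.mem _ (by omega), m0]
    · rw [hmem _ (by omega), hFν.mem _ (by omega), m1]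
    · rw [hmem _ (by omega), hFν.mem _ (by omega), m2]
    · have := region_le (n := n) hj.le
      exact (hrν j hj).congr fun x _ hx => hmem x (by omega)
    · exact hz.congr fun x _ hx => hmem x (by omega)
    · refine ⟨_, _, fun j hj v hv => ?_, fun i hi => ?_, hDS⟩
      · have := region_le (n := n) hj.le
        have e : (2 * j + 1) * n = 2 * j * n + n := by ring
        rw [hmem _ (by omega), e, ← add_assoc]
      · rw [hmem _ (by omega)]

/-! ## Queries -/

/-- The state in which a query is answered. The real registers hold `q`; the memory holds `mem` and
`rm`. -/
structure QueryEnv (d n L : ℕ) (q rm : ℕ → ℝ) (mem : ℕ → ℕ) (σ : State) : Prop where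
  r1 : σ.reg 1 = 1
  r2 : σ.reg 2 = n
  r3 : σ.reg 3 = 2 ^ L
  r4 : σ.reg 4 = L
  rreg : ∀ r < 4 * d, σ.rreg r = q r
  mem_eq : σ.mem = mem
  rmem_eq : σ.rmem = rm

theorem QueryEnv.frame {d n L : ℕ} {q rm : ℕ → ℝ} {mem : ℕ → ℕ} {S : ℕ → Prop} {σ τ : State}
    (h : QueryEnv d n L q rm mem σ) (hF : Frame d S σ τ) (hS : ∀ x < 10, ¬ S x) :
    QueryEnv d n L q rm mem τ := by
  refine ⟨?_, ?_, ?_, ?_, fun r hr => ?_, hF.mem.trans h.mem_eq, hF.rmem.trans h.rmem_eq⟩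
  · rw [hF.reg _ (hS _ (by omega)), h.r1]
  · rw [hF.reg _ (hS _ (by omega)), h.r2]
  · rw [hF.reg _ (hS _ (by omega)), h.r3]
  · rw [hF.reg _ (hS _ (by omega)), h.r4]
  · rw [hF.rreg r hr, h.rreg r hr]

/-- The registers that a query in the frame `f` may change. -/
def QueryReg (f x : ℕ) : Prop := TempReg x ∨ f + 3 ≤ x

/-- The routine `p` counts, in the frame `f` and with the help of the structure for `m` constrained
coordinates, the points with the property `ψ` in a range of the sequence. -/
def Counts (W d n L : ℕ) (q rm : ℕ → ℝ) (mem : ℕ → ℕ) (rk : ℕ → ℕ → ℕ) (m f t : ℕ)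
    (ψ : ℕ → Prop) (p : Prog) : Prop :=
  ∀ (σ : State) (A : ℕ → ℕ) (l r B : ℕ), QueryEnv d n L q rm mem σ →
    σ.reg f = l → σ.reg (f + 1) = r → σ.reg (f + 2) = B → l ≤ r → r ≤ n → (∀ i < n, A i < n) →
    DS d n L rk mem m A B → B + dsSize d n L m + 2 * n + 2 < W →
    WP W p σ fun T τ => T ≤ t ∧ Frame d (QueryReg f) σ τ ∧
      τ.reg (f + 3) = cntP (fun i => ψ (A i)) l r

/-! ### Descending through the bits of a bound on the rank -/

/-- Go down by one level if the current bit of the bound is one. The numbers of zero bits before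
the two ends of the range are in the registers `17` and `18`. -/
def descendOne (f : ℕ) (sub : Prog) : Prog :=
  .block [.add 19 (f + 12) 2, .load 19 19, .add (f + 10) 19 (f + 10), .sub (f + 10) (f + 10) 17,
      .add (f + 11) 19 (f + 11), .sub (f + 11) (f + 11) 18, .copy (f + 16) 17,
      .copy (f + 17) 18, .add (f + 18) (f + 12) 2, .add (f + 18) (f + 18) 2,
      .add (f + 18) (f + 18) 1]
    (.seq sub (.instr (.add (f + 14) (f + 14) (f + 19))))

/-- Go down by one level; the bound for the rank is in the register `x`. -/
def descendLevel (x f : ℕ) (sub : Prog) : Prog :=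
  .block [.const 16 2, .div (f + 13) (f + 13) 16, .add 15 (f + 12) (f + 10), .load 17 15,
      .add 15 (f + 12) (f + 11), .load 18 15, .div 15 x (f + 13), .div 19 15 16, .mul 19 19 16,
      .sub 15 15 19]
    (.seq (.ite (.eq 15 1) (descendOne f sub)
      (.seq (.instr (.copy (f + 10) 17)) (.instr (.copy (f + 11) 18))))
    (.instr (.add (f + 12) (f + 12) (f + 8))))

/-- The registers that a descent may change. -/
def DescentReg (f x : ℕ) : Prop := TempReg x ∨ f + 10 ≤ x

/-- The zeros of the range occupy `[zl, zr)` in the partitioned sequence; the nested query counts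
those of them that meet the remaining constraints. The ones lie behind all `zn` zeros, which
explains the ends `zn + l - zl` and `zn + r - zr` of the new range. -/
theorem descendOne_spec {W d n L m f t b w l r s zl zr zn : ℕ} {q rm : ℕ → ℝ} {mem : ℕ → ℕ}
    {rk : ℕ → ℕ → ℕ} {A' : ℕ → ℕ} {ψ : ℕ → Prop} {sub : Prog} (hf : 20 ≤ f)
    (hsub : Counts W d n L q rm mem rk m (f + 16) t ψ sub)
    (hw : 2 * n + 1 + dsSize d n L m = w) {σ : State} (hE : QueryEnv d n L q rm mem σ)
    (hA' : ∀ i < n, A' i < n) (hzn : mem (b + n) = zn) (hDS : DS d n L rk mem m A' (b + 2 * n + 1))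
    (hW : b + w + 2 * n + 2 < W) (hl : l ≤ n) (hr : r ≤ n) (hznn : zn ≤ n) (hz : zl ≤ zr)
    (hzr : zr ≤ n) (hs : s + cntP (fun i => ψ (A' i)) zl zr ≤ n)
    (h17 : σ.reg 17 = zl) (h18 : σ.reg 18 = zr) (h10 : σ.reg (f + 10) = l)
    (h11 : σ.reg (f + 11) = r) (h12 : σ.reg (f + 12) = b) (h14 : σ.reg (f + 14) = s) :
    WP W (descendOne f sub) σ fun T τ => T ≤ 12 + t ∧
      Frame d (fun y => TempReg y ∨ y = f + 10 ∨ y = f + 11 ∨ f + 14 ≤ y) σ τ ∧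
      τ.reg (f + 10) = zn + l - zl ∧ τ.reg (f + 11) = zn + r - zr ∧
      τ.reg (f + 14) = s + cntP (fun i => ψ (A' i)) zl zr := by
  obtain ⟨g, rfl⟩ : ∃ g, f = g + 20 := ⟨f - 20, by omega⟩
  unfold descendOne
  simp only [Nat.add_assoc, Nat.reduceAdd] at h10 h11 h12 h14 hsub ⊢
  simp only [Prog.block, wp_seq (p := .instr _), wp_instr, Instr.Fits, Instr.exec,
    State.setReg, Function.update_apply, if_true, if_false, Nat.reduceEqDiff,
    Nat.add_left_cancel_iff, hE.r1, hE.r2, hE.mem_eq, h17, h18, h10, h11, h12, hzn,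
    OfNat.one_ne_ofNat]
  refine ⟨by omega, trivial, by omega, trivial, by omega, trivial, trivial, trivial, by omega,
    by omega, by omega, ?_⟩
  rw [wp_seq]
  generalize hσ₂ : State.mk _ _ _ _ = σ₂
  have hF₂ : Frame d (fun x => x = 19 ∨ x = g + 30 ∨ x = g + 31 ∨ g + 36 ≤ x) σ σ₂ := by
    subst hσ₂
    refine ⟨fun y hy => ?_, fun _ _ => rfl, hE.mem_eq.symm, rfl⟩
    have : y ≠ 19 ∧ y ≠ g + 30 ∧ y ≠ g + 31 ∧ y ≠ g + 36 ∧ y ≠ g + 37 ∧ y ≠ g + 38 := by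
      omega
    simp [this]
  have hE₂ := hE.frame hF₂ fun y h => by omega
  have t30 : σ₂.reg (g + 30) = zn + l - zl := by subst hσ₂; simp
  have t31 : σ₂.reg (g + 31) = zn + r - zr := by subst hσ₂; simp
  refine WP.mono (hsub σ₂ A' zl zr (b + 2 * n + 1) hE₂ ?_ ?_ ?_ hz hzr hA' hDS (by omega)) ?_
  · subst hσ₂; simp
  · subst hσ₂; simp
  · subst hσ₂; simp; omega
  clear hσ₂
  rintro T τ ⟨hT, hτ, eτ⟩
  have hτr : ∀ y, ¬ TempReg y → y < g + 36 → τ.reg y = σ₂.reg y := fun y h h' =>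
    hτ.reg y fun hq => hq.elim h (by omega)
  have q34 : τ.reg (g + 34) = s := by
    rw [hτr _ (by simp only [TempReg]; omega) (by omega), hF₂.reg _ (by omega), h14]
  have q30 : τ.reg (g + 30) = zn + l - zl := by
    rw [hτr _ (by simp only [TempReg]; omega) (by omega), t30]
  have q31 : τ.reg (g + 31) = zn + r - zr := by
    rw [hτr _ (by simp only [TempReg]; omega) (by omega), t31]
  simp only [Nat.add_assoc, Nat.reduceAdd] at eτ
  simp only [wp_instr, Instr.Fits, Instr.exec, State.setReg, Function.update_apply, if_true,
    if_false, Nat.reduceEqDiff, Nat.add_left_cancel_iff, q30, q31, q34, eτ]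
  refine ⟨by omega, by omega, ((hF₂.mono fun y h => ?_).trans
    (hτ.mono fun y h => ?_)).trans ⟨fun y hy => ?_, fun _ _ => rfl, rfl, rfl⟩, trivial, trivial,
    trivial⟩
  · simp only [TempReg]; omega
  · simp only [QueryReg, TempReg] at *; omega
  · have : y ≠ g + 34 := by omega
    simp [this]

/-- The count gathered so far plus the count still open does not change. The bound `hs` on this
total by `n` keeps the accumulated count within a word. -/
theorem descendLevel_spec {W d n L m f t x v e b w l r s : ℕ} {q rm : ℕ → ℝ} {mem : ℕ → ℕ}
    {rk : ℕ → ℕ → ℕ} {A A' rkj : ℕ → ℕ} {ψ : ℕ → Prop} {sub : Prog} (hf : 20 ≤ f)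
    (hx : f ≤ x ∧ x < f + 8) (hsub : Counts W d n L q rm mem rk m (f + 16) t ψ sub)
    (hw : 2 * n + 1 + dsSize d n L m = w) {σ : State} (hE : QueryEnv d n L q rm mem σ)
    (hA' : ∀ i < n, A' i < n) (hpart : IsPart n (rankBit rkj e) A A')
    (hz : ∀ i ≤ n, mem (b + i) = zeros (rankBit rkj e) A i)
    (hDS : DS d n L rk mem m A' (b + 2 * n + 1)) (hW : b + w + 2 * n + 2 < W) (hv : v ≤ n)
    (hlr : l ≤ r) (hr : r ≤ n)
    (hs : s + cntP (fun i => rkj (A i) % 2 ^ (e + 1) < v % 2 ^ (e + 1) ∧ ψ (A i)) l r ≤ n)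
    (hrx : σ.reg x = v) (h8 : σ.reg (f + 8) = w) (h10 : σ.reg (f + 10) = l)
    (h11 : σ.reg (f + 11) = r) (h12 : σ.reg (f + 12) = b) (h13 : σ.reg (f + 13) = 2 ^ (e + 1))
    (h14 : σ.reg (f + 14) = s) :
    WP W (descendLevel x f sub) σ fun T τ => T ≤ 25 + t ∧ Frame d (DescentReg f) σ τ ∧
      τ.reg (f + 12) = b + w ∧ τ.reg (f + 13) = 2 ^ e ∧ ∃ l' r',
        τ.reg (f + 10) = l' ∧ τ.reg (f + 11) = r' ∧ l' ≤ r' ∧ r' ≤ n ∧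
        τ.reg (f + 14) + cntP (fun i => rkj (A' i) % 2 ^ e < v % 2 ^ e ∧ ψ (A' i)) l' r' =
          s + cntP (fun i => rkj (A i) % 2 ^ (e + 1) < v % 2 ^ (e + 1) ∧ ψ (A i)) l r := by
  obtain ⟨g, rfl⟩ : ∃ g, f = g + 20 := ⟨f - 20, by omega⟩
  have hpw : 2 ^ (e + 1) / 2 = 2 ^ e := by rw [pow_succ]; simp
  have hzl := hz l (by omega)
  have hzr := hz r hr
  have hzn := hz n le_rfl
  have m1 := zeros_mono (rankBit rkj e) A hlr
  have m2 := zeros_mono (rankBit rkj e) A hr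
  have m3 := sub_zeros_mono (rankBit rkj e) A hlr
  have m4 := sub_zeros_mono (rankBit rkj e) A hr
  have m5 := zeros_le (rankBit rkj e) A l
  have m6 := zeros_le (rankBit rkj e) A r
  have m7 := zeros_le (rankBit rkj e) A n
  have hone := IsPart.cntP_step_one (v := v) hpart ψ hlr hr
  have hzero := IsPart.cntP_step_zero (v := v) hpart ψ hlr hr
  -- `rankBit` is definitionally the bit function in the partition lemmas; naming it allows
  -- `generalize` to turn the three counts of zeros into variables.
  change _ → _ = cntP _ (zeros (rankBit rkj e) A l) (zeros (rankBit rkj e) A r) +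
    cntP _ (zeros (rankBit rkj e) A n + l - zeros (rankBit rkj e) A l)
      (zeros (rankBit rkj e) A n + r - zeros (rankBit rkj e) A r) at hone
  change _ → _ = cntP _ (zeros (rankBit rkj e) A l) (zeros (rankBit rkj e) A r) at hzero
  generalize zeros (rankBit rkj e) A l = zl at *
  generalize zeros (rankBit rkj e) A r = zr at *
  generalize zeros (rankBit rkj e) A n = zn at *
  obtain ⟨u, hu⟩ : ∃ u, v / 2 ^ e = u := ⟨_, rfl⟩
  have huv : u ≤ n := by rw [← hu]; exact (Nat.div_le_self _ _).trans hv
  have hx1 : x ≠ 16 ∧ x ≠ 15 ∧ x ≠ 17 ∧ x ≠ 18 ∧ x ≠ g + 33 := by omega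
  obtain ⟨x1, x2, x3, x4, x5⟩ := hx1
  have hdiv : u / 2 * 2 ≤ u := Nat.div_mul_le_self _ _
  unfold descendLevel
  simp only [Nat.add_assoc, Nat.reduceAdd] at h8 h10 h11 h12 h13 h14 hsub ⊢
  simp only [Prog.block, wp_seq (p := .instr _), wp_instr, Instr.Fits, Instr.exec, State.setReg,
    Function.update_apply, if_true, if_false, Nat.reduceEqDiff, Nat.add_left_cancel_iff,
    h10, h11, h12, h13, hpw, hrx, x1, x2, x3, x4, x5, hu, hE.mem_eq, hzl, hzr]
  refine ⟨by omega, trivial, by omega, trivial, by omega, trivial, trivial, trivial, by omega,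
    trivial, ?_⟩
  rw [wp_seq]
  generalize hσ₁ : State.mk _ _ _ _ = σ₁
  have hF₁ : Frame d (fun x => TempReg x ∨ x = g + 33) σ σ₁ := by
    subst hσ₁
    refine ⟨fun y hy => ?_, fun _ _ => rfl, hE.mem_eq.symm, rfl⟩
    have : y ≠ 15 ∧ y ≠ 16 ∧ y ≠ 17 ∧ y ≠ 18 ∧ y ≠ 19 ∧ y ≠ g + 33 := by
      simp only [TempReg] at hy; omega
    simp [this]
  have s15 : σ₁.reg 15 = u - u / 2 * 2 := by subst hσ₁; simp
  have s17 : σ₁.reg 17 = zl := by subst hσ₁; simp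
  have s18 : σ₁.reg 18 = zr := by subst hσ₁; simp
  have s33 : σ₁.reg (g + 33) = 2 ^ e := by subst hσ₁; simp
  have keep : ∀ y, ¬ TempReg y → y ≠ g + 33 → σ₁.reg y = σ.reg y := fun y h h' =>
    hF₁.reg y (by simp [h, h'])
  clear hσ₁
  have hE₁ := hE.frame hF₁ fun y h => by simp only [TempReg]; omega
  have s28 : σ₁.reg (g + 28) = w := by
    rw [keep _ (by simp only [TempReg]; omega) (by omega), h8]
  have s30 : σ₁.reg (g + 30) = l := by
    rw [keep _ (by simp only [TempReg]; omega) (by omega), h10]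
  have s31 : σ₁.reg (g + 31) = r := by
    rw [keep _ (by simp only [TempReg]; omega) (by omega), h11]
  have s32 : σ₁.reg (g + 32) = b := by
    rw [keep _ (by simp only [TempReg]; omega) (by omega), h12]
  have s34 : σ₁.reg (g + 34) = s := by
    rw [keep _ (by simp only [TempReg]; omega) (by omega), h14]
  have hF₁' : Frame d (DescentReg (g + 20)) σ σ₁ := hF₁.mono fun y h => by
    simp only [DescentReg, TempReg] at *; omega
  rw [wp_ite]
  simp only [Test.Holds, s15, hE₁.r1]
  constructor
  · intro hu1
    rw [hone (by omega)] at hs ⊢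
    refine WP.mono (descendOne_spec (l := l) (r := r) (s := s) hf hsub hw hE₁ hA' hzn hDS hW
      (by omega) hr (by omega) m1 (by omega) (by omega) s17 s18 s30 s31 s32 s34) ?_
    rintro T τ ⟨hT, hτ, q30, q31, q34⟩
    have hτr : ∀ y, ¬ TempReg y → y < g + 34 → y ≠ g + 30 → y ≠ g + 31 → τ.reg y = σ₁.reg y :=
      fun y h h1 h2 h3 => hτ.reg y fun hq => hq.elim h (by omega)
    have q28 : τ.reg (g + 28) = w := by
      rw [hτr _ (by simp only [TempReg]; omega) (by omega) (by omega) (by omega), s28]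
    have q32 : τ.reg (g + 32) = b := by
      rw [hτr _ (by simp only [TempReg]; omega) (by omega) (by omega) (by omega), s32]
    have q33 : τ.reg (g + 33) = 2 ^ e := by
      rw [hτr _ (by simp only [TempReg]; omega) (by omega) (by omega) (by omega), s33]
    simp only [Nat.add_assoc, Nat.reduceAdd] at q30 q31 q34
    simp only [wp_instr, Instr.Fits, Instr.exec, State.setReg, Function.update_apply, if_true,
      if_false, Nat.reduceEqDiff, Nat.add_left_cancel_iff, q28, q30, q31, q32, q33, q34]
    refine ⟨by omega, by omega, (hF₁'.trans (hτ.mono fun y h => ?_)).trans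
      ⟨fun y hy => ?_, fun _ _ => rfl, rfl, rfl⟩, trivial, trivial,
      _, _, rfl, rfl, by omega, by omega, by omega⟩
    · simp only [DescentReg, TempReg] at *; omega
    · have : y ≠ g + 32 := by simp only [DescentReg] at hy; omega
      simp [this]
  · intro hu0
    rw [hzero (by omega)] at hs ⊢
    simp only [wp_seq, wp_instr, Instr.Fits, Instr.exec,
      State.setReg, Function.update_apply, if_true, if_false, Nat.reduceEqDiff,
      Nat.add_left_cancel_iff, s17, s18, s32, s28, s33, s34]
    refine ⟨trivial, trivial, by omega, by omega, hF₁'.trans ⟨fun y hy => ?_, fun _ _ => rfl, rfl,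
      rfl⟩, trivial, trivial, zl, zr, rfl, rfl, m1, by omega, rfl⟩
    have : y ≠ g + 30 ∧ y ≠ g + 31 ∧ y ≠ g + 32 := by
      simp only [DescentReg, TempReg] at hy; omega
    simp [this]

/-- Count, in register `f + 14`, the points of the range whose rank is less than the bound in
register `x` and that have the property that `sub` counts. -/
def descent (x f : ℕ) (sub : Prog) : Prog :=
  .block [.copy (f + 10) f, .copy (f + 11) (f + 1), .copy (f + 12) (f + 9), .copy (f + 13) 3,
    .const (f + 14) 0] (.loop (.lt 1 (f + 13)) (descendLevel x f sub))

theorem descent_spec {W d n L m f t x v j B w l r : ℕ} {q rm : ℕ → ℝ} {mem : ℕ → ℕ}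
    {rk : ℕ → ℕ → ℕ} {A : ℕ → ℕ} {ψ : ℕ → Prop} {sub : Prog} (hf : 20 ≤ f)
    (hx : f ≤ x ∧ x < f + 8) (hj : j < d) (hL : n < 2 ^ L)
    (hsub : Counts W d n L q rm mem rk m (f + 16) t ψ sub)
    (hw : 2 * n + 1 + dsSize d n L m = w) {σ₀ : State} (hE : QueryEnv d n L q rm mem σ₀)
    (hA : ∀ i < n, A i < n) (hrk : ∀ u < n, rk j u < n)
    (hDS : DSCoord d n L rk mem m w A B j) (hW : B + d * L * w + 2 * n + 2 < W) (hv : v ≤ n)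
    (hlr : l ≤ r) (hr : r ≤ n) (hrx : σ₀.reg x = v) (h0 : σ₀.reg f = l) (h1 : σ₀.reg (f + 1) = r)
    (h8 : σ₀.reg (f + 8) = w) (h9 : σ₀.reg (f + 9) = B + j * L * w) :
    WP W (descent x f sub) σ₀ fun T τ => T ≤ L * (26 + t) + 6 ∧ Frame d (DescentReg f) σ₀ τ ∧
      τ.reg (f + 14) = cntP (fun i => rk j (A i) < v ∧ ψ (A i)) l r := by
  obtain ⟨seq, hseq, hs⟩ := hDS
  have hlt : ∀ ℓ ≤ L, ∀ i < n, seq ℓ i < n := by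
    intro ℓ
    induction ℓ with
    | zero => intro _; rwa [hseq]
    | succ ℓ ih => exact fun h => (hs ℓ (by omega)).1.lt (ih (by omega))
  have htot : cntP (fun i => rk j (A i) < v ∧ ψ (A i)) l r ≤ n :=
    (cntP_le _ _ _).trans (by omega)
  generalize hc : cntP (fun i => rk j (A i) < v ∧ ψ (A i)) l r = c at *
  have hloop := wp_loop (W := W) (b := .lt 1 (f + 13)) (p := descendLevel x f sub)
    (I := fun k σ => ∃ ℓ l r, k = (L - ℓ) * (26 + t) ∧ ℓ ≤ L ∧ Frame d (DescentReg f) σ₀ σ ∧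
      σ.reg (f + 10) = l ∧ σ.reg (f + 11) = r ∧ σ.reg (f + 12) = B + (j * L + ℓ) * w ∧
      σ.reg (f + 13) = 2 ^ (L - ℓ) ∧ l ≤ r ∧ r ≤ n ∧
      σ.reg (f + 14) + cntP (fun i => rk j (seq ℓ i) % 2 ^ (L - ℓ) < v % 2 ^ (L - ℓ) ∧
        ψ (seq ℓ i)) l r = c) (by
    rintro k σ ⟨ℓ, l, r, rfl, hℓ, hF, h10, h11, h12, h13, hlr, hr, hc⟩ hb
    have hEσ := hE.frame hF fun y h => by simp only [DescentReg, TempReg]; omega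
    simp only [Test.Holds, hEσ.r1, h13] at hb
    obtain ⟨e, he⟩ : ∃ e, L - ℓ = e + 1 := by
      refine ⟨L - ℓ - 1, ?_⟩
      rcases Nat.eq_zero_or_pos (L - ℓ) with h | h
      · simp [h] at hb
      · omega
    obtain ⟨hp, hz, hD⟩ := hs ℓ (by omega)
    have hbl := block_le (w := w) (ℓ := ℓ) (L := L) hj (by omega)
    rw [show L - 1 - ℓ = e by omega] at hp hz
    have hnext : B + (j * L + ℓ) * w + w = B + (j * L + (ℓ + 1)) * w := by ring
    rw [he] at h13 hc
    refine (descendLevel_spec (b := B + (j * L + ℓ) * w) (v := v) (s := σ.reg (f + 14)) hf hx hsub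
      hw hEσ (hlt (ℓ + 1) (by omega)) hp hz hD (by omega) hv hlr hr (by omega) ?_ ?_ h10 h11 h12
      h13 rfl).mono ?_
    · rw [hF.reg _ (by simp only [DescentReg, TempReg]; omega), hrx]
    · rw [hF.reg _ (by simp only [DescentReg, TempReg]; omega), h8]
    rintro T τ ⟨hT, hτ, t12, t13, l', r', t10, t11, hlr', hr', hc'⟩
    refine ⟨(L - (ℓ + 1)) * (26 + t), ?_, ℓ + 1, l', r', rfl, by omega, hF.trans hτ, t10, t11,
      by rw [t12, hnext], ?_, hlr', hr', ?_⟩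
    · rw [he, show L - (ℓ + 1) = e by omega, add_mul e 1, one_mul]; omega
    · rw [t13, show L - (ℓ + 1) = e by omega]
    · rw [show L - (ℓ + 1) = e by omega, hc', hc])
  obtain ⟨g, rfl⟩ : ∃ g, f = g + 20 := ⟨f - 20, by omega⟩
  unfold descent
  simp only [Nat.add_assoc, Nat.reduceAdd] at h1 h8 h9 hloop ⊢
  simp only [Prog.block, wp_seq (p := .instr _), wp_instr, Instr.Fits, Instr.exec,
    State.setReg, Function.update_apply, if_false, Nat.reduceEqDiff, Nat.add_left_cancel_iff,
    h0, h1, h9]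
  refine ⟨trivial, trivial, trivial, trivial, by omega,
    WP.mono (hloop (k := L * (26 + t)) ?_) ?_⟩
  · refine ⟨0, l, r, by simp, by omega, ⟨fun y hy => ?_, fun _ _ => rfl, rfl, rfl⟩, ?_, ?_, ?_, ?_,
      hlr, hr, ?_⟩
    · have : y ≠ g + 30 ∧ y ≠ g + 31 ∧ y ≠ g + 32 ∧ y ≠ g + 33 ∧ y ≠ g + 34 := by
        simp only [DescentReg] at hy; omega
      simp [this]
    · simp
    · simp
    · simp
    · simp [hE.r3]
    -- Initially the reduction modulo `2 ^ L` changes nothing. For the bound `v`, which may equal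
    -- `n`, this requires the strict inequality `n < 2 ^ L`.
    · simp only [Function.update_apply, if_true, zero_add, Nat.sub_zero]
      rw [← hc]
      refine cntP_congr fun i _ hi => ?_
      have := hrk _ (hA i (by omega))
      rw [hseq, Nat.mod_eq_of_lt (by omega), Nat.mod_eq_of_lt (by omega)]
  · rintro T τ ⟨hT, hb, k, ℓ, l', r', -, hℓ, hF, -, -, -, h13, -, hr', hc'⟩
    have hEτ := hE.frame hF fun y h => by simp only [DescentReg, TempReg]; omega
    simp only [Test.Holds, hEτ.r1, h13] at hb
    obtain rfl : ℓ = L := by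
      by_contra hne
      obtain ⟨e, he⟩ : ∃ e, L - ℓ = e + 1 := ⟨L - ℓ - 1, by omega⟩
      rw [he, pow_succ] at hb
      have : 0 < 2 ^ e := by positivity
      omega
    refine ⟨by omega, hF, ?_⟩
    -- After the last bit both sides are residues modulo `1`, so no entry is strictly below the
    -- bound and nothing is left to count.
    rw [← hc', cntP_eq_zero.2, add_zero]
    intro i _ _
    simp [Nat.mod_one]

/-- A property that holds on an initial segment of the sorted order holds exactly for the points
whose rank is below the length of the segment. This converts a comparison with a real bound into one
with an integer bound on the rank. -/
theorem Ranked.lt_iff {α : Type*} [LE α] {K : ℕ → α} {mem : ℕ → ℕ} {n X a : ℕ} {φ : ℕ → Prop}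
    (h : Ranked K mem n X) (ha : ∀ i < n, φ (mem (X + i)) ↔ i < a) {v : ℕ} (hv : v < n) :
    φ v ↔ mem (X + n + v) < a := by
  obtain ⟨i, hi, rfl⟩ := h.perm.surj hv
  rw [h.rank i hi]
  exact ha i hi

/-- Find the ranks that the sides of the query rectangle have in the coordinate `j`. -/
def boundSearch (d j f : ℕ) : Prog :=
  .block [.const 15 (2 * j), .mul 15 15 2, .const 16 8, .add (f + 6) 16 15, .copy (f + 7) (f + 6)]
    (.seq (bsearch (f + 4) (coordLess d (fetchPoint d 10) (fetchReg 0) j))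
      (bsearch (f + 5) (negate (coordLess d (fetchReg d) (fetchPoint d 10) j))))

/-- The registers in which the sides are looked up. -/
def BoundReg (f x : ℕ) : Prop := TempReg x ∨ (f + 4 ≤ x ∧ x < f + 8)

theorem boundSearch_spec {W d n L j f : ℕ} {q rm : ℕ → ℝ} {mem : ℕ → ℕ} (hf : 20 ≤ f) (hj : j < d)
    (hn : 0 < n) (hL : n < 2 ^ L) (hR : Ranked (fun v => rm (v * d + j)) mem n (8 + 2 * j * n))
    (hW : dsBase d n + 2 * n + 2 < W) {σ : State} (hE : QueryEnv d n L q rm mem σ) :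
    WP W (boundSearch d j f) σ fun T τ => T ≤ L * 42 + 11 ∧ Frame d (BoundReg f) σ τ ∧
      τ.reg (f + 4) ≤ n ∧ τ.reg (f + 5) ≤ n ∧
      (∀ v < n, rm (v * d + j) < q j ↔ mem (8 + 2 * j * n + n + v) < τ.reg (f + 4)) ∧
      ∀ v < n, rm (v * d + j) ≤ q (d + j) ↔ mem (8 + 2 * j * n + n + v) < τ.reg (f + 5) := by
  obtain ⟨g, rfl⟩ : ∃ g, f = g + 20 := ⟨f - 20, by omega⟩
  have hreg := region_le (n := n) hj.le
  have hj2 : 2 * j ≤ 2 * j * n := Nat.le_mul_of_pos_right _ hn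
  have hnd : n * d ≤ dsBase d n := by unfold dsBase; nlinarith
  unfold boundSearch
  simp only [Nat.add_assoc g, Nat.reduceAdd]
  simp only [Prog.block, wp_seq (p := .instr _), wp_instr, Instr.Fits, Instr.exec,
    State.setReg, Function.update_apply, if_true, if_false, Nat.reduceEqDiff, hE.r2]
  refine ⟨by omega, by omega, by omega, by omega, trivial, ?_⟩
  rw [wp_seq]
  generalize hσ₁ : State.mk _ _ _ _ = σ₁
  have hF₁ : Frame d (BoundReg (g + 20)) σ σ₁ := by
    subst hσ₁
    refine ⟨fun y hy => ?_, fun _ _ => rfl, rfl, rfl⟩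
    have : y ≠ 15 ∧ y ≠ 16 ∧ y ≠ g + 26 ∧ y ≠ g + 27 := by
      simp only [BoundReg, TempReg] at hy; omega
    simp [this]
  have hE₁ := hE.frame hF₁ fun y h => by simp only [BoundReg, TempReg]; omega
  have s26 : σ₁.reg (g + 26) = 8 + 2 * j * n := by subst hσ₁; simp
  have s27 : σ₁.reg (g + 27) = 8 + 2 * j * n := by subst hσ₁; simp
  clear hσ₁
  have hsorted := hR.sorted
  refine (bsearch_spec (d := d) (K := L) (c := 12) (X := 8 + 2 * j * n)
    (φ := fun v => rm (v * d + j) < q j) (R := fun i => mem (8 + 2 * j * n + i)) (by omega)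
    (by omega) (by omega) hE₁.r1 hE₁.r2 s26 (fun i _ => by rw [hE₁.mem_eq]) ?_ ?_ hL).mono ?_
  · intro ρ hρ i hi h10
    have hEρ := hE₁.frame hρ fun y h => by simp only [BsearchReg]; omega
    refine (coordLess_spec (by omega) (fetches_point (n := n) (by omega) (Or.inl rfl) h10
      (hR.perm.lt i hi)) (fetches_reg (by omega) ρ) hj).congr ?_ le_rfl
    rw [hEρ.rmem_eq, hEρ.rreg _ (by omega), zero_add]
  · exact fun i i' h h' hφ => (hsorted i i' (Nat.zero_le _) h.le h').trans_lt hφ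
  rintro T τ ⟨hT, hτ, ha, hφa⟩
  have hEτ := hE₁.frame hτ fun y h => by simp only [BsearchReg]; omega
  have t27 : τ.reg (g + 25 + 2) = 8 + 2 * j * n := by
    rw [hτ.reg _ (by simp only [BsearchReg]; omega), s27]
  refine (bsearch_spec (d := d) (K := L) (c := 14) (X := 8 + 2 * j * n)
    (φ := fun v => ¬ q (d + j) < rm (v * d + j)) (R := fun i => mem (8 + 2 * j * n + i)) (by omega)
    (by omega) (by omega) hEτ.r1 hEτ.r2 t27 (fun i _ => by rw [hEτ.mem_eq]) ?_ ?_ hL).mono ?_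
  · intro ρ hρ i hi h10
    have hEρ := hEτ.frame hρ fun y h => by simp only [BsearchReg]; omega
    refine (negate_spec (by omega) hEρ.r1 (coordLess_spec (by omega) (fetches_reg (by omega) ρ)
      (fetches_point (n := n) (by omega) (Or.inl rfl) h10 (hR.perm.lt i hi)) hj)).congr ?_ le_rfl
    rw [hEρ.rmem_eq, hEρ.rreg _ (by omega)]
  · exact fun i i' h h' hφ hlt => hφ (hlt.trans_le (hsorted i i' (Nat.zero_le _) h.le h'))
  rintro U ρ ⟨hU, hρ, hb, hφb⟩
  have e24 : ρ.reg (g + 24) = τ.reg (g + 24) := hρ.reg _ (by simp only [BsearchReg]; omega)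
  rw [e24]
  refine ⟨by omega, (hF₁.trans (hτ.mono fun y h => ?_)).trans (hρ.mono fun y h => ?_), ha, hb,
    fun v hv => hR.lt_iff (φ := fun v => rm (v * d + j) < q j) hφa hv, fun v hv => ?_⟩
  · simp only [BsearchReg, BoundReg, TempReg] at *; omega
  · simp only [BsearchReg, BoundReg, TempReg] at *; omega
  · rw [← not_lt]
    exact hR.lt_iff (φ := fun v => ¬ q (d + j) < rm (v * d + j)) hφb hv

/-- Compute the width of a block, and the address of the first block for the coordinate `j`. -/
def blockSetup (d m j f : ℕ) : Prog :=
  .seq (sizeProg d (f + 8) m) (.block [.add (f + 8) (f + 8) 2, .add (f + 8) (f + 8) 2,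
    .add (f + 8) (f + 8) 1, .const 15 j, .mul 15 15 4, .mul 15 15 (f + 8)]
      (.instr (.add (f + 9) (f + 2) 15)))

theorem blockSetup_spec {W d n L m j f B w : ℕ} {q rm : ℕ → ℝ} {mem : ℕ → ℕ} (hf : 20 ≤ f)
    (hj : j < d) (hL : 0 < L) (hw : 2 * n + 1 + dsSize d n L m = w)
    (hW : B + d * L * w + 2 * n + 2 < W) {σ : State} (hE : QueryEnv d n L q rm mem σ)
    (h2 : σ.reg (f + 2) = B) :
    WP W (blockSetup d m j f) σ fun T τ => T ≤ 6 * m + 8 ∧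
      Frame d (fun x => TempReg x ∨ x = f + 8 ∨ x = f + 9) σ τ ∧
      τ.reg (f + 8) = w ∧ τ.reg (f + 9) = B + j * L * w := by
  obtain ⟨g, rfl⟩ : ∃ g, f = g + 20 := ⟨f - 20, by omega⟩
  have hd : 0 < d := by omega
  have e1 : w ≤ d * L * w := Nat.le_mul_of_pos_left _ (Nat.mul_pos hd hL)
  have e2 : j * L * w ≤ d * L * w := by gcongr
  have e3 : j * L ≤ j * L * w := Nat.le_mul_of_pos_right _ (by omega)
  have e4 : j ≤ j * L := Nat.le_mul_of_pos_right _ hL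
  have e7 : d ≤ d * L * w := by
    rw [mul_assoc]; exact Nat.le_mul_of_pos_right _ (Nat.mul_pos hL (by omega))
  unfold blockSetup
  simp only [Nat.add_assoc, Nat.reduceAdd] at *
  rw [wp_seq]
  refine (sizeProg_spec hd hL (by omega) hE.r1 hE.r2 hE.r4 (by omega) (by omega)).mono ?_
  rintro T τ ⟨hT, hτ, t8⟩
  have hEτ := hE.frame hτ fun y h => by simp only [FillReg, TempReg]; omega
  have t22 : τ.reg (g + 22) = B := by
    rw [hτ.reg _ (by simp only [FillReg, TempReg]; omega), h2]
  have e : dsSize d n L m + n + n + 1 = w := by omega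
  simp only [Prog.block, wp_seq, wp_instr, Instr.Fits, Instr.exec, State.setReg,
    Function.update_apply, if_true, if_false, Nat.reduceEqDiff, Nat.left_eq_add,
    OfNat.ofNat_ne_zero, one_ne_zero, hEτ.r1, hEτ.r2, hEτ.r4, t8, t22, e]
  refine ⟨by omega, by omega, by omega, by omega, by omega, by omega, by omega, by omega,
    (hτ.mono fun y h => ?_).trans ⟨fun x hx => ?_, fun _ _ => rfl, rfl, rfl⟩, trivial, trivial⟩
  · simp only [FillReg, TempReg] at *; omega
  · have : x ≠ 15 ∧ x ≠ g + 28 ∧ x ≠ g + 29 := by simp only [TempReg] at hx; omega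
    simp [this]

/-- Count the points of the range that satisfy the query in the coordinate `j` and that have the
property that `sub` counts. -/
def coordQuery (d m j f : ℕ) (sub : Prog) : Prog :=
  .seq (boundSearch d j f) (.seq (blockSetup d m j f) (.seq (descent (f + 5) f sub)
    (.seq (.instr (.copy (f + 3) (f + 14))) (.seq (descent (f + 4) f sub)
      (.instr (.sub (f + 3) (f + 3) (f + 14)))))))

theorem coordQuery_spec {W d n L m f t j B l r : ℕ} {q rm : ℕ → ℝ} {mem : ℕ → ℕ}
    {rk : ℕ → ℕ → ℕ} {A : ℕ → ℕ} {ψ : ℕ → Prop} {sub : Prog} (hf : 20 ≤ f) (hj : j < d)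
    (hn : 0 < n) (hL : n < 2 ^ L) (hR : Ranked (fun v => rm (v * d + j)) mem n (8 + 2 * j * n))
    (hrk : ∀ v < n, rk j v = mem (8 + 2 * j * n + n + v)) (hq : q j ≤ q (d + j))
    (hW₀ : dsBase d n + 2 * n + 2 < W) (hsub : Counts W d n L q rm mem rk m (f + 16) t ψ sub)
    {σ : State} (hE : QueryEnv d n L q rm mem σ) (hl : σ.reg f = l) (hr : σ.reg (f + 1) = r)
    (hB : σ.reg (f + 2) = B) (hlr : l ≤ r) (hrn : r ≤ n) (hA : ∀ i < n, A i < n)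
    (hDS : DS d n L rk mem (m + 1) A B) (hW : B + dsSize d n L (m + 1) + 2 * n + 2 < W) :
    WP W (coordQuery d m j f sub) σ fun T τ => T ≤ L * (94 + 2 * t) + 6 * m + 40 ∧
      Frame d (QueryReg f) σ τ ∧ τ.reg (f + 3) =
        cntP (fun i => (q j ≤ rm (A i * d + j) ∧ rm (A i * d + j) ≤ q (d + j)) ∧ ψ (A i)) l r := by
  have hL0 : 0 < L := by
    rcases Nat.eq_zero_or_pos L with rfl | h
    · simp at hL; omega
    · exact h
  obtain ⟨w, hw⟩ : ∃ w, 2 * n + 1 + dsSize d n L m = w := ⟨_, rfl⟩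
  have hDSj := ds_succ_iff.1 hDS j hj
  simp only [dsSize, hw] at hW hDSj
  have hrkn : ∀ v < n, rk j v < n := fun v hv => by rw [hrk v hv]; exact hR.rank_lt hv
  unfold coordQuery
  rw [wp_seq]
  refine (boundSearch_spec hf hj hn hL hR hW₀ hE).mono ?_
  rintro T₁ τ₁ ⟨hT₁, hτ₁, han, hbn, ha, hb⟩
  have hE₁ := hE.frame hτ₁ fun y h => by simp only [BoundReg, TempReg]; omega
  have k₁ : ∀ y, 20 ≤ y → (y < f + 4 ∨ f + 8 ≤ y) → τ₁.reg y = σ.reg y := fun y h h' =>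
    hτ₁.reg y (by simp only [BoundReg, TempReg]; omega)
  obtain ⟨a, h4⟩ : ∃ a, τ₁.reg (f + 4) = a := ⟨_, rfl⟩
  obtain ⟨b, h5⟩ : ∃ b, τ₁.reg (f + 5) = b := ⟨_, rfl⟩
  rw [h4] at han ha
  rw [h5] at hbn hb
  -- If `b < a`, the point of rank `b` would lie below the lower side, hence not above the upper
  -- side, and its rank would have to be smaller than `b`.
  have hab : a ≤ b := by
    by_contra hab
    obtain ⟨v, hv, hvb⟩ : ∃ v < n, rk j v = b := by
      refine ⟨mem (8 + 2 * j * n + b), hR.perm.lt b (by omega), ?_⟩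
      rw [hrk _ (hR.perm.lt b (by omega)), hR.rank b (by omega)]
    rw [hrk v hv] at hvb
    have h1 := (ha v hv).2 (by omega)
    have h2 := (hb v hv).1 (h1.le.trans hq)
    omega
  rw [wp_seq]
  refine (blockSetup_spec hf hj hL0 hw (by omega) hE₁
    (by rw [k₁ _ (by omega) (by omega), hB])).mono ?_
  rintro T₂ τ₂ ⟨hT₂, hτ₂, h8, h9⟩
  have hE₂ := hE₁.frame hτ₂ fun y h => by simp only [TempReg]; omega
  have k₂ : ∀ y, 20 ≤ y → y < f + 8 → τ₂.reg y = τ₁.reg y := fun y h h' =>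
    hτ₂.reg y (by simp only [TempReg]; omega)
  have k₂' : ∀ y, 20 ≤ y → y < f + 4 → τ₂.reg y = σ.reg y := fun y h h' => by
    rw [k₂ _ h (by omega), k₁ _ h (by omega)]
  rw [wp_seq]
  refine (descent_spec (x := f + 5) (B := B) hf (by omega) hj hL hsub hw hE₂ hA hrkn hDSj hW hbn
    hlr hrn (by rw [k₂ _ (by omega) (by omega), h5]) (by rw [k₂' _ (by omega) (by omega), hl])
    (by rw [k₂' _ (by omega) (by omega), hr]) h8 h9).mono ?_
  rintro T₃ τ₃ ⟨hT₃, hτ₃, h14⟩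
  rw [wp_seq]
  simp only [wp_instr, Instr.Fits, Instr.exec, true_and]
  rw [wp_seq]
  have hτ₃' : Frame d (fun y => DescentReg f y ∨ y = f + 3) τ₂
      (τ₃.setReg (f + 3) (τ₃.reg (f + 14))) := by
    refine (hτ₃.mono fun y h => Or.inl h).trans ⟨fun y hy => ?_, fun _ _ => rfl, rfl, rfl⟩
    have : y ≠ f + 3 := fun h => hy (Or.inr h)
    simp [State.setReg, this]
  have h3 : (τ₃.setReg (f + 3) (τ₃.reg (f + 14))).reg (f + 3) = τ₃.reg (f + 14) := by
    simp [State.setReg]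
  generalize τ₃.setReg (f + 3) (τ₃.reg (f + 14)) = τ₄ at *
  have hE₃ := hE₂.frame hτ₃' fun y h => by simp only [DescentReg, TempReg]; omega
  have k₃ : ∀ y, 20 ≤ y → y < f + 10 → y ≠ f + 3 → τ₄.reg y = τ₂.reg y := fun y h h' h'' =>
    hτ₃'.reg y (by simp only [DescentReg, TempReg]; omega)
  have k₃' : ∀ y, 20 ≤ y → y < f + 3 → τ₄.reg y = σ.reg y := fun y h h' => by
    rw [k₃ _ h (by omega) (by omega), k₂' _ h (by omega)]
  refine (descent_spec (x := f + 4) (B := B) hf (by omega) hj hL hsub hw hE₃ hA hrkn hDSj hW han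
    hlr hrn (by rw [k₃ _ (by omega) (by omega) (by omega), k₂ _ (by omega) (by omega), h4])
    (by rw [k₃' _ (by omega) (by omega), hl]) (by rw [k₃' _ (by omega) (by omega), hr])
    (by rw [k₃ _ (by omega) (by omega) (by omega), h8])
    (by rw [k₃ _ (by omega) (by omega) (by omega), h9])).mono ?_
  rintro T₅ τ₅ ⟨hT₅, hτ₅, h14'⟩
  have h3' : τ₅.reg (f + 3) = τ₃.reg (f + 14) := by
    rw [hτ₅.reg _ (by simp only [DescentReg, TempReg]; omega), h3]
  have e : L * (94 + 2 * t) = 42 * L + (L * (26 + t) + L * (26 + t)) := by ring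
  simp only [wp_instr, Instr.Fits, Instr.exec, true_and]
  refine ⟨by omega, (((((hτ₁.mono fun y h => ?_).trans (hτ₂.mono fun y h => ?_)).trans
    (hτ₃'.mono fun y h => ?_)).trans (hτ₅.mono fun y h => ?_)).trans
    ⟨fun y hy => ?_, fun _ _ => rfl, rfl, rfl⟩), ?_⟩
  · simp only [BoundReg, QueryReg, TempReg] at *; omega
  · simp only [QueryReg, TempReg] at *; omega
  · simp only [DescentReg, QueryReg, TempReg] at *; omega
  · simp only [DescentReg, QueryReg, TempReg] at *; omega
  · have : y ≠ f + 3 := fun h => hy (Or.inr h.ge)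
    simp [State.setReg, this]
  · simp only [State.setReg, Function.update_self]
    -- The ranks admitted by the closed side are those from `a` up to `b`, so the two one-sided
    -- counts are subtracted; `hab` makes the difference correct.
    rw [h3', h14, h14', ← cntP_between hab, Nat.add_sub_cancel]
    refine cntP_congr fun i _ hi => ?_
    have hAi := hA i (by omega)
    rw [hrk _ hAi, ← hb _ hAi, ← not_lt, ← ha _ hAi, not_lt]

/-! ### Querying all restricted coordinates -/

/-- The query is a proper restriction of the cell in the coordinate `j`. -/
def Restricts (d : ℕ) (q : ℕ → ℝ) (j : ℕ) : Prop :=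
  q (2 * d + j) < q j ∨ q (d + j) < q (3 * d + j)

/-- Count the points of the range that satisfy the query in the last `e` coordinates, given the
structure for `m` constrained coordinates. -/
def queryCoords (d : ℕ) : ℕ → ℕ → ℕ → Prog
  | 0, f, _ => .instr (.sub (f + 3) (f + 1) f)
  | _ + 1, f, 0 => .instr (.sub (f + 3) (f + 1) f)
  | m + 1, f, e + 1 =>
    .ite (.rlt (2 * d + (d - (e + 1))) (d - (e + 1)))
      (coordQuery d m (d - (e + 1)) f (queryCoords d m (f + 16) e))
      (.ite (.rlt (d + (d - (e + 1))) (3 * d + (d - (e + 1))))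
        (coordQuery d m (d - (e + 1)) f (queryCoords d m (f + 16) e))
        (queryCoords d (m + 1) f e))

/-- A bound on the time of a query with `k` restricted coordinates. -/
def queryTime (d L : ℕ) : ℕ → ℕ
  | 0 => 2 * d + 1
  | k + 1 => 2 * d + (L * (94 + 2 * queryTime d L k) + 6 * d + 40)

theorem range_sub_spec {W d n L m f : ℕ} {q rm : ℕ → ℝ} {mem : ℕ → ℕ} {rk : ℕ → ℕ → ℕ}
    {ψ : ℕ → Prop} (hψ : ∀ v < n, ψ v) {t : ℕ} (ht : 1 ≤ t) :
    Counts W d n L q rm mem rk m f t ψ (.instr (.sub (f + 3) (f + 1) f)) := by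
  intro σ A l r B hE hl hr hB hlr hrn hA hDS hW
  simp only [wp_instr, Instr.Fits, Instr.exec, State.setReg, Function.update_self, hl, hr]
  refine ⟨trivial, ht, ⟨fun y hy => ?_, fun _ _ => rfl, rfl, rfl⟩,
    (cntP_true fun i _ hi => hψ _ (hA i (by omega))).symm⟩
  have : y ≠ f + 3 := fun h => hy (Or.inr h.ge)
  simp [this]

/-- A restricted coordinate uses up one stage of the structure, an unrestricted one only two tests;
hence the nested inductions on `m` and on `e`. The stages suffice because `m` is at least the number
of restricted coordinates ahead, and at `m = 0` the whole range counts. `queryTime` sets aside `2 *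
d` steps for tests, of which the bound keeps the `2 * e` that may still be needed. -/
theorem queryCoords_spec {W d n L : ℕ} {q rm : ℕ → ℝ} {mem : ℕ → ℕ} {rk : ℕ → ℕ → ℕ}
    (hn : 0 < n) (hL : n < 2 ^ L)
    (hR : ∀ j < d, Ranked (fun v => rm (v * d + j)) mem n (8 + 2 * j * n))
    (hrk : ∀ j < d, ∀ v < n, rk j v = mem (8 + 2 * j * n + n + v)) (hq : ∀ j < d, q j ≤ q (d + j))
    (hW₀ : dsBase d n + 2 * n + 2 < W) (m : ℕ) (hm : m ≤ d) :
    ∀ e ≤ d, ∀ f, 20 ≤ f → cntP (Restricts d q) (d - e) d ≤ m →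
      Counts W d n L q rm mem rk m f
        (queryTime d L (cntP (Restricts d q) (d - e) d) - 2 * d + 2 * e)
        (fun v => ∀ j, d - e ≤ j → j < d → Restricts d q j →
          q j ≤ rm (v * d + j) ∧ rm (v * d + j) ≤ q (d + j)) (queryCoords d m f e) := by
  -- Ensures that the subtraction of `2 * d` in the time bound is not truncated.
  have hpos : ∀ k, 2 * d + 1 ≤ queryTime d L k := by
    rintro (_ | k) <;> simp only [queryTime] <;> omega
  induction m with
  | zero =>
    intro e he f hf hk
    rw [queryCoords]
    refine range_sub_spec (fun v hv j hj hjd hr => ?_)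
      (by have := hpos (cntP (Restricts d q) (d - e) d); omega)
    exact absurd hr (cntP_eq_zero.1 (Nat.le_zero.1 hk) j hj hjd)
  | succ m ihm =>
    intro e
    induction e with
    | zero =>
      intro he f hf hk
      rw [queryCoords]
      exact range_sub_spec (fun v hv j hj hjd hr => by omega)
        (by have := hpos (cntP (Restricts d q) (d - 0) d); omega)
    | succ e ihe =>
      intro he f hf hk
      rw [queryCoords]
      obtain ⟨j, hj⟩ : ∃ j, d - (e + 1) = j := ⟨_, rfl⟩
      have hje : d - e = j + 1 := by omega
      have hjd : j < d := by omega
      have hsplit := cntP_append (Restricts d q) (l := j) (m := j + 1) (r := d) (by omega) hjd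
      rw [hj] at hk ⊢
      have key : Restricts d q j → ∀ (σ : State) (A : ℕ → ℕ) (l r B : ℕ),
          QueryEnv d n L q rm mem σ → σ.reg f = l → σ.reg (f + 1) = r → σ.reg (f + 2) = B →
          l ≤ r → r ≤ n → (∀ i < n, A i < n) → DS d n L rk mem (m + 1) A B →
          B + dsSize d n L (m + 1) + 2 * n + 2 < W →
          WP W (coordQuery d m j f (queryCoords d m (f + 16) e)) σ fun T τ =>
            T ≤ queryTime d L (cntP (Restricts d q) j d) - 2 * d ∧
            Frame d (QueryReg f) σ τ ∧ τ.reg (f + 3) = cntP (fun i => ∀ j', j ≤ j' → j' < d →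
              Restricts d q j' → q j' ≤ rm (A i * d + j') ∧ rm (A i * d + j') ≤ q (d + j'))
              l r := by
        intro hres σ A l r B hE hl hr hB hlr hrn hA hDS hW
        have hone : cntP (Restricts d q) j (j + 1) = 1 := by
          rw [cntP_true fun i h h' => by obtain rfl : i = j := by omega
                                         exact hres]
          omega
        rw [hone] at hsplit
        have ih := ihm (by omega) e (by omega) (f + 16) (by omega) (by rw [hje]; omega)
        rw [hje] at ih
        refine (coordQuery_spec hf hjd hn hL (hR j hjd) (hrk j hjd) (hq j hjd) hW₀ ih hE hl hr hB
          hlr hrn hA hDS hW).mono ?_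
        rintro T τ ⟨hT, hτ, e3⟩
        refine ⟨?_, hτ, ?_⟩
        · rw [hsplit, add_comm 1]
          simp only [queryTime]
          have h1 := hpos (cntP (Restricts d q) (j + 1) d)
          have h2 : L * (94 + 2 *
              (queryTime d L (cntP (Restricts d q) (j + 1) d) - 2 * d + 2 * e)) ≤
              L * (94 + 2 * queryTime d L (cntP (Restricts d q) (j + 1) d)) := by
            gcongr; omega
          omega
        · rw [e3]
          refine cntP_congr fun i _ _ => ⟨fun h j' h1 h2 h3 => ?_, fun h => ⟨h j le_rfl hjd hres,
            fun j' h1 h2 h3 => h j' (by omega) h2 h3⟩⟩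
          rcases h1.eq_or_lt with rfl | h1
          · exact h.1
          · exact h.2 j' h1 h2 h3
      intro σ A l r B hE hl hr hB hlr hrn hA hDS hW
      have e1 : σ.rreg j = q j := hE.rreg _ (by omega)
      have e2 : σ.rreg (2 * d + j) = q (2 * d + j) := hE.rreg _ (by omega)
      have e3 : σ.rreg (d + j) = q (d + j) := hE.rreg _ (by omega)
      have e4 : σ.rreg (3 * d + j) = q (3 * d + j) := hE.rreg _ (by omega)
      rw [wp_ite]
      simp only [Test.Holds, e1, e2]
      refine ⟨fun h => (key (Or.inl h) σ A l r B hE hl hr hB hlr hrn hA hDS hW).mono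
        fun T τ h => ⟨by omega, h.2⟩, fun h => ?_⟩
      rw [wp_ite]
      simp only [Test.Holds, e3, e4]
      refine ⟨fun h => (key (Or.inr h) σ A l r B hE hl hr hB hlr hrn hA hDS hW).mono
        fun T τ h => ⟨by omega, h.2⟩, fun h' => ?_⟩
      have hres : ¬ Restricts d q j := not_or.2 ⟨h, h'⟩
      have hzero : cntP (Restricts d q) j (j + 1) = 0 :=
        cntP_eq_zero.2 fun i h h' => by
          obtain rfl : i = j := by omega
          exact hres
      rw [hzero, zero_add] at hsplit
      have ih := ihe (by omega) f hf (by rw [hje]; omega)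
      rw [hje] at ih
      refine (ih σ A l r B hE hl hr hB hlr hrn hA hDS hW).mono ?_
      rintro T τ ⟨hT, hτ, e3⟩
      refine ⟨by rw [hsplit]; omega, hτ, ?_⟩
      rw [e3]
      refine cntP_congr fun i _ _ => ⟨fun h j' h1 h2 h3 => ?_, fun h j' h1 h2 h3 =>
        h j' (by omega) h2 h3⟩
      rcases h1.eq_or_lt with rfl | h1
      · exact absurd h3 hres
      · exact h j' h1 h2 h3

theorem zkey_congr {d : ℕ} (hd : 0 < d) {x y : ℕ → ℝ} (h : ∀ j < d, x j = y j) :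
    zkey d x = zkey d y := by
  refine congrArg toLex (funext fun m => ?_)
  simp only [h _ (Nat.mod_lt m hd)]

/-! ### The cell as an interval of the Z-order -/

/-- Decide whether the point with index in register `10` precedes, in the Z-order, the end of the
cell whose corners are in the real registers from `2 * d` and from `3 * d` on. -/
def beforeEnd (d : ℕ) : Prog :=
  negate (conj (negate (zLess d (fetchPoint d 10) (fetchReg (2 * d))))
    (negate (inBox d (fetchPoint d 10) (2 * d) (3 * d) d)))

/-- The upper corner of the cell does not mark its end in the Z-order, as points outside the cell
may come in between. The end is described instead as being before the lower corner or inside the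
cell; the program computes this disjunction as a negated conjunction. -/
theorem beforeEnd_spec {W d n v : ℕ} (hd : 0 < d) (hW : 2 < W) (hn : n * d < W) {σ : State}
    (h1 : σ.reg 1 = 1) (hv : σ.reg 10 = v) (hvn : v < n) :
    Decides W d (44 * d + 12) (beforeEnd d) σ
      (zkey d (fun j => σ.rmem (v * d + j)) < zkey d (fun j => σ.rreg (2 * d + j)) ∨
        ∀ j < d, σ.rreg (2 * d + j) ≤ σ.rmem (v * d + j) ∧
          σ.rmem (v * d + j) < σ.rreg (3 * d + j)) := by
  have hf := fetches_point hn (Or.inl rfl) hv hvn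
  refine (negate_spec hW h1 (conj_spec h1
    (negate_spec hW h1 (zLess_spec hW hd hf (fetches_reg (by omega) σ)))
    (ψ := ¬ ∀ j < d, σ.rreg (2 * d + j) ≤ σ.rmem (v * d + j) ∧
      σ.rmem (v * d + j) < σ.rreg (3 * d + j)) (c' := 30 * d + 2 + 2)
    fun τ hτ => ?_)).congr ?_ (by omega)
  · have e1 : τ.reg 1 = 1 := by rw [hτ.reg 1 (by simp [LeafReg]), h1]
    refine negate_spec hW e1 ((inBox_spec hW (hf.congr hτ) e1 (by omega) (by omega)
      le_rfl).congr ?_ le_rfl)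
    refine forall₂_congr fun i hi => ?_
    rw [hτ.rreg _ (by omega), hτ.rreg _ (by omega)]
  · rw [← not_or, not_not]

/-- Find the range of the points of the cell in the Z-order, in the registers `24` and `25`. -/
def cellSearch (d : ℕ) : Prog :=
  .block [.const 15 (2 * d), .mul 15 15 2, .const 16 8, .add 26 16 15, .copy 27 26]
    (.seq (bsearch 24 (zLess d (fetchPoint d 10) (fetchReg (2 * d))))
      (bsearch 25 (beforeEnd d)))

/-- Both searched properties are initial segments of the Z-order: the first by transitivity, the
second by `InCell.of_zkey_le`. Their difference is the cell, since no point of the cell precedes its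
lower corner. -/
theorem cellSearch_spec {W d n L ℓ : ℕ} {idx : ℕ → ℕ} {q rm : ℕ → ℝ} {mem : ℕ → ℕ} (hd : 0 < d)
    (hn : 0 < n) (hL : n < 2 ^ L)
    (hR : Ranked (fun v => zkey d fun j => rm (v * d + j)) mem n (8 + 2 * d * n))
    (hlo : ∀ j < d, q (2 * d + j) = (idx j : ℝ) / 2 ^ ℓ)
    (hhi : ∀ j < d, q (3 * d + j) = ((idx j : ℝ) + 1) / 2 ^ ℓ)
    (hW : dsBase d n + 2 * n + 2 < W) {σ : State} (hE : QueryEnv d n L q rm mem σ) :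
    WP W (cellSearch d) σ fun T τ => T ≤ L * (58 * d + 30) + 11 ∧ Frame d (10 ≤ ·) σ τ ∧
      τ.reg 24 ≤ τ.reg 25 ∧ τ.reg 25 ≤ n ∧ ∀ i < n, (τ.reg 24 ≤ i ∧ i < τ.reg 25) ↔
        InCell d ℓ idx fun j => rm (mem (8 + 2 * d * n + i) * d + j) := by
  have hreg := region_le (n := n) (le_refl d)
  have hd2 : 2 * d ≤ 2 * d * n := Nat.le_mul_of_pos_right _ hn
  have hnd : n * d ≤ dsBase d n := by unfold dsBase; nlinarith
  have hzlo : zkey d (fun j => q (2 * d + j)) = zkey d (fun j => (idx j : ℝ) / 2 ^ ℓ) :=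
    zkey_congr hd hlo
  have hcell : ∀ v, InCell d ℓ idx (fun j => rm (v * d + j)) ↔ ∀ j < d,
      q (2 * d + j) ≤ rm (v * d + j) ∧ rm (v * d + j) < q (3 * d + j) := fun v =>
    forall₂_congr fun j hj => by rw [hlo j hj, hhi j hj]
  unfold cellSearch
  simp only [Prog.block, wp_seq (p := .instr _), wp_instr, Instr.Fits, Instr.exec,
    State.setReg, Function.update_apply, if_true, if_false, Nat.reduceEqDiff, hE.r2]
  refine ⟨by omega, by omega, by omega, by omega, trivial, ?_⟩
  rw [wp_seq]
  generalize hσ₁ : State.mk _ _ _ _ = σ₁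
  have hF₁ : Frame d (10 ≤ ·) σ σ₁ := by
    subst hσ₁
    refine ⟨fun y hy => ?_, fun _ _ => rfl, rfl, rfl⟩
    have : y ≠ 15 ∧ y ≠ 16 ∧ y ≠ 26 ∧ y ≠ 27 := by omega
    simp [this]
  have hE₁ := hE.frame hF₁ fun y h => by omega
  have s26 : σ₁.reg 26 = 8 + 2 * d * n := by subst hσ₁; simp
  have s27 : σ₁.reg 27 = 8 + 2 * d * n := by subst hσ₁; simp
  clear hσ₁
  have hsorted := hR.sorted
  refine (bsearch_spec (d := d) (K := L) (c := 14 * d + 2) (X := 8 + 2 * d * n)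
    (φ := fun v => zkey d (fun j => rm (v * d + j)) < zkey d (fun j => q (2 * d + j)))
    (R := fun i => mem (8 + 2 * d * n + i)) (by omega)
    (by omega) (by omega) hE₁.r1 hE₁.r2 s26 (fun i _ => by rw [hE₁.mem_eq]) ?_ ?_ hL).mono ?_
  · intro ρ hρ i hi h10
    have hEρ := hE₁.frame hρ fun y h => by simp only [BsearchReg]; omega
    have e : zkey d (fun j => ρ.rreg (2 * d + j)) = zkey d (fun j => q (2 * d + j)) :=
      zkey_congr hd fun j hj => hEρ.rreg _ (by omega)
    refine (zLess_spec (by omega) hd (fetches_point (n := n) (by omega) (Or.inl rfl) h10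
      (hR.perm.lt i hi)) (fetches_reg (by omega) ρ)).congr ?_ le_rfl
    rw [hEρ.rmem_eq, e]
  · exact fun i i' h h' hφ => (hsorted i i' (Nat.zero_le _) h.le h').trans_lt hφ
  rintro T τ ⟨hT, hτ, ha, hφa⟩
  have hEτ := hE₁.frame hτ fun y h => by simp only [BsearchReg]; omega
  have t27 : τ.reg (25 + 2) = 8 + 2 * d * n := by
    rw [hτ.reg _ (by simp only [BsearchReg]; omega), s27]
  refine (bsearch_spec (d := d) (K := L) (c := 44 * d + 12) (X := 8 + 2 * d * n)
    (φ := fun v => zkey d (fun j => rm (v * d + j)) < zkey d (fun j => q (2 * d + j)) ∨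
      InCell d ℓ idx fun j => rm (v * d + j)) (R := fun i => mem (8 + 2 * d * n + i)) (by omega)
    (by omega) (by omega) hEτ.r1 hEτ.r2 t27 (fun i _ => by rw [hEτ.mem_eq]) ?_ ?_ hL).mono ?_
  · intro ρ hρ i hi h10
    have hEρ := hEτ.frame hρ fun y h => by simp only [BsearchReg]; omega
    have e : zkey d (fun j => ρ.rreg (2 * d + j)) = zkey d (fun j => q (2 * d + j)) :=
      zkey_congr hd fun j hj => hEρ.rreg _ (by omega)
    refine (beforeEnd_spec hd (by omega) (n := n) (by omega) hEρ.r1 h10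
      (hR.perm.lt i hi)).congr ?_ le_rfl
    rw [hEρ.rmem_eq, e, hcell]
    refine or_congr Iff.rfl (forall₂_congr fun j hj => ?_)
    rw [hEρ.rreg _ (by omega), hEρ.rreg _ (by omega)]
  · rintro i i' h h' (hφ | hφ)
    · exact Or.inl ((hsorted i i' (Nat.zero_le _) h.le h').trans_lt hφ)
    · rw [hzlo]
      exact hφ.of_zkey_le hd (hsorted i i' (Nat.zero_le _) h.le h')
  rintro U ρ ⟨hU, hρ, hb, hφb⟩
  have e24 : ρ.reg 24 = τ.reg 24 := hρ.reg _ (by simp only [BsearchReg]; omega)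
  rw [e24]
  have e5 : L * (58 * d + 30) = L * (14 * d + 2 + 8) + L * (44 * d + 12 + 8) := by ring
  refine ⟨by omega, (hF₁.trans (hτ.mono fun y h => ?_)).trans (hρ.mono fun y h => ?_), ?_, hb,
    fun i hi => ?_⟩
  · simp only [BsearchReg] at h; omega
  · simp only [BsearchReg] at h; omega
  · by_contra hlt
    have := (hφb (ρ.reg 25) (by omega)).1 (Or.inl ((hφa _ (by omega)).2 (by omega)))
    omega
  · rw [← not_lt, ← hφa i hi, ← hφb i hi]
    constructor
    · rintro ⟨h1, h2 | h2⟩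
      · exact absurd h2 h1
      · exact h2
    · intro h
      refine ⟨?_, Or.inr h⟩
      rw [hzlo]
      exact not_lt.2 (h.le_zkey hd)

/-- Run `p` unless the query rectangle and the cell are disjoint; then the answer is zero. -/
def guard (d : ℕ) (p : Prog) : ℕ → Prog
  | 0 => p
  | j + 1 => .ite (.rlt (d + j) (2 * d + j)) (.instr (.const 0 0))
      (.ite (.rlt j (3 * d + j)) (guard d p j) (.instr (.const 0 0)))

/-- The tests match closed rectangles and half-open cells: equality is allowed at the upper side of
the rectangle but not at the upper side of the cell. If they all succeed the box and the cell meet,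
which is the premise of the face argument. -/
theorem guard_spec {W d t : ℕ} {p : Prog} {σ : State} {Q : State → Prop} (hW : 0 < W) (ht : 1 ≤ t)
    {j : ℕ} (hmeet : (∀ i < j, σ.rreg (2 * d + i) ≤ σ.rreg (d + i) ∧
      σ.rreg i < σ.rreg (3 * d + i)) → WP W p σ fun T τ => T ≤ t ∧ Q τ)
    (hdisj : (¬ ∀ i < j, σ.rreg (2 * d + i) ≤ σ.rreg (d + i) ∧ σ.rreg i < σ.rreg (3 * d + i)) →
      Q (σ.setReg 0 0)) :
    WP W (guard d p j) σ fun T τ => T ≤ 2 * j + t ∧ Q τ := by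
  induction j with
  | zero => exact (hmeet (by simp)).mono fun T τ h => ⟨by omega, h.2⟩
  | succ j ih =>
    rw [guard, wp_ite]
    simp only [Test.Holds, wp_instr, Instr.Fits, Instr.exec]
    refine ⟨fun h => ⟨hW, by omega, hdisj fun hh => absurd h (not_lt.2 (hh j (by omega)).1)⟩,
      fun h => ?_⟩
    rw [wp_ite]
    simp only [Test.Holds, wp_instr, Instr.Fits, Instr.exec]
    refine ⟨fun h' => (ih (fun hh => hmeet fun i hi => ?_) fun hh => hdisj fun hh' =>
      hh fun i hi => hh' i (by omega)).mono fun T τ h => ⟨by omega, h.2⟩,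
      fun h' => ⟨hW, by omega, hdisj fun hh => absurd (hh j (by omega)).2 h'⟩⟩
    rcases Nat.lt_succ_iff_lt_or_eq.1 hi with h1 | rfl
    · exact hh i h1
    · exact ⟨not_lt.1 h, h'⟩

/-! ### The complete query -/

/-- The part of the query for a rectangle and a cell that meet. -/
def meetQuery (d : ℕ) : Prog :=
  .seq (.block [.const 1 1, .const 10 0, .load 2 10, .load 3 1, .const 10 2] (.instr (.load 4 10)))
    (.seq (cellSearch d)
      (.seq (.block [.const 15 (2 * (d + 1)), .mul 15 15 2, .const 16 8, .add 22 16 15,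
          .copy 20 24] (.instr (.copy 21 25)))
        (.seq (queryCoords d (d - 1) 20 d) (.instr (.copy 0 23)))))

/-- The query. -/
def queryProg (d : ℕ) : Prog := guard d (meetQuery d) d

theorem queryTime_mono {d L : ℕ} (hL : 0 < L) : Monotone (queryTime d L) := by
  refine monotone_nat_of_le_succ fun k => ?_
  have : 1 * (94 + 2 * queryTime d L k) ≤ L * (94 + 2 * queryTime d L k) :=
    Nat.mul_le_mul_right _ hL
  rw [queryTime]
  omega

/-- The bound on the number of restricted coordinates is available only if rectangle and cell meet;
otherwise the guard answers zero. With `k ≤ d - 1`, a structure with `d - 1` stages is enough. -/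
theorem queryProg_spec {W d n L ℓ k : ℕ} {idx : ℕ → ℕ} {q rm : ℕ → ℝ} {mem : ℕ → ℕ} (hd : 0 < d)
    (hn : 0 < n) (hL : n < 2 ^ L) (hdata : Data d n L rm mem)
    (hlo : ∀ j < d, q (2 * d + j) = (idx j : ℝ) / 2 ^ ℓ)
    (hhi : ∀ j < d, q (3 * d + j) = ((idx j : ℝ) + 1) / 2 ^ ℓ) (hq : ∀ j < d, q j ≤ q (d + j))
    (hkd : k ≤ d - 1) (hk : (∀ j < d, q (2 * d + j) ≤ q (d + j) ∧ q j < q (3 * d + j)) →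
      cntP (Restricts d q) 0 d ≤ k)
    (hW : dsBase d n + dsSize d n L (d - 1) + 2 * n + 2 < W) {σ : State}
    (hrreg : ∀ r < 4 * d, σ.rreg r = q r) (hmem : σ.mem = mem) (hrmem : σ.rmem = rm) :
    WP W (queryProg d) σ fun T τ =>
      T ≤ 2 * d + (queryTime d L k + L * (58 * d + 30) + 24) ∧ τ.mem = mem ∧ τ.rmem = rm ∧
      τ.reg 0 = cntP (fun v => (InCell d ℓ idx fun j => rm (v * d + j)) ∧
        ∀ j < d, q j ≤ rm (v * d + j) ∧ rm (v * d + j) ≤ q (d + j)) 0 n := by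
  have hL0 : 0 < L := by
    rcases Nat.eq_zero_or_pos L with rfl | h
    · simp at hL; omega
    · exact h
  have hdn : 2 * (d + 1) ≤ 2 * (d + 1) * n := Nat.le_mul_of_pos_right _ hn
  have hbase : 8 + 2 * (d + 1) * n = dsBase d n := rfl
  have heq : (∀ i < d, σ.rreg (2 * d + i) ≤ σ.rreg (d + i) ∧ σ.rreg i < σ.rreg (3 * d + i)) ↔
      ∀ j < d, q (2 * d + j) ≤ q (d + j) ∧ q j < q (3 * d + j) := by
    refine forall₂_congr fun j hj => ?_
    rw [hrreg _ (by omega), hrreg _ (by omega), hrreg _ (by omega), hrreg _ (by omega)]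
  refine guard_spec (by omega) (by omega) (fun hmeet => ?_) fun hdisj => ?_
  · rw [heq] at hmeet
    have hk := hk hmeet
    have hsorted := hdata.zranked.perm
    unfold meetQuery
    rw [wp_seq]
    simp only [Prog.block, wp_seq (p := .instr _), wp_instr, Instr.Fits, Instr.exec,
      State.setReg, Function.update_apply, if_true, if_false, OfNat.one_ne_ofNat, hmem, hdata.m0, hdata.m1,
      hdata.m2]
    refine ⟨by omega, by omega, trivial, trivial, by omega, trivial, ?_⟩
    generalize hσ₁ : State.mk _ _ _ _ = σ₁
    have hE₁ : QueryEnv d n L q rm mem σ₁ := by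
      subst hσ₁
      exact ⟨by simp, by simp, by simp, by simp, hrreg, rfl, hrmem⟩
    clear hσ₁
    rw [wp_seq]
    refine (cellSearch_spec hd hn hL hdata.zranked hlo hhi (by omega) hE₁).mono ?_
    rintro T₂ τ₂ ⟨hT₂, hτ₂, hlr, hrn, hcell⟩
    have hE₂ := hE₁.frame hτ₂ fun y h => by omega
    obtain ⟨l, hl⟩ : ∃ l, τ₂.reg 24 = l := ⟨_, rfl⟩
    obtain ⟨r, hr⟩ : ∃ r, τ₂.reg 25 = r := ⟨_, rfl⟩
    simp only [hl, hr] at hlr hrn hcell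
    rw [wp_seq]
    simp only [wp_seq (p := .instr _), wp_instr, Instr.Fits, Instr.exec,
      State.setReg, Function.update_apply, if_true, if_false, Nat.reduceEqDiff,
      hE₂.r2, hl, hr, hbase]
    refine ⟨by omega, by omega, by omega, by omega, trivial, trivial, ?_⟩
    generalize hσ₃ : State.mk _ _ _ _ = σ₃
    have hF₃ : Frame d (10 ≤ ·) τ₂ σ₃ := by
      subst hσ₃
      refine ⟨fun y hy => ?_, fun _ _ => rfl, rfl, rfl⟩
      have : y ≠ 15 ∧ y ≠ 16 ∧ y ≠ 20 ∧ y ≠ 21 ∧ y ≠ 22 := by omega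
      simp [this]
    have hE₃ := hE₂.frame hF₃ fun y h => by omega
    have s20 : σ₃.reg 20 = l := by subst hσ₃; simp
    have s21 : σ₃.reg 21 = r := by subst hσ₃; simp
    have s22 : σ₃.reg 22 = dsBase d n := by subst hσ₃; simp
    clear hσ₃
    obtain ⟨rk, A, hrk, hA, hDS⟩ := hdata.ds
    have hAn : ∀ i < n, A i < n := fun i hi => by rw [hA i hi]; exact hdata.zranked.perm.lt i hi
    have hsub : d - d = 0 := Nat.sub_self d
    rw [wp_seq]
    refine (queryCoords_spec (W := W) hn hL hdata.ranked hrk hq (by omega) (d - 1) (by omega) d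
      le_rfl 20 le_rfl (by rw [hsub]; omega) σ₃ A l r (dsBase d n) hE₃ s20 s21 s22 hlr hrn hAn hDS
      (by omega)).mono ?_
    rintro T₄ τ₄ ⟨hT₄, hτ₄, e23⟩
    have hE₄ := hE₃.frame hτ₄ fun y h => by simp only [QueryReg, TempReg]; omega
    simp only [wp_instr, Instr.Fits, Instr.exec, State.setReg, Function.update_self, true_and]
    refine ⟨?_, hE₄.mem_eq, hE₄.rmem_eq, ?_⟩
    · rw [hsub] at hT₄
      have h1 := queryTime_mono (d := d) hL0 hk
      have h2 : 2 * d ≤ queryTime d L (cntP (Restricts d q) 0 d) := by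
        rcases cntP (Restricts d q) 0 d with _ | k <;> simp only [queryTime] <;> omega
      omega
    -- The count over point indices becomes one over positions in the Z-order. Positions before and
    -- after the range found by the search contribute nothing, as their points are not in the cell.
    · rw [e23, hsub, ← hdata.zranked.perm.cntP, cntP_append _ (Nat.zero_le l) (hlr.trans hrn),
        cntP_append _ hlr hrn, (cntP_eq_zero (l := 0) (r := l)).2,
        (cntP_eq_zero (l := r) (r := n)).2, zero_add, add_zero]
      · refine cntP_congr fun i h h' => ?_
        have hin := (hcell i (by omega)).1 ⟨h, h'⟩
        rw [hA i (by omega)]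
        simp only [hin, true_and]
        refine ⟨fun hh j hj => ?_, fun hh j _ hj _ => hh j hj⟩
        by_cases hres : Restricts d q j
        · exact hh j (Nat.zero_le _) hj hres
        -- In an unrestricted coordinate the side of the rectangle covers that of the cell, so being
        -- in the cell already implies the condition.
        · simp only [Restricts, not_or, not_lt] at hres
          have h1 := hin j hj
          rw [← hlo j hj, ← hhi j hj] at h1
          exact ⟨hres.1.trans h1.1, h1.2.le.trans hres.2⟩
      · intro i h h' hh
        have := (hcell i h').2 hh.1
        omega
      · intro i h h' hh
        have := (hcell i (by omega)).2 hh.1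
        omega
  · rw [heq] at hdisj
    refine ⟨hmem, hrmem, ?_⟩
    simp only [State.setReg, Function.update_self]
    refine (cntP_eq_zero.2 fun v _ _ hv => hdisj fun j hj => ?_).symm
    have h1 := hv.1 j hj
    have h2 := hv.2 j hj
    rw [hlo j hj, hhi j hj]
    exact ⟨h1.1.trans h2.2, h2.1.trans_lt h1.2⟩

/-! ## Bounds -/

/-- Adding `3 * n` absorbs the `2 * n + 1` words of a block and makes the recursion multiplicative
with factor `d * L + 1`. -/
theorem dsSize_le {d n L : ℕ} (hn : 0 < n) (m : ℕ) :
    dsSize d n L m + 3 * n ≤ 3 * n * (d * L + 1) ^ m := by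
  induction m with
  | zero => simp [dsSize]
  | succ m ih =>
    calc dsSize d n L (m + 1) + 3 * n
        ≤ d * L * (3 * n + dsSize d n L m) + (3 * n + dsSize d n L m) := by
          rw [dsSize]; gcongr <;> omega
      _ = (dsSize d n L m + 3 * n) * (d * L + 1) := by ring
      _ ≤ 3 * n * (d * L + 1) ^ m * (d * L + 1) := by gcongr
      _ = 3 * n * (d * L + 1) ^ (m + 1) := by ring

/-- The same device as for the size: the shift `(6 * d + 68) * n` dominates the time spent on a
level outside the nested call, together with the setup for the coordinate. -/
theorem buildTime_le {d n L m : ℕ} (hd : 0 < d) (hn : 0 < n) (hL : 0 < L) (hm : m ≤ d) :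
    buildTime d n L m + (6 * d + 68) * n ≤ (6 * d + 69) * n * (d * L + 1) ^ m := by
  induction m with
  | zero => simp only [buildTime, pow_zero, mul_one]; rw [add_mul _ 69, add_mul _ 68]; omega
  | succ m ih =>
    have h1 : 1 ≤ d * L := Nat.mul_pos hd hL
    have h2 : 6 * m + 15 ≤ L * (6 * m + 15) := Nat.le_mul_of_pos_left _ hL
    have h3 : 6 * d ≤ 6 * d * n := Nat.le_mul_of_pos_right _ hn
    calc buildTime d n L (m + 1) + (6 * d + 68) * n
        ≤ d * (L * (6 * m + 15) + L * (n * 37 + 15 + buildTime d n L m)) + d * L +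
            (6 * d + 68) * n := by
          rw [buildTime]; gcongr
      _ = d * L * (6 * m + 31 + n * 37 + buildTime d n L m) + (6 * d + 68) * n := by ring
      _ ≤ d * L * (buildTime d n L m + (6 * d + 68) * n) +
            (buildTime d n L m + (6 * d + 68) * n) := by
          refine Nat.add_le_add (Nat.mul_le_mul_left _ ?_) (Nat.le_add_left _ _)
          rw [add_mul]; omega
      _ = (buildTime d n L m + (6 * d + 68) * n) * (d * L + 1) := by ring
      _ ≤ (6 * d + 69) * n * (d * L + 1) ^ m * (d * L + 1) := by gcongr; exact ih (by omega)
      _ = (6 * d + 69) * n * (d * L + 1) ^ (m + 1) := by ring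

/-- The shift `8 * d + 134` equals `(8 * d + 40) + 94`, all the cost of one coordinate apart from
its nested queries; with it, one coordinate multiplies the time by at most `2 * L`. -/
theorem queryTime_le {d L : ℕ} (hL : 0 < L) (k : ℕ) :
    queryTime d L k + (8 * d + 134) ≤ 2 * (8 * d + 134) * (2 * L) ^ k := by
  induction k with
  | zero => simp only [queryTime, pow_zero, mul_one]; omega
  | succ k ih =>
    have h1 : 8 * d + 40 ≤ L * (8 * d + 40) := Nat.le_mul_of_pos_left _ hL
    have h2 : 8 * d + 134 ≤ L * (8 * d + 134) := Nat.le_mul_of_pos_left _ hL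
    calc queryTime d L (k + 1) + (8 * d + 134)
        ≤ L * (8 * d + 40) + L * (94 + 2 * queryTime d L k) + L * (8 * d + 134) := by
          rw [queryTime]; omega
      _ = (queryTime d L k + (8 * d + 134)) * (2 * L) := by ring
      _ ≤ 2 * (8 * d + 134) * (2 * L) ^ k * (2 * L) := by gcongr
      _ = 2 * (8 * d + 134) * (2 * L) ^ (k + 1) := by ring

theorem mul_add_one_le {d L : ℕ} (hL : 0 < L) : d * L + 1 ≤ (d + 1) * L := by
  rw [add_mul, one_mul]; omega

/-- The memory fits into words whose length is proportional to that of `n`. -/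
theorem memory_lt_pow {d n : ℕ} (hd : 0 < d) (hn : 2 ≤ n) :
    dsBase d n + dsSize d n (Nat.log 2 n + 1) (d - 1) + 2 * n + 2 <
      n ^ (3 * (d + 1) ^ (d - 1) + 2 * d + 16 + d) := by
  have hlog : Nat.log 2 n + 1 ≤ n := Nat.log_lt_self 2 (by omega)
  obtain ⟨e, rfl⟩ : ∃ e, d = e + 1 := ⟨d - 1, by omega⟩
  rw [Nat.add_sub_cancel]
  have h1 := dsSize_le (d := e + 1) (L := Nat.log 2 n + 1) (show 0 < n by omega) e
  have h2 : ((e + 1) * (Nat.log 2 n + 1) + 1) ^ e ≤ ((e + 1 + 1) * n) ^ e :=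
    Nat.pow_le_pow_left ((mul_add_one_le (by omega)).trans (by gcongr)) e
  have h3 : n ≤ n ^ (e + 1) := Nat.le_self_pow (by omega) n
  have h4 : dsBase (e + 1) n + dsSize (e + 1) n (Nat.log 2 n + 1) e + 2 * n + 2 ≤
      (3 * (e + 1 + 1) ^ e + 2 * (e + 1) + 16) * n ^ (e + 1) := by
    calc dsBase (e + 1) n + dsSize (e + 1) n (Nat.log 2 n + 1) e + 2 * n + 2
        ≤ (2 * (e + 1) + 16) * n + 3 * n * ((e + 1 + 1) * n) ^ e := by
          have h5 : 3 * n * ((e + 1) * (Nat.log 2 n + 1) + 1) ^ e ≤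
            3 * n * ((e + 1 + 1) * n) ^ e := Nat.mul_le_mul_left _ h2
          have h6 : 2 * (e + 1 + 1) * n = 2 * (e + 1) * n + 2 * n := by ring
          unfold dsBase
          rw [add_mul _ 16]
          omega
      _ ≤ (2 * (e + 1) + 16) * n ^ (e + 1) + 3 * n * ((e + 1 + 1) * n) ^ e := by gcongr
      _ = _ := by rw [mul_pow]; ring
  rw [pow_add n _ (e + 1)]
  refine h4.trans_lt (Nat.mul_lt_mul_of_pos_right ?_ (by positivity))
  -- The constant factor is absorbed into the exponent by `a < 2 ^ a ≤ n ^ a`, so one exponent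
  -- serves all `n ≥ 2`.
  exact Nat.lt_two_pow_self.trans_le (Nat.pow_le_pow_left hn _)

/-- A query sees only the first words of the memory; the data lie entirely within them. -/
theorem Data.congr {d n L : ℕ} {rm : ℕ → ℝ} {mem mem' : ℕ → ℕ} (h : Data d n L rm mem)
    (hm : ∀ x < dsBase d n + dsSize d n L (d - 1), mem' x = mem x) : Data d n L rm mem' := by
  have hb : 8 ≤ dsBase d n := by unfold dsBase; omega
  have hz := region_le (n := n) (le_refl d)
  obtain ⟨rk, A, hrk, hA, hDS⟩ := h.ds
  refine ⟨?_, ?_, ?_, fun j hj => ?_, ?_, rk, A, fun j hj v hv => ?_, fun i hi => ?_, ?_⟩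
  · rw [hm _ (by omega), h.m0]
  · rw [hm _ (by omega), h.m1]
  · rw [hm _ (by omega), h.m2]
  · have := region_le (n := n) hj.le
    exact (h.ranked j hj).congr fun x _ hx => hm x (by omega)
  · exact h.zranked.congr fun x _ hx => hm x (by omega)
  · have := region_le (n := n) hj.le
    rw [hm _ (by omega), hrk j hj v hv]
  · rw [hm _ (by omega), hA i hi]
  · exact hDS.congr fun x _ hx => hm x hx

theorem cntP_eq_ncard (P : ℕ → Prop) (n : ℕ) : cntP P 0 n = {v : Fin n | P v}.ncard := by
  classical
  rw [← Set.ncard_image_of_injective _ Fin.val_injective, cntP, ← Set.ncard_coe_finset]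
  congr 1
  ext v
  simp only [Finset.coe_filter, Finset.mem_Ico, Nat.zero_le, true_and, Set.mem_ofPred_eq,
    Set.mem_image]
  exact ⟨fun h => ⟨⟨v, h.1⟩, h.2, rfl⟩, by rintro ⟨u, hu, rfl⟩; exact ⟨u.2, hu⟩⟩

/-! ## Faces -/

/-- If a cell meets a rectangle but none of its faces of dimension less than `t`, then the rectangle
is a proper restriction of the cell in at most `d - t` coordinates. -/
theorem ncard_restricted_le {d t : ℕ} {Q : Rect d} {c : Cell d}
    (hface : ∀ F : Rect d, F.IsFace Q → F.dim < t → Disjoint F.pts c.pts)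
    (hmeet : ∀ j, c.lo j ≤ Q.hi j ∧ Q.lo j < c.hi j) :
    {j | c.lo j < Q.lo j ∨ Q.hi j < c.hi j}.ncard + t ≤ d := by
  classical
  have hc : ∀ j, c.lo j < c.hi j := fun j => by unfold Cell.lo Cell.hi; gcongr; simp
  -- Pin each cut coordinate to a side of `Q` that cuts the cell, preferring the lower side if both
  -- do, and keep the full side of `Q` elsewhere.
  let F : Rect d :=
    { lo := fun j => if c.lo j < Q.lo j then Q.lo j else if Q.hi j < c.hi j then Q.hi j else Q.lo j
      hi := fun j => if c.lo j < Q.lo j then Q.lo j else Q.hi j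
      lo_le_hi := fun j => by
        have := Q.lo_le_hi j
        split_ifs <;> first | exact le_rfl | exact this }
  have hF : F.IsFace Q := fun j => by
    dsimp only [F]
    split_ifs <;> simp
  have hdim : t ≤ F.dim := by
    by_contra hlt
    -- A common point of the face and the cell: the pinned value in a cut coordinate, and the lower
    -- corner of the cell in the others, where it lies within the side of `Q`.
    let x := fun j =>
      if c.lo j < Q.lo j then Q.lo j else if Q.hi j < c.hi j then Q.hi j else c.lo j
    have hxF : x ∈ F.pts := fun j => by
      have h1 := hmeet j
      dsimp only [F, x]
      split_ifs with h2 h3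
      · simp
      · simp
      · exact ⟨not_lt.1 h2, h1.1⟩
    have hxc : x ∈ c.pts := fun j => by
      have h1 := hmeet j
      dsimp only [x]
      split_ifs with h2 h3
      · exact ⟨h2.le, h1.2⟩
      · exact ⟨h1.1, h3⟩
      · exact ⟨le_rfl, hc j⟩
    exact Set.disjoint_left.1 (hface F hF (not_le.1 hlt)) hxF hxc
  -- The face has positive length only along coordinates that are not cut, so `t` of them remain
  -- uncut.
  have hsub : F.dim ≤ ({j | c.lo j < Q.lo j ∨ Q.hi j < c.hi j}ᶜ).ncard := by
    refine Set.ncard_le_ncard (fun j hj hj' => ?_) (Set.toFinite _)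
    simp only [Set.mem_ofPred_eq, F] at hj
    split_ifs at hj with h2 h3
    · exact lt_irrefl _ hj
    · exact lt_irrefl _ hj
    · exact hj'.elim h2 h3
  have hcard := Set.ncard_add_ncard_compl {j | c.lo j < Q.lo j ∨ Q.hi j < c.hi j}
  rw [Nat.card_eq_fintype_card, Fintype.card_fin] at hcard
  omega

theorem one_le_logb {n : ℕ} (hn : 2 ≤ n) : 1 ≤ Real.logb 2 n := by
  rw [Real.le_logb_iff_rpow_le (by norm_num) (by positivity), Real.rpow_one]
  exact_mod_cast hn

/-- For `n ≥ 2` the logarithm is at least `1`, so rounding and the additional bit cost at most a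
factor `2`. -/
theorem natLog_add_one_le {n : ℕ} (hn : 2 ≤ n) :
    ((Nat.log 2 n + 1 : ℕ) : ℝ) ≤ 2 * Real.logb 2 n := by
  have h1 := one_le_logb hn
  have h2 := Real.natLog_le_logb n 2
  push_cast at h2 ⊢
  linarith

theorem cast_pow_le {d n m : ℕ} (hn : 2 ≤ n) :
    (((d * (Nat.log 2 n + 1) + 1) ^ m : ℕ) : ℝ) ≤
      (2 * (d + 1)) ^ m * Real.logb 2 n ^ m := by
  rw [← mul_pow, Nat.cast_pow]
  refine pow_le_pow_left₀ (Nat.cast_nonneg _) ?_ m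
  have h1 : ((d * (Nat.log 2 n + 1) + 1 : ℕ) : ℝ) ≤ (d + 1) * (Nat.log 2 n + 1 : ℕ) := by
    exact_mod_cast mul_add_one_le (d := d) (Nat.succ_pos (Nat.log 2 n))
  have h2 := mul_le_mul_of_nonneg_left (natLog_add_one_le hn) (by positivity : (0 : ℝ) ≤ d + 1)
  linarith

theorem build_time_bound {d n T : ℕ} (hd : 2 ≤ d) (hn : 2 ≤ n)
    (hT : T ≤ (100 * d + 200) * (n * (Nat.log 2 n + 1)) +
      buildTime d n (Nat.log 2 n + 1) (d - 1)) :
    (T : ℝ) ≤ (2 * (100 * d + 200) + (6 * d + 69) * (2 * (d + 1)) ^ (d - 1)) *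
      (n * Real.logb 2 n ^ (d - 1)) := by
  have h1 := one_le_logb hn
  have h2 := natLog_add_one_le hn
  have h3 : Real.logb 2 n ≤ Real.logb 2 n ^ (d - 1) := le_self_pow₀ h1 (by omega)
  have h4 := cast_pow_le (d := d) (m := d - 1) hn
  have h5 : T ≤ (100 * d + 200) * (n * (Nat.log 2 n + 1)) +
      (6 * d + 69) * n * (d * (Nat.log 2 n + 1) + 1) ^ (d - 1) := by
    have := buildTime_le (d := d) (n := n) (L := Nat.log 2 n + 1) (m := d - 1) (by omega)
      (by omega) (by omega) (by omega)
    omega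
  generalize Real.logb 2 n = lg at *
  generalize Nat.log 2 n + 1 = L at *
  generalize (d * L + 1) ^ (d - 1) = X at *
  calc (T : ℝ) ≤ (100 * d + 200) * (n * L) + (6 * d + 69) * n * X := by exact_mod_cast h5
    _ ≤ (100 * d + 200) * (n * (2 * lg ^ (d - 1))) +
          (6 * d + 69) * n * ((2 * (d + 1)) ^ (d - 1) * lg ^ (d - 1)) := by
        gcongr
        linarith
    _ = _ := by ring

theorem size_bound {d n : ℕ} (hd : 2 ≤ d) (hn : 2 ≤ n) :
    ((dsBase d n + dsSize d n (Nat.log 2 n + 1) (d - 1) : ℕ) : ℝ) ≤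
      (2 * d + 10 + 3 * (2 * (d + 1)) ^ (d - 1)) * (n * Real.logb 2 n ^ (d - 1)) := by
  have h1 := one_le_logb hn
  have h3 : 1 ≤ Real.logb 2 n ^ (d - 1) := one_le_pow₀ h1
  have h4 := cast_pow_le (d := d) (m := d - 1) hn
  have h5 : dsBase d n + dsSize d n (Nat.log 2 n + 1) (d - 1) ≤
      (2 * d + 10) * n + 3 * n * (d * (Nat.log 2 n + 1) + 1) ^ (d - 1) := by
    have := dsSize_le (d := d) (L := Nat.log 2 n + 1) (show 0 < n by omega) (d - 1)
    have e : 2 * (d + 1) * n + 8 * n = (2 * d + 10) * n := by ring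
    unfold dsBase
    omega
  generalize Real.logb 2 n = lg at *
  generalize dsBase d n + dsSize d n (Nat.log 2 n + 1) (d - 1) = S at *
  generalize (d * (Nat.log 2 n + 1) + 1) ^ (d - 1) = X at *
  calc (S : ℝ) ≤ (2 * d + 10) * (n * 1) + 3 * n * X := by rw [mul_one]; exact_mod_cast h5
    _ ≤ (2 * d + 10) * (n * lg ^ (d - 1)) +
          3 * n * ((2 * (d + 1)) ^ (d - 1) * lg ^ (d - 1)) := by gcongr
    _ = _ := by ring

theorem query_time_bound {d n k U : ℕ} (hn : 2 ≤ n) (hk : k ≤ d)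
    (hU : U ≤ 2 * d + (queryTime d (Nat.log 2 n + 1) k +
      (Nat.log 2 n + 1) * (58 * d + 30) + 24)) :
    (U : ℝ) ≤ (118 * d + 84 + 2 * (8 * d + 134) * 4 ^ d) *
      (Real.logb 2 n ^ k + Real.logb 2 n) := by
  have h1 := one_le_logb hn
  have h2 := natLog_add_one_le hn
  have h3 : U ≤ 2 * d + 24 + (Nat.log 2 n + 1) * (58 * d + 30) +
      2 * (8 * d + 134) * (2 * (Nat.log 2 n + 1)) ^ k := by
    have := queryTime_le (d := d) (Nat.succ_pos (Nat.log 2 n)) k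
    simp only [Nat.succ_eq_add_one] at this
    omega
  generalize Real.logb 2 n = lg at *
  generalize Nat.log 2 n + 1 = L at *
  have h4 : ((2 : ℝ) * L) ^ k ≤ 4 ^ d * lg ^ k := by
    calc ((2 : ℝ) * L) ^ k ≤ (4 * lg) ^ k := by
          refine pow_le_pow_left₀ (by positivity) (by linarith) k
      _ = 4 ^ k * lg ^ k := mul_pow ..
      _ ≤ 4 ^ d * lg ^ k := by gcongr; norm_num
  calc (U : ℝ) ≤ (2 * d + 24) * 1 + L * (58 * d + 30) + 2 * (8 * d + 134) * (2 * L) ^ k := by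
        rw [mul_one]; exact_mod_cast h3
    _ ≤ (2 * d + 24) * lg + 2 * lg * (58 * d + 30) + 2 * (8 * d + 134) * (4 ^ d * lg ^ k) := by
        gcongr
    _ = (118 * d + 84) * lg + 2 * (8 * d + 134) * 4 ^ d * lg ^ k := by ring
    _ ≤ (118 * d + 84 + 2 * (8 * d + 134) * 4 ^ d) * lg +
          (118 * d + 84 + 2 * (8 * d + 134) * 4 ^ d) * lg ^ k := by
        have : 0 ≤ lg ^ k := by positivity
        have h5 : (0 : ℝ) ≤ 2 * (8 * d + 134) * 4 ^ d := by positivity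
        have h6 : (0 : ℝ) ≤ 118 * d + 84 := by positivity
        exact add_le_add (mul_le_mul_of_nonneg_right (by linarith) (by linarith))
          (mul_le_mul_of_nonneg_right (by linarith) this)
    _ = _ := by ring

/-! ## The input of construction and query -/

theorem inputState_rmem {d n : ℕ} (p : Fin n → Fin d → ℝ) (v : Fin n) (j : Fin d) :
    (inputState p).rmem (v * d + j) = p v j := by
  obtain ⟨h1, h2⟩ := div_mod_of_lt (k := v) j.2
  have hd : 0 < d := j.pos
  simp only [inputState, h1, h2, hd, v.2, and_self, dif_pos]

/-- Beyond the coordinates of the points the real memory is zero, so erasing it from the size of the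
structure on, which is at least `n * d`, has no effect. -/
theorem inputState_rmem_of_le {d n a : ℕ} (p : Fin n → Fin d → ℝ) (ha : n * d ≤ a) :
    (inputState p).rmem a = 0 := by
  refine dif_neg fun h => ?_
  have := (Nat.div_lt_iff_lt_mul h.1).1 h.2
  omega

theorem queryState_rreg {d : ℕ} (σ : State) (S : ℕ) (Q : Rect d) (c : Cell d) (j : Fin d) :
    (queryState σ S Q c).rreg j = Q.lo j ∧ (queryState σ S Q c).rreg (d + j) = Q.hi j ∧
      (queryState σ S Q c).rreg (2 * d + j) = c.lo j ∧
      (queryState σ S Q c).rreg (3 * d + j) = c.hi j := by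
  have hd : 0 < d := j.pos
  obtain ⟨a1, b1⟩ := div_mod_of_lt (k := 1) j.2
  obtain ⟨a2, b2⟩ := div_mod_of_lt (k := 2) j.2
  obtain ⟨a3, b3⟩ := div_mod_of_lt (k := 3) j.2
  rw [one_mul] at a1 b1
  refine ⟨?_, ?_, ?_, ?_⟩ <;>
  simp only [queryState, hd, dif_pos, a1, b1, a2, b2, a3, b3, Nat.div_eq_of_lt j.2,
    Nat.mod_eq_of_lt j.2, if_true, if_false, one_ne_zero, OfNat.ofNat_ne_zero,
    OfNat.ofNat_ne_one, Nat.reduceEqDiff]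

theorem ncard_range_inter {α β : Type*} {p : α → β} (hp : Function.Injective p) (s : Set β) :
    (Set.range p ∩ s).ncard = {v | p v ∈ s}.ncard := by
  rw [← Set.ncard_image_of_injective _ hp]
  congr 1
  ext x
  constructor
  · rintro ⟨⟨v, rfl⟩, h⟩
    exact ⟨v, h, rfl⟩
  · rintro ⟨v, h, rfl⟩
    exact ⟨⟨v, rfl⟩, h⟩

/-- The query, started on a memory that holds the data structure, counts the points. -/
theorem query_correct {d n t W S : ℕ} (ht : 0 < t) (htd : t ≤ d) (hn : 0 < n)
    {p : Fin n → Fin d → ℝ} (hp : Function.Injective p)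
    (hW : dsBase d n + dsSize d n (Nat.log 2 n + 1) (d - 1) + 2 * n + 2 < W)
    (hS : dsBase d n + dsSize d n (Nat.log 2 n + 1) (d - 1) = S) {σ : State}
    (hrm : σ.rmem = (inputState p).rmem)
    (hdata : Data d n (Nat.log 2 n + 1) (inputState p).rmem σ.mem) (Q : Rect d) (c : Cell d)
    (hface : ∀ F : Rect d, F.IsFace Q → F.dim < t → Disjoint F.pts c.pts) :
    WP W (queryProg d) (queryState σ S Q c) fun U τ =>
      U ≤ 2 * d + (queryTime d (Nat.log 2 n + 1) (d - t) +
        (Nat.log 2 n + 1) * (58 * d + 30) + 24) ∧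
      τ.mem = (queryState σ S Q c).mem ∧ τ.rmem = (queryState σ S Q c).rmem ∧
      τ.reg 0 = (Set.range p ∩ (Q.pts ∩ c.pts)).ncard := by
  have hd : 0 < d := by omega
  have hnS : n * d ≤ S := by rw [← hS]; unfold dsBase; nlinarith
  have hrmem : (queryState σ S Q c).rmem = (inputState p).rmem := by
    funext a
    simp only [queryState, hrm]
    split_ifs with h
    · rfl
    · rw [inputState_rmem_of_le p (by omega)]
  have hdata' : Data d n (Nat.log 2 n + 1) (inputState p).rmem (queryState σ S Q c).mem := by
    refine hdata.congr fun x hx => ?_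
    rw [hS] at hx
    simp [queryState, hx]
  have hr := queryState_rreg σ S Q c
  refine (queryProg_spec (L := Nat.log 2 n + 1) (k := d - t) (ℓ := c.level)
    -- The index of the cell is extended to all naturals; the default `0` is never read, as only
    -- coordinates below `d` occur.
    (idx := fun j => if h : j < d then c.index ⟨j, h⟩ else 0)
    (q := (queryState σ S Q c).rreg) (W := W) hd hn (Nat.lt_pow_succ_log_self (by omega) n) hdata'
    (fun j hj => ?_) (fun j hj => ?_) (fun j hj => ?_) (by omega) (fun hmeet => ?_) hW
    (fun _ _ => rfl) rfl hrmem).mono ?_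
  · rw [(hr ⟨j, hj⟩).2.2.1, dif_pos hj, Cell.lo]
  · rw [(hr ⟨j, hj⟩).2.2.2, dif_pos hj, Cell.hi]
  · rw [(hr ⟨j, hj⟩).1, (hr ⟨j, hj⟩).2.1]
    exact Q.lo_le_hi _
  -- The only use of the hypothesis on faces: it limits the restricted coordinates to `d - t`, which
  -- sets the exponent of the logarithm.
  · have := ncard_restricted_le hface fun j => by
      have := hmeet j j.2
      rwa [(hr j).1, (hr j).2.1, (hr j).2.2.1, (hr j).2.2.2] at this
    rw [cntP_eq_ncard]
    simp only [Restricts, fun j => (hr j).1, fun j => (hr j).2.1, fun j => (hr j).2.2.1,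
      fun j => (hr j).2.2.2]
    omega
  · rintro U τ ⟨hU, hmem, hrmem', h0⟩
    refine ⟨hU, hmem, hrmem'.trans hrmem.symm, ?_⟩
    rw [h0, cntP_eq_ncard, ncard_range_inter hp]
    congr 1
    ext v
    simp only [Set.mem_ofPred_eq, Set.mem_inter_iff, Rect.pts, Cell.pts, InCell]
    rw [and_comm]
    refine and_congr ⟨fun h j => ?_, fun h j hj => ?_⟩ ⟨fun h j => ?_, fun h j hj => ?_⟩
    · have := h j j.2
      rwa [(hr j).1, (hr j).2.1, inputState_rmem] at this
    · have := h ⟨j, hj⟩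
      rwa [← (hr ⟨j, hj⟩).1, ← (hr ⟨j, hj⟩).2.1, ← inputState_rmem p] at this
    · have := h j j.2
      rwa [dif_pos j.2, inputState_rmem] at this
    · have := h ⟨j, hj⟩
      rw [← inputState_rmem p, Cell.lo, Cell.hi] at this
      rwa [dif_pos hj]

end RangeCount

theorem mainTheorem9 (d : ℕ) (hd : 2 ≤ d) :
    ∃ (build query : RangeCount.Prog) (κ : ℕ) (C : ℝ),
      ∀ (n : ℕ), 2 ≤ n →
      ∀ p : Fin n → Fin d → ℝ, Function.Injective p → (∀ i j, p i j ∈ Set.Ico (0 : ℝ) 1) →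
      ∃ (T S : ℕ) (σ : RangeCount.State),
        RangeCount.Runs (n ^ κ) build (RangeCount.inputState p) T σ ∧
        (T : ℝ) ≤ C * (n * Real.logb 2 n ^ (d - 1)) ∧
        (S : ℝ) ≤ C * (n * Real.logb 2 n ^ (d - 1)) ∧
        ∀ (t : ℕ), 0 < t → t ≤ d →
        ∀ (Q : RangeCount.Rect d) (c : RangeCount.Cell d),
          RangeCount.CompressedCell (Set.range p) c →
          (∀ F : RangeCount.Rect d, F.IsFace Q → F.dim < t → Disjoint F.pts c.pts) →
          ∃ (U : ℕ) (τ : RangeCount.State),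
            RangeCount.Runs (n ^ κ) query (RangeCount.queryState σ S Q c) U τ ∧
            τ.reg 0 = (Set.range p ∩ (Q.pts ∩ c.pts)).ncard ∧
            τ.mem = (RangeCount.queryState σ S Q c).mem ∧
            τ.rmem = (RangeCount.queryState σ S Q c).rmem ∧
            (U : ℝ) ≤ C * (Real.logb 2 n ^ (d - t) + Real.logb 2 n) := by
  obtain ⟨C₁, hC₁⟩ : ∃ C : ℝ, C = 2 * (100 * d + 200) + (6 * d + 69) * (2 * (d + 1)) ^ (d - 1) :=
    ⟨_, rfl⟩
  obtain ⟨C₂, hC₂⟩ : ∃ C : ℝ, C = 2 * d + 10 + 3 * (2 * (d + 1)) ^ (d - 1) :=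
    ⟨_, rfl⟩
  obtain ⟨C₃, hC₃⟩ : ∃ C : ℝ, C = 118 * d + 84 + 2 * (8 * d + 134) * 4 ^ d := ⟨_, rfl⟩
  have h₁ : 0 ≤ C₁ := by rw [hC₁]; positivity
  have h₂ : 0 ≤ C₂ := by rw [hC₂]; positivity
  have h₃ : 0 ≤ C₃ := by rw [hC₃]; positivity
  -- The three constants, for building time, size and query time, are nonnegative, so their sum
  -- serves for all three bounds.
  refine ⟨RangeCount.buildProg d, RangeCount.queryProg d,
    3 * (d + 1) ^ (d - 1) + 2 * d + 16 + d, C₁ + C₂ + C₃, fun n hn p hp _ => ?_⟩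
  have hW := RangeCount.memory_lt_pow (d := d) (by omega) hn
  have hlog := RangeCount.one_le_logb hn
  have hlog₀ : 0 ≤ Real.logb 2 n := zero_le_one.trans hlog
  have hpos : 0 ≤ n * Real.logb 2 n ^ (d - 1) := by positivity
  obtain ⟨T, σ, hruns, hT, hrm, hdata⟩ :=
    RangeCount.buildProg_spec (d := d) (n := n) (σ₀ := RangeCount.inputState p) (by omega)
      (by omega) hW rfl
  -- One length covers both memories: the words of the whole structure, and the `n * d` reals of the
  -- input, which are fewer.
  refine ⟨T, RangeCount.dsBase d n + RangeCount.dsSize d n (Nat.log 2 n + 1) (d - 1), σ, hruns,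
    ?_, ?_, fun t ht htd Q c _ hface => ?_⟩
  · exact (hC₁ ▸ RangeCount.build_time_bound hd hn hT).trans
      (mul_le_mul_of_nonneg_right (by linarith) hpos)
  · exact (hC₂ ▸ RangeCount.size_bound hd hn).trans
      (mul_le_mul_of_nonneg_right (by linarith) hpos)
  · obtain ⟨U, τ, hruns', hU, hmem, hrmem, h0⟩ :=
      RangeCount.query_correct ht htd (by omega) hp hW rfl hrm hdata Q c hface
    have hpos' : 0 ≤ Real.logb 2 n ^ (d - t) + Real.logb 2 n := by positivity
    exact ⟨U, τ, hruns', h0, hmem, hrmem,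
      (hC₃ ▸ RangeCount.query_time_bound hn (Nat.sub_le _ _) hU).trans
        (mul_le_mul_of_nonneg_right (by linarith) hpos')⟩
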